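/- Let $T$ be a signed ground tree: a finite tree on a vertex set $V=V^-\sqcup V^+$ with $\nu=|V|\ge 1$ elements, partitioned into negative and positive vertices. **Spines.** A *signed spine* on $T$ is a directed tree $S$ whose nodes are labeled by the parts of a partition of $V$ into non-empty sets, such that at each node with label $U$ the source label sets of the different incoming arcs are subsets of distinct connected components of $T\smallsetminus (U\cap V^-)$ and the sink label sets of the different outgoing arcs are subsets of distinct connected components of $T\smallsetminus(U\cap V^+)$. Here the source label set $\mathrm{sc}(r)$ (resp. sink label set) of an arc $r$ is the union of the labels in the component of $S\smallsetminus r$ containing the source (resp. the target) of $r$. A signed spine is *maximal* if it is not obtained from another signed spine by contracting arcs. In that case the labels are singletons, and $S$ is regarded as a directed tree on $V$. For $u,v\in V$ write $u\le_S v$ if there is a directed path (possibly trivial) in $S$ from the node containing $u$ to the node containing $v$. For a linear order $\prec$ on $V$, $\kappa(\prec)$ denotes the unique maximal signed spine $S$ on $T$ of which $\prec$ is a linear extension (i.e. $u \prec v$ whenever there is a non-trivial directed path in $S$ from $u$ to $v$). **Polytopes.** Let $\mathbb H=\{x\in\mathbb R^V:\sum_v x_v=\binom{\nu+1}2\}$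 and $\mathbf H^{\ge}(U)=\{x\in\mathbb R^V:\sum_{u\in U}x_u\ge\binom{|U|+1}2\}$. For a bijection $\sigma:[\nu]\to V$ let $\mathbf p(\sigma)=\sum_i i\,e_{\sigma(i)}$, and let $\mathrm{Perm}(V)$ be the convex hull of all $\mathbf p(\sigma)$. A subset $B\subseteq V$ is a *signed building block* if every negative vertex on the path of $T$ between two elements of $B$ is in $B$, and every positive vertex on the path of $T$ between two elements of $V\smallsetminus B$ is in $V\smallsetminus B$. Let $\mathrm{Asso}(T)$ be the intersection of $\mathbb H$ with the $\mathbf H^{\ge}(B)$ for all signed building blocks $B$, and $\mathrm{Para}(T)$ the intersection of $\mathbb H$ with the $\mathbf H^{\ge}(X)$ for the vertex sets $X$ of the two components of $T\smallsetminus e$, for all edges $e$ of $T$. For a maximal signed spine $S$, let $\mathbf a(S)\in\mathbb R^V$ have coordinates $\mathbf a(S)_v=|\{\pi: v\in\pi,\ r_v\notin\pi\}|$ for $v\in V^-$ and $\mathbf a(S)_v=\nu+1-|\{\pi: v\in\pi,\ r_v\notin\pi\}|$ for $v\in V^+$, where $\pi$ ranges over the undirected simple paths of $S$ (including the trivial ones)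 and $r_v$ is the outgoing (resp. incoming) arc at $v$ if $v\in V^-$ (resp. $v\in V^+$); there is at most one such arc, and if there is none the condition $r_v\notin\pi$ is void. **Cones.** For a preposet $R$ on $V$ let $C(R)=\{x\in\mathbb H: x_u\le x_v\text{ whenever } u\mathrel R v\}$ be its braid cone and $C^*(R)=\mathrm{cone}\{e_u-e_v: u\mathrel R v\}$ its incidence cone. Write $C(S),C^*(S)$ for $R={\le_S}$ and $C(\prec),C^*(\prec)$ for the reflexive closure of $\prec$. The cone of a polytope $P$ at a vertex $p$ is $\mathrm{cone}\{x-p:x\in P\}$, and its normal cone at $p$ is $\{g\in\mathbb H:\max_{x\in P}\langle g,x\rangle=\langle g,p\rangle\}$. **Statement.** (1) Let $S$ be a maximal signed spine on $T$, let $\prec$ be a linear order on $V$, and let $\sigma:[\nu]\to V$ be the bijection with $\sigma(1)\prec\dots\prec\sigma(\nu)$. The following are equivalent: - (i) $\mathbf a(S)=\mathbf p(\sigma)$; - (ii) $C^*(S)=C^*(\prec)$; equivalently, the cone of $\mathrm{Asso}(T)$ at $\mathbf a(S)$ equals the cone of $\mathrm{Perm}(V)$ at $\mathbf p(\sigma)$;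 - (iii) $C(S)=C(\prec)$; equivalently, the normal cone of $\mathrm{Asso}(T)$ at $\mathbf a(S)$ equals the normal cone of $\mathrm{Perm}(V)$ at $\mathbf p(\sigma)$; - (iv) $\kappa^{-1}(S)=\{\prec\}$; - (v) $S$ is a directed path whose $i$-th node is labeled by $\{\sigma(i)\}$, for all $i\in[\nu]$; - (vi) $S$ is a directed path whose transitive closure is $\prec$; - (vii) for all $i,j\in[\nu-1]$, the sets $\sigma([i])$ and $\sigma([j])$ are nested source label sets of arcs of $S$. (2) If $\nu\ge 2$, then the polytopes $\mathrm{Perm}(V)$, $\mathrm{Asso}(T)$ and $\mathrm{Para}(T)$ have exactly two vertices in common if $T$ is a path, and no common vertex otherwise. -/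

import Mathlib

/-- A signed ground tree on `V`: a tree with vertex set `V`, with `V` partitioned into the set `neg`
of negative vertices and its complement, the set of positive vertices. -/
structure SignedTree (V : Type*) where
  graph : SimpleGraph V
  isTree : graph.IsTree
  neg : Set V

/-- A directed graph whose nodes are labeled by the non-empty parts of a partition of `V`.
The partition is `same` (`u` and `v` are in the label of the same node), so that nodes are
identified with their labels; `arc u v` says that there is an arc from the node whose label contains
`u` to the node whose label contains `v`. -/
@[ext]
structure LabeledDigraph (V : Type*) where
  same : Setoid V
  arc : V → V → Prop
  arc_congr : ∀ u u' v v', same u u' → same v v' → arc u v → arc u' v'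

namespace LabeledDigraph

variable {V : Type*} (S : LabeledDigraph V)

/-- The nodes. -/
abbrev Node : Type _ := Quotient S.same

/-- The node whose label contains `v`. -/
def node (v : V) : S.Node := Quotient.mk S.same v

/-- The label of the node whose label contains `v`. -/
def label (v : V) : Set V := {x | S.same v x}

/-- There is an arc from the node `A` to the node `B`. -/
def NodeArc (A B : S.Node) : Prop := ∃ u v, S.node u = A ∧ S.node v = B ∧ S.arc u v

/-- The underlying undirected graph on the nodes. -/
def graph : SimpleGraph S.Node := SimpleGraph.fromRel S.NodeArc

/-- The labeled digraph is a directed tree: an orientation of a tree. -/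
def IsDirectedTree : Prop := S.graph.IsTree ∧ ∀ u v, S.arc u v → ¬ S.arc v u

/-- The source label set `sc(r)` of the arc `r` from the node of `u` to the node of `v`: the union of
the labels in the connected component of `S ∖ {r}` containing the source of `r`. -/
def sourceSet (u v : V) : Set V :=
  {x | (S.graph.deleteEdges {s(S.node u, S.node v)}).Reachable (S.node u) (S.node x)}

/-- The sink label set `sk(r)` of the arc `r` from the node of `u` to the node of `v`. -/
def sinkSet (u v : V) : Set V :=
  {x | (S.graph.deleteEdges {s(S.node u, S.node v)}).Reachable (S.node v) (S.node x)}

/-- `B` is the source label set of some arc. -/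
def IsSourceSet (B : Set V) : Prop := ∃ u v, S.arc u v ∧ S.sourceSet u v = B

/-- The contraction of the arc from the node of `u` to the node of `v`: the two nodes are merged and
the other arcs are kept. -/
def contract (u v : V) : LabeledDigraph V where
  same :=
    { r := fun x y => S.same x y ∨
        ((S.same u x ∨ S.same v x) ∧ (S.same u y ∨ S.same v y))
      iseqv :=
        { refl := fun x => Or.inl (S.same.refl x)
          symm := by
            rintro x y (h | ⟨h, h'⟩)
            · exact Or.inl (S.same.symm h)
            · exact Or.inr ⟨h', h⟩
          trans := by
            rintro x y z (h | ⟨h, h'⟩) (k | ⟨k, k'⟩)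
            · exact Or.inl (S.same.trans h k)
            · exact Or.inr ⟨k.imp (fun t => S.same.trans t (S.same.symm h))
                (fun t => S.same.trans t (S.same.symm h)), k'⟩
            · exact Or.inr ⟨h, h'.imp (fun t => S.same.trans t k) (fun t => S.same.trans t k)⟩
            · exact Or.inr ⟨h, k'⟩ } }
  arc := fun x y =>
    ¬ (S.same x y ∨ ((S.same u x ∨ S.same v x) ∧ (S.same u y ∨ S.same v y))) ∧
    ∃ x' y', (S.same x x' ∨ ((S.same u x ∨ S.same v x) ∧ (S.same u x' ∨ S.same v x'))) ∧
      (S.same y y' ∨ ((S.same u y ∨ S.same v y) ∧ (S.same u y' ∨ S.same v y'))) ∧ S.arc x' y'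
  arc_congr := by
    intro a a' b b' ha hb
    have key : ∀ {x y z : V},
        (S.same x y ∨ ((S.same u x ∨ S.same v x) ∧ (S.same u y ∨ S.same v y))) →
        (S.same y z ∨ ((S.same u y ∨ S.same v y) ∧ (S.same u z ∨ S.same v z))) →
        (S.same x z ∨ ((S.same u x ∨ S.same v x) ∧ (S.same u z ∨ S.same v z))) := by
      rintro x y z (h | ⟨h, h'⟩) (k | ⟨k, k'⟩)
      · exact Or.inl (S.same.trans h k)
      · exact Or.inr ⟨k.imp (fun t => S.same.trans t (S.same.symm h))
          (fun t => S.same.trans t (S.same.symm h)), k'⟩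
      · exact Or.inr ⟨h, h'.imp (fun t => S.same.trans t k) (fun t => S.same.trans t k)⟩
      · exact Or.inr ⟨h, k'⟩
    have symm : ∀ {x y : V},
        (S.same x y ∨ ((S.same u x ∨ S.same v x) ∧ (S.same u y ∨ S.same v y))) →
        (S.same y x ∨ ((S.same u y ∨ S.same v y) ∧ (S.same u x ∨ S.same v x))) := by
      rintro x y (h | ⟨h, h'⟩)
      · exact Or.inl (S.same.symm h)
      · exact Or.inr ⟨h', h⟩
    rintro ⟨hn, x', y', hx, hy, hxy⟩
    exact ⟨fun h => hn (key (key ha h) (symm hb)), x', y', key (symm ha) hx, key (symm hb) hy, hxy⟩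

/-- `S'.Refines S`: the labeled digraph `S` is obtained from `S'` by contracting arcs. -/
def Refines (S' S : LabeledDigraph V) : Prop :=
  Relation.ReflTransGen
    (fun S₁ S₂ : LabeledDigraph V => ∃ u v, S₁.arc u v ∧ S₂ = S₁.contract u v) S' S

/-- `u` appears strictly below `v`: there is a directed path with at least one arc from the node of
`u` to the node of `v`. -/
def Below (u v : V) : Prop := Relation.TransGen S.arc u v

/-- The preposet on `V` given by the (reflexive and) transitive closure. -/
def Le (u v : V) : Prop := S.same u v ∨ S.Below u v

/-- The linear order `lt` is a linear extension of the transitive closure. -/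
def IsLinearExtension (lt : V → V → Prop) : Prop := ∀ u v, S.Below u v → lt u v

/-- The nodes and arcs form a directed path. -/
def IsDirectedPath : Prop :=
  ∃ (n : ℕ) (e : Fin n ≃ S.Node), ∀ i j, S.NodeArc (e i) (e j) ↔ (i : ℕ) + 1 = j

/-- The set of all undirected simple paths, including the trivial ones. A path and its reverse are
the same path, so a path is recorded as the subgraph it traverses. -/
def paths : Set S.graph.Subgraph :=
  {H | ∃ (A B : S.Node) (p : S.graph.Walk A B), p.IsPath ∧ H = p.toSubgraph}

/-- The paths which contain the node of `v` but no outgoing arc of this node. -/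
def pathsAvoidingOut (v : V) : Set S.graph.Subgraph :=
  {H ∈ S.paths | S.node v ∈ H.verts ∧ ∀ w, S.arc v w → ¬ H.Adj (S.node v) (S.node w)}

/-- The paths which contain the node of `v` but no incoming arc of this node. -/
def pathsAvoidingIn (v : V) : Set S.graph.Subgraph :=
  {H ∈ S.paths | S.node v ∈ H.verts ∧ ∀ w, S.arc w v → ¬ H.Adj (S.node w) (S.node v)}

end LabeledDigraph

/-- The affine hyperplane of `ℝ^V` where the coordinates sum to `ν(ν+1)/2`, for `ν = |V|`. -/
def hyperplaneH (V : Type*) [Fintype V] : Set (V → ℝ) :=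
  {x | ∑ v, x v = ((Fintype.card V + 1).choose 2 : ℝ)}

/-- The half-space of the points `x` with `∑_{u ∈ U} x_u ≥ |U|(|U|+1)/2`. -/
def halfSpace {V : Type*} (U : Finset V) : Set (V → ℝ) :=
  {x | ((U.card + 1).choose 2 : ℝ) ≤ ∑ u ∈ U, x u}

/-- The point `p(σ) = ∑ i e_{σ(i)}`; here `Fin ν` is indexed from `0`. -/
def permVertex {V : Type*} [Fintype V] (σ : Fin (Fintype.card V) ≃ V) : V → ℝ :=
  fun v => ((σ.symm v : ℕ) : ℝ) + 1

/-- The permutahedron. -/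
def Perm (V : Type*) [Fintype V] : Set (V → ℝ) :=
  convexHull ℝ (Set.range (permVertex (V := V)))

/-- The braid cone `C(R)` of a preposet `R`. -/
def braidCone {V : Type*} [Fintype V] (R : V → V → Prop) : Set (V → ℝ) :=
  {x ∈ hyperplaneH V | ∀ u v, R u v → x u ≤ x v}

open Classical in
/-- The incidence cone `C*(R)` of a preposet `R`: the cone spanned by the vectors `e_u - e_v` for
`u ≤ v`. It is the polar of the (linear) cone of all `x` with `x_u ≤ x_v` for `u ≤ v`. -/
noncomputable def incidenceCone {V : Type*} (R : V → V → Prop) : PointedCone ℝ (V → ℝ) :=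
  PointedCone.hull ℝ {y | ∃ u v, R u v ∧ y = Pi.single u 1 - Pi.single v 1}

/-- The cone of the polytope `P` at its vertex `p`. -/
def vertexCone {V : Type*} (P : Set (V → ℝ)) (p : V → ℝ) : PointedCone ℝ (V → ℝ) :=
  PointedCone.hull ℝ {y | ∃ x ∈ P, y = x - p}

/-- The normal cone of the polytope `P` at its vertex `p`: the functionals (represented in the
hyperplane `hyperplaneH V`) whose maximum over `P` is attained at `p`. -/
def normalConeAt {V : Type*} [Fintype V] (P : Set (V → ℝ)) (p : V → ℝ) : Set (V → ℝ) :=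
  {g ∈ hyperplaneH V | IsGreatest ((fun x => ∑ v, g v * x v) '' P) (∑ v, g v * p v)}

namespace SignedTree

variable {V : Type*} (T : SignedTree V)

/-- The vertices `x` and `y` are outside `X` and in the same connected component of `T ∖ X`. -/
def SameComponent (X : Set V) (x y : V) : Prop :=
  ∃ (hx : x ∈ Xᶜ) (hy : y ∈ Xᶜ), (T.graph.induce Xᶜ).Reachable ⟨x, hx⟩ ⟨y, hy⟩

/-- `S` is a signed spine on `T`: a directed tree labeled by a partition of `V` such that, at a node
with label `U = U⁻ ⊔ U⁺`, the source label sets of the different incoming arcs are subsets of distinct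
connected components of `T ∖ U⁻`, and the sink label sets of the different outgoing arcs are subsets
of distinct connected components of `T ∖ U⁺`. -/
structure IsSpine (S : LabeledDigraph V) : Prop where
  isDirectedTree : S.IsDirectedTree
  source_subset : ∀ u w, S.arc u w → ∀ x ∈ S.sourceSet u w, ∀ y ∈ S.sourceSet u w,
    T.SameComponent (S.label w ∩ T.neg) x y
  source_distinct : ∀ u u' w, S.arc u w → S.arc u' w → ¬ S.same u u' →
    ∀ x ∈ S.sourceSet u w, ∀ y ∈ S.sourceSet u' w, ¬ T.SameComponent (S.label w ∩ T.neg) x y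
  sink_subset : ∀ w v, S.arc w v → ∀ x ∈ S.sinkSet w v, ∀ y ∈ S.sinkSet w v,
    T.SameComponent (S.label w ∩ T.negᶜ) x y
  sink_distinct : ∀ w v v', S.arc w v → S.arc w v' → ¬ S.same v v' →
    ∀ x ∈ S.sinkSet w v, ∀ y ∈ S.sinkSet w v', ¬ T.SameComponent (S.label w ∩ T.negᶜ) x y

/-- `S` is a maximal element of the poset of signed spines on `T` ordered by arc contraction. -/
def IsMaximalSpine (S : LabeledDigraph V) : Prop :=
  T.IsSpine S ∧ ∀ S', T.IsSpine S' → S'.Refines S → S' = S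

open Classical in
/-- The map `κ`: the unique maximal signed spine on `T` of which `lt` is a linear extension (with a
default value if there were no such unique spine). -/
noncomputable def kappa (lt : V → V → Prop) : LabeledDigraph V :=
  if h : ∃! S, T.IsMaximalSpine S ∧ S.IsLinearExtension lt then h.choose
  else ⟨⊥, fun _ _ => False, fun _ _ _ _ _ _ h => h⟩

/-- The fiber of `S` under the map `κ` from the (strict) linear orders on `V`. -/
def kappaFiber (S : LabeledDigraph V) : Set (V → V → Prop) :=
  {lt | IsStrictTotalOrder V lt ∧ T.kappa lt = S}

open Classical in
/-- The point `a(S)`. In a maximal signed spine, a negative (resp. positive) node `v` has at most one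
outgoing (resp. incoming) arc `r_v`. -/
noncomputable def assoVertex [Fintype V] (S : LabeledDigraph V) : V → ℝ := fun v =>
  if v ∈ T.neg then ((S.pathsAvoidingOut v).ncard : ℝ)
  else (Fintype.card V : ℝ) + 1 - ((S.pathsAvoidingIn v).ncard : ℝ)

/-- Every vertex of `X` on the path of `T` between two elements of `B` is in `B`. -/
def ConvexFor (X B : Set V) : Prop :=
  ∀ u ∈ B, ∀ w ∈ B, ∀ p : T.graph.Walk u w, p.IsPath → ∀ v ∈ p.support, v ∈ X → v ∈ B

/-- Signed building blocks: negative convex sets with positive convex complement. -/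
def IsBuildingBlock (B : Set V) : Prop := T.ConvexFor T.neg B ∧ T.ConvexFor T.negᶜ Bᶜ

/-- The signed tree associahedron. -/
def Asso [Fintype V] : Set (V → ℝ) :=
  {x ∈ hyperplaneH V | ∀ B : Finset V, T.IsBuildingBlock B → x ∈ halfSpace B}

open Classical in
/-- The vertices of the connected component of `T ∖ {e}` containing `u`, for the edge `e = uv`. -/
noncomputable def edgeSide [Fintype V] (u v : V) : Finset V :=
  {x | (T.graph.deleteEdges {s(u, v)}).Reachable u x}

/-- The parallelepiped defined by the pairs of parallel facets of the signed tree associahedron; these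
are the pairs given by the two components of `T ∖ {e}` for the edges `e` of `T`. -/
def Para [Fintype V] : Set (V → ℝ) :=
  {x ∈ hyperplaneH V | ∀ u v, T.graph.Adj u v → x ∈ halfSpace (T.edgeSide u v)}

/-- The underlying tree is a path. -/
def IsPathTree [Fintype V] : Prop :=
  Nonempty (T.graph ≃g SimpleGraph.pathGraph (Fintype.card V))

/-- The points which are vertices of all three polytopes. -/
def commonVertices [Fintype V] : Set (V → ℝ) :=
  (Perm V).extremePoints ℝ ∩ T.Asso.extremePoints ℝ ∩ T.Para.extremePoints ℝ

end SignedTree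

/-! Everything rests on the source label sets of the arcs of a maximal spine `S`. Deleting an arc of
a directed tree gives a cut crossed by that arc alone, so each source set is a lower set of the
order of `S`. Two vertices are comparable in `S` unless the path joining them turns, at a peak or at
a valley (`turn`).

All statements of (1) are compared with one condition: `lt x y` implies that `x` is below `y` in
`S`. By `below_of_sourcesInitial` it suffices that every source set is an initial segment of `lt`,
and each statement detects this in its own way. The point a(S) satisfies with equality the
inequality of each source set (`sum_assoVertex`), and a permutation point does so only for initial
segments. Sums over source sets are nonnegative on C*(S) and on the cone of Asso(T) at a(S), because
source sets are signed building blocks (`isBuildingBlock_source`). Dually, shifted indicators of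
sink sets lie in C(S). For the normal cones one must first know that a(S) is in Asso(T), which is
extracted from the equality itself. If some source set is not initial, sorting the vertices with
this set first gives a second linear extension. Conversely, under the condition `S` is the path
through σ, its source sets are the initial segments, and Abel summation identifies the cones.

Two facts on spines are needed. Maximal spines have singleton labels, since a vertex can be split
off a larger label (`split_isSpine`, with reversal of arcs and signs for positive vertices). Two
such spines with a common linear extension coincide, because a turn of one contradicts the other at
the same vertex of a path of T (`below_of_arc`). So the fiber of κ over `S` is the set of linear
extensions of `S`.

The tightness of a(S) is a potential argument: counting paths by their pairs of endpoints shows that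
a(S)_v is the deficit at v of a potential on oriented edges, and such deficits telescope over a side
of an edge (`sum_side`).

For (2), at a vertex of Para(T) each edge of T has a tight side. At a permutation point a tight side
is an initial segment, and this forces adjacent vertices of T to be consecutive: T is a path
traversed by σ, in one of two directions. Conversely such a point is a vertex of Para(T), hence of
the smaller polytopes Perm(V) ⊆ Asso(T) containing it. -/

namespace SimpleGraph

/-! ### Branches at a vertex of a tree, and the paths through it. -/

variable {N : Type*} {G : SimpleGraph N}

/-- The vertices on the side of `a` when the edge `ab` is removed. -/
def side (G : SimpleGraph N) (a b : N) : Set N :=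
  {x | (G.deleteEdges {s(a, b)}).Reachable a x}

theorem self_mem_side (a b : N) : a ∈ G.side a b := Reachable.refl _

theorem mem_side_of_adj {a b x y : N} (hx : x ∈ G.side a b) (h : G.Adj x y)
    (hne : s(x, y) ≠ s(a, b)) : y ∈ G.side a b :=
  Reachable.trans hx (Adj.reachable (by simpa [deleteEdges_adj] using ⟨h, by simpa using hne⟩))

theorem IsTree.notMem_side (hG : G.IsTree) {a b : N} (h : G.Adj a b) : b ∉ G.side a b :=
  isBridge_iff.1 (isAcyclic_iff_forall_adj_isBridge.1 hG.isAcyclic h)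

/-- Any other edge survives the deletion and cannot leave the component; the orientation is forced
because `b` is not on the side of `a`. The inductions along edges below end with this fact. -/
theorem IsTree.eq_of_crossing (hG : G.IsTree) {a b x y : N} (h : G.Adj a b) (hxy : G.Adj x y)
    (hx : x ∈ G.side a b) (hy : y ∉ G.side a b) : x = a ∧ y = b := by
  by_contra hne
  refine hy (mem_side_of_adj hx hxy fun he => ?_)
  rcases Sym2.eq_iff.1 he with h' | ⟨rfl, rfl⟩
  · exact hne h'
  · exact hG.notMem_side h hx

theorem induction_adj (hG : G.Connected) {P : N → Prop} (a : N) (ha : P a)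
    (hs : ∀ x y, G.Adj x y → P x → P y) (x : N) : P x := by
  have h := (reachable_iff_reflTransGen a x).1 (hG.preconnected a x)
  induction h with
  | refl => exact ha
  | tail _ hxy ih => exact hs _ _ hxy ih

theorem IsTree.side_swap (hG : G.IsTree) {a b : N} (h : G.Adj a b) :
    G.side b a = (G.side a b)ᶜ := by
  ext x
  constructor
  · intro hx hx'
    refine hG.notMem_side h (Reachable.trans hx' ?_)
    have hx2 : (G.deleteEdges {s(b, a)}).Reachable b x := hx
    rw [Sym2.eq_swap] at hx2
    exact hx2.symm
  · refine induction_adj hG.connected (P := fun x => x ∉ G.side a b → x ∈ G.side b a) a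
      (fun hx => absurd (self_mem_side a b) hx) (fun x y hxy ih hy => ?_) x
    by_cases hx : x ∈ G.side a b
    · rw [(hG.eq_of_crossing h hxy hx hy).2]
      exact self_mem_side _ _
    · by_contra hy'
      obtain ⟨rfl, rfl⟩ := hG.eq_of_crossing h.symm hxy (ih hx) hy'
      exact hy (self_mem_side _ _)

theorem IsTree.exists_mem_side (hG : G.IsTree) {v x : N} (hne : x ≠ v) :
    ∃ w, G.Adj v w ∧ x ∈ G.side w v := by
  revert hne
  refine induction_adj hG.connected (P := fun x => x ≠ v → ∃ w, G.Adj v w ∧ x ∈ G.side w v) v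
      (fun h => absurd rfl h) (fun x y hxy ih hy => ?_) x
  by_cases hx : x = v
  · subst hx
    exact ⟨y, hxy, self_mem_side _ _⟩
  · obtain ⟨w, hw, hxw⟩ := ih hx
    refine ⟨w, hw, ?_⟩
    by_contra hyw
    exact hy (hG.eq_of_crossing hw.symm hxy hxw hyw).2

theorem IsTree.notMem_side_of_ne (hG : G.IsTree) {v w w' x : N} (hw : G.Adj v w)
    (hw' : G.Adj v w') (hne : w ≠ w') (hx : x ∈ G.side w v) : x ∉ G.side w' v := by
  suffices h : x ∈ G.side v w' by rwa [hG.side_swap hw'.symm] at h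
  revert hx
  refine induction_adj hG.connected (P := fun x => x ∈ G.side w v → x ∈ G.side v w') w
      (fun _ => ?_) (fun x y hxy ih hy => ?_) x
  · by_contra hc
    exact hne (hG.eq_of_crossing hw' hw (self_mem_side _ _) hc).2
  · by_cases hx : x ∈ G.side w v
    · by_contra hc
      obtain ⟨rfl, rfl⟩ := hG.eq_of_crossing hw' hxy (ih hx) hc
      exact hG.notMem_side hw.symm hx
    · have hx' : x ∈ G.side v w := by rwa [hG.side_swap hw.symm]
      obtain ⟨rfl, rfl⟩ := hG.eq_of_crossing hw hxy hx'
        (by rw [hG.side_swap hw.symm]; exact fun h => h hy)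
      by_contra hc
      exact hne (hG.eq_of_crossing hw' hw (self_mem_side _ _) hc).2

theorem IsTree.mem_support (hG : G.IsTree) {x y v : N} {p : G.Walk x y} (hp : p.IsPath)
    (hv : v ∈ p.support) (q : G.Walk x y) : v ∈ q.support := by
  classical
  have h := (hG.isAcyclic.subsingleton_path x y).elim ⟨p, hp⟩ ⟨q.bypass, q.bypass_isPath⟩
  have h' : p = q.bypass := congrArg Subtype.val h
  rw [h'] at hv
  exact q.support_bypass_subset_support hv

theorem mem_edges_of_crossing {a b x y : N} (p : G.Walk x y) (hx : x ∈ G.side a b)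
    (hy : y ∉ G.side a b) : s(a, b) ∈ p.edges := by
  by_contra h
  exact hy (Reachable.trans hx (reachable_deleteEdges_iff_exists_walk.2 ⟨p, h⟩))

theorem IsTree.notMem_support (hG : G.IsTree) {v w x y : N} (hw : G.Adj v w)
    (hx : x ∈ G.side w v) (hy : y ∈ G.side w v) {p : G.Walk x y} (hp : p.IsPath) :
    v ∉ p.support := by
  intro hv
  obtain ⟨q, hq⟩ := reachable_deleteEdges_iff_exists_walk.1 (Reachable.trans (Reachable.symm hx) hy)
  have hvq := hG.mem_support hp hv q
  classical
  have h1 := mem_edges_of_crossing (q.takeUntil v hvq) hx (hG.notMem_side hw.symm)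
  exact hq (q.edges_takeUntil_subset_edges hvq h1)

theorem mem_side_of_notMem_support {v w x y : N} (hx : x ∈ G.side w v) (p : G.Walk x y)
    (hv : v ∉ p.support) : y ∈ G.side w v := by
  by_contra hy
  exact hv (p.snd_mem_support_of_mem_edges (mem_edges_of_crossing p hx hy))

/-- Makes passing through `v` a condition on the endpoints alone, so that paths can be counted as
pairs of endpoints. -/
theorem IsTree.mem_support_iff (hG : G.IsTree) {v x y : N} {p : G.Walk x y} (hp : p.IsPath) :
    v ∈ p.support ↔ ∀ w, G.Adj v w → ¬ (x ∈ G.side w v ∧ y ∈ G.side w v) := by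
  constructor
  · rintro hv w hw ⟨hx, hy⟩
    exact hG.notMem_support hw hx hy hp hv
  · intro h
    by_contra hv
    have hx : x ≠ v := by
      rintro rfl
      exact hv p.start_mem_support
    obtain ⟨w, hw, hxw⟩ := hG.exists_mem_side hx
    exact h w hw ⟨hxw, mem_side_of_notMem_support hxw p hv⟩

theorem IsTree.adj_toSubgraph_iff (hG : G.IsTree) {v w x y : N} {p : G.Walk x y} (hp : p.IsPath)
    (hv : v ∈ p.support) (hw : G.Adj v w) :
    p.toSubgraph.Adj v w ↔ x ∈ G.side w v ∨ y ∈ G.side w v := by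
  rw [Walk.adj_toSubgraph_iff_mem_edges]
  constructor
  · intro he
    by_contra! hc
    have hx : x ∈ G.side v w := by rw [hG.side_swap hw.symm]; exact hc.1
    have hy : y ∈ G.side v w := by rw [hG.side_swap hw.symm]; exact hc.2
    exact hG.notMem_support hw.symm hx hy hp (p.snd_mem_support_of_mem_edges he)
  · intro h
    by_cases hx : x ∈ G.side w v
    · have hy : y ∉ G.side w v := fun hy => hG.notMem_support hw hx hy hp hv
      rw [Sym2.eq_swap]
      exact mem_edges_of_crossing p hx hy
    · have := mem_edges_of_crossing p.reverse (h.resolve_left hx) hx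
      rw [Sym2.eq_swap]
      simpa using this

/-- The subgraph reveals the endpoints: an interior vertex has two neighbours, an endpoint at most
one. -/
theorem eq_endpoint_of_toSubgraph_eq {x y x' y' : N} {p : G.Walk x y} {q : G.Walk x' y'} (hp : p.IsPath)
    (hq : q.IsPath) (h : p.toSubgraph = q.toSubgraph) : x = x' ∨ x = y' := by
  have hx : x ∈ q.support := by
    rw [← q.mem_verts_toSubgraph, ← h]
    exact p.start_mem_verts_toSubgraph
  obtain ⟨i, rfl, hi⟩ := Walk.mem_support_iff_exists_getVert.1 hx
  by_contra! hne
  have h0 : i ≠ 0 := by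
    rintro rfl
    exact hne.1 (by simp)
  have hl : i < q.length := by
    refine lt_of_le_of_ne hi ?_
    rintro rfl
    exact hne.2 (by simp)
  have h2 := hq.ncard_neighborSet_toSubgraph_internal_eq_two h0 hl
  rw [← h] at h2
  have hnp : ¬ p.Nil := by
    intro hnil
    cases p with
    | nil => simp at h2
    | cons => simp at hnil
  rw [hp.neighborSet_toSubgraph_startpoint hnp] at h2
  simp at h2

theorem sym2_eq_of_toSubgraph_eq {x y x' y' : N} {p : G.Walk x y} {q : G.Walk x' y'}
    (hp : p.IsPath) (hq : q.IsPath) (h : p.toSubgraph = q.toSubgraph) : s(x, y) = s(x', y') := by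
  have h1 := eq_endpoint_of_toSubgraph_eq hp hq h
  have h2 := eq_endpoint_of_toSubgraph_eq hp.reverse hq (by simpa using h)
  have h3 := eq_endpoint_of_toSubgraph_eq hq hp h.symm
  have h4 := eq_endpoint_of_toSubgraph_eq hq.reverse hp (by simpa using h.symm)
  grind

end SimpleGraph

/-! ### Counting paths through a vertex, and sums over sides of edges. -/

namespace SimpleGraph

variable {N : Type*} {G : SimpleGraph N}

open Classical in
/-- The subgraph traversed by the path of a tree between two vertices. -/
noncomputable def IsTree.pathSubgraph (hG : G.IsTree) : Sym2 N → G.Subgraph :=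
  Sym2.lift ⟨fun x y => (hG.existsUnique_path x y).choose.toSubgraph, fun x y => by
    change (hG.existsUnique_path x y).choose.toSubgraph =
      (hG.existsUnique_path y x).choose.toSubgraph
    rw [← Walk.toSubgraph_reverse (hG.existsUnique_path y x).choose]
    congr 1
    exact ((hG.existsUnique_path x y).choose_spec.2 _
      (hG.existsUnique_path y x).choose_spec.1.reverse).symm⟩

theorem IsTree.pathSubgraph_eq (hG : G.IsTree) {x y : N} {p : G.Walk x y} (hp : p.IsPath) :
    hG.pathSubgraph s(x, y) = p.toSubgraph := by
  change (hG.existsUnique_path x y).choose.toSubgraph = _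
  rw [(hG.existsUnique_path x y).choose_spec.2 p hp]

theorem IsTree.pathSubgraph_injective (hG : G.IsTree) : Function.Injective hG.pathSubgraph := by
  intro e e' h
  induction e with | _ x y
  induction e' with | _ x' y'
  obtain ⟨p, hp, -⟩ := hG.existsUnique_path x y
  obtain ⟨q, hq, -⟩ := hG.existsUnique_path x' y'
  rw [hG.pathSubgraph_eq hp, hG.pathSubgraph_eq hq] at h
  exact sym2_eq_of_toSubgraph_eq hp hq h

-- A path amounts to an unordered pair of endpoints, possibly equal, and n vertices have n(n+1)/2
-- such pairs. Avoiding the edges to `O` keeps both endpoints out of the branches towards `O`; among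
-- the remaining pairs, those inside one branch miss `v`.
open Classical in
theorem IsTree.ncard_paths (hG : G.IsTree) [Fintype N] (v : N) (O : Set N)
    (hO : ∀ w ∈ O, G.Adj v w) :
    {H : G.Subgraph | (∃ (A B : N) (p : G.Walk A B), p.IsPath ∧ H = p.toSubgraph) ∧
      v ∈ H.verts ∧ ∀ w ∈ O, ¬ H.Adj v w}.ncard +
      ∑ w with G.Adj v w ∧ w ∉ O, ((G.side w v).ncard + 1).choose 2 =
    ({x | ∀ w ∈ O, x ∉ G.side w v}.ncard + 1).choose 2 := by
  set D : Finset N := {x | ∀ w ∈ O, x ∉ G.side w v} with hD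
  set W : Finset N := {w | G.Adj v w ∧ w ∉ O} with hW
  set B : N → Finset N := fun w => {x | x ∈ G.side w v} with hB
  have hBc : ∀ w, (G.side w v).ncard = (B w).card := fun w => by
    rw [← Set.ncard_coe_finset]; congr; ext; simp [hB]
  have hDc : {x | ∀ w ∈ O, x ∉ G.side w v}.ncard = D.card := by
    rw [← Set.ncard_coe_finset]; congr; ext; simp [hD]
  have hsub : W.biUnion (fun w => (B w).sym2) ⊆ D.sym2 := by
    intro e he
    obtain ⟨w, hw, he⟩ := Finset.mem_biUnion.1 he
    refine Finset.sym2_mono (fun x hx => ?_) he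
    simp only [hW, hB, hD, Finset.mem_filter, Finset.mem_univ, true_and] at hw hx ⊢
    intro w' hw'
    exact hG.notMem_side_of_ne hw.1 (hO w' hw') (fun h => hw.2 (h ▸ hw')) hx
  have hdisj : (W : Set N).PairwiseDisjoint (fun w => (B w).sym2) := by
    intro w hw w' hw' hne
    refine Finset.disjoint_left.2 fun e he he' => ?_
    induction e with | _ x y
    simp only [hW, hB, Finset.coe_filter, Finset.mem_univ, true_and, Set.mem_ofPred_eq,
      Finset.mk_mem_sym2_iff, Finset.mem_filter] at hw hw' he he'
    exact hG.notMem_side_of_ne hw.1 hw'.1 hne he.1 he'.1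
  have hK : {H : G.Subgraph | (∃ (A B : N) (p : G.Walk A B), p.IsPath ∧ H = p.toSubgraph) ∧
      v ∈ H.verts ∧ ∀ w ∈ O, ¬ H.Adj v w} =
      ((D.sym2 \ W.biUnion (fun w => (B w).sym2)).image hG.pathSubgraph : Finset _) := by
    have key : ∀ {x y : N} (p : G.Walk x y), p.IsPath →
        ((v ∈ p.toSubgraph.verts ∧ ∀ w ∈ O, ¬ p.toSubgraph.Adj v w) ↔
          s(x, y) ∈ D.sym2 \ W.biUnion (fun w => (B w).sym2)) := by
      intro x y p hp
      have h1 : s(x, y) ∈ D.sym2 \ W.biUnion (fun w => (B w).sym2) ↔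
          (∀ w ∈ O, x ∉ G.side w v ∧ y ∉ G.side w v) ∧
          ∀ w, G.Adj v w → w ∉ O → ¬ (x ∈ G.side w v ∧ y ∈ G.side w v) := by
        simp only [Finset.mem_sdiff, Finset.mk_mem_sym2_iff, Finset.mem_biUnion, hD, hW, hB,
          Finset.mem_filter, Finset.mem_univ, true_and, not_exists, not_and]
        constructor
        · rintro ⟨⟨h, h'⟩, h2⟩
          exact ⟨fun w hw => ⟨h w hw, h' w hw⟩, fun w hw hw' => h2 w ⟨hw, hw'⟩⟩
        · rintro ⟨h, h2⟩
          exact ⟨⟨fun w hw => (h w hw).1, fun w hw => (h w hw).2⟩, fun w hw => h2 w hw.1 hw.2⟩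
      rw [h1, Walk.mem_verts_toSubgraph]
      constructor
      · rintro ⟨hv, h⟩
        refine ⟨fun w hw => ?_, fun w hw _ => (hG.mem_support_iff hp).1 hv w hw⟩
        have := h w hw
        rw [hG.adj_toSubgraph_iff hp hv (hO w hw)] at this
        exact not_or.1 this
      · rintro ⟨h, h'⟩
        have hv : v ∈ p.support := by
          rw [hG.mem_support_iff hp]
          intro w hw hc
          by_cases hwO : w ∈ O
          · exact (h w hwO).1 hc.1
          · exact h' w hw hwO hc
        refine ⟨hv, fun w hw => ?_⟩
        rw [hG.adj_toSubgraph_iff hp hv (hO w hw)]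
        exact not_or.2 (h w hw)
    ext H
    simp only [Set.mem_ofPred_eq, Finset.coe_image, Set.mem_image, Finset.mem_coe]
    constructor
    · rintro ⟨⟨x, y, p, hp, rfl⟩, h⟩
      exact ⟨s(x, y), (key p hp).1 h, hG.pathSubgraph_eq hp⟩
    · rintro ⟨e, he, rfl⟩
      induction e with | _ x y
      obtain ⟨p, hp, -⟩ := hG.existsUnique_path x y
      rw [hG.pathSubgraph_eq hp]
      exact ⟨⟨x, y, p, hp, rfl⟩, (key p hp).2 he⟩
  rw [hK, Set.ncard_coe_finset, Finset.card_image_of_injective _ hG.pathSubgraph_injective, hDc,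
    ← Finset.card_sym2, ← Finset.card_sdiff_add_card_eq_card hsub, Finset.card_biUnion hdisj]
  simp only [hBc, Finset.card_sym2]

open Classical in
theorem IsTree.side_eq (hG : G.IsTree) [Fintype N] {u w : N} (h : G.Adj u w) :
    ({x | x ∈ G.side u w} : Finset N) =
      insert u ((Finset.univ.filter fun y => G.Adj u y ∧ y ≠ w).biUnion
        fun y => ({x | x ∈ G.side y u} : Finset N)) := by
  ext x
  simp only [Finset.mem_filter, Finset.mem_univ, true_and, Finset.mem_insert, Finset.mem_biUnion]
  constructor
  · intro hx
    by_cases hxu : x = u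
    · exact Or.inl hxu
    · obtain ⟨y, hy, hxy⟩ := hG.exists_mem_side hxu
      refine Or.inr ⟨y, ⟨hy, ?_⟩, hxy⟩
      rintro rfl
      rw [hG.side_swap h] at hxy
      exact hxy hx
  · rintro (rfl | ⟨y, ⟨hy, hne⟩, hx⟩)
    · exact self_mem_side _ _
    · have := hG.notMem_side_of_ne hy h hne hx
      rw [hG.side_swap h] at this
      exact not_not.1 this

theorem IsTree.side_pairwiseDisjoint (hG : G.IsTree) (u : N) {s : Set N}
    (hs : ∀ y ∈ s, G.Adj u y) {f : N → Finset N} (hf : ∀ y x, x ∈ f y → x ∈ G.side y u) :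
    s.PairwiseDisjoint f := by
  intro y hy y' hy' hne
  refine Finset.disjoint_left.2 fun x hx hx' => ?_
  exact hG.notMem_side_of_ne (hs y hy) (hs y' hy') hne (hf _ _ hx) (hf _ _ hx')

open Classical in
theorem IsTree.univ_eq (hG : G.IsTree) [Fintype N] (u : N) :
    (Finset.univ : Finset N) = insert u ((Finset.univ.filter fun y => G.Adj u y).biUnion
        fun y => ({x | x ∈ G.side y u} : Finset N)) := by
  ext x
  simp only [Finset.mem_filter, Finset.mem_univ, true_and, Finset.mem_insert, Finset.mem_biUnion,
    true_iff]
  by_cases hxu : x = u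
  · exact Or.inl hxu
  · obtain ⟨y, hy, hxy⟩ := hG.exists_mem_side hxu
    exact Or.inr ⟨y, hy, hxy⟩

open Classical in
/-- If `α v` is the deficit at `v` of a potential `A` on the oriented edges, then the sum of `α` over
a side of an edge is the potential of this edge. -/
theorem IsTree.sum_side (hG : G.IsTree) [Fintype N] (α : N → ℝ) (A : N → N → ℝ) (F : ℝ)
    (hA : ∀ u w, G.Adj u w → A u w + A w u = F)
    (hα : ∀ v, α v = F - ∑ w with G.Adj v w, A w v) {u w : N} (h : G.Adj u w) :
    ∑ x with x ∈ G.side u w, α x = A u w := by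
  -- Peel off `u`: the branches at its other neighbours `y` contribute `A y u` by induction, and `α
  -- u` cancels all of these, leaving `F - A w u = A u w`.
  induction hn : (Finset.univ.filter fun x => x ∈ G.side u w).card using Nat.strong_induction_on
    generalizing u w with
  | _ n ih =>
    have hu : u ∉ (Finset.univ.filter fun y => G.Adj u y ∧ y ≠ w).biUnion
        fun y => ({x | x ∈ G.side y u} : Finset N) := by
      simp only [Finset.mem_biUnion, Finset.mem_filter, Finset.mem_univ, true_and, not_exists,
        not_and]
      exact fun y hy => hG.notMem_side hy.1.symm
    have hsum : ∀ y ∈ Finset.univ.filter (fun y => G.Adj u y ∧ y ≠ w),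
        ∑ x with x ∈ G.side y u, α x = A y u := by
      intro y hy
      simp only [Finset.mem_filter, Finset.mem_univ, true_and] at hy
      refine ih _ ?_ hy.1.symm rfl
      rw [← hn, hG.side_eq h]
      refine Finset.card_lt_card ⟨?_, fun hs => ?_⟩
      · refine Finset.Subset.trans ?_ (Finset.subset_insert _ _)
        exact Finset.subset_biUnion_of_mem (fun y => ({x | x ∈ G.side y u} : Finset N))
          (by simpa using hy)
      · have := hs (Finset.mem_insert_self _ _)
        simp only [Finset.mem_filter, Finset.mem_univ, true_and] at this
        exact hG.notMem_side hy.1.symm this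
    rw [hG.side_eq h, Finset.sum_insert hu, Finset.sum_biUnion, Finset.sum_congr rfl hsum, hα u]
    · have hw : (Finset.univ.filter fun y => G.Adj u y) =
          insert w (Finset.univ.filter fun y => G.Adj u y ∧ y ≠ w) := by
        ext y
        simp only [Finset.mem_filter, Finset.mem_univ, true_and, Finset.mem_insert]
        constructor
        · intro hy; by_cases hyw : y = w
          · exact Or.inl hyw
          · exact Or.inr ⟨hy, hyw⟩
        · rintro (rfl | hy)
          · exact h
          · exact hy.1
      rw [hw, Finset.sum_insert (by simp)]
      linarith [hA u w h]
    · exact hG.side_pairwiseDisjoint u (by simp +contextual) (by simp)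

open Classical in
theorem IsTree.sum_univ (hG : G.IsTree) [Fintype N] (α : N → ℝ) (A : N → N → ℝ) (F : ℝ)
    (hA : ∀ u w, G.Adj u w → A u w + A w u = F)
    (hα : ∀ v, α v = F - ∑ w with G.Adj v w, A w v) : ∑ x, α x = F := by
  obtain ⟨u⟩ := hG.connected.nonempty
  rw [hG.univ_eq u, Finset.sum_insert, Finset.sum_biUnion, hα u]
  · have := Finset.sum_congr rfl fun y (hy : y ∈ Finset.univ.filter fun y => G.Adj u y) =>
      hG.sum_side α A F hA hα (Finset.mem_filter.1 hy).2.symm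
    linarith
  · exact hG.side_pairwiseDisjoint u (by simp) (by simp)
  · simp only [Finset.mem_biUnion, Finset.mem_filter, Finset.mem_univ, true_and, not_exists,
        not_and]
    exact fun y hy => hG.notMem_side hy.symm

open Classical in
theorem IsTree.sum_ncard_side (hG : G.IsTree) [Fintype N] (u : N) :
    ∑ y with G.Adj u y, (G.side y u).ncard + 1 = Fintype.card N := by
  have h : ∀ y, (G.side y u).ncard = ({x | x ∈ G.side y u} : Finset N).card := fun y => by
    rw [← Set.ncard_coe_finset]; congr; ext; simp
  simp only [h]
  rw [← Finset.card_biUnion, ← Finset.card_insert_of_notMem (a := u), ← hG.univ_eq u,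
    Finset.card_univ]
  · simp only [Finset.mem_biUnion, Finset.mem_filter, Finset.mem_univ, true_and, not_exists,
        not_and]
    exact fun y hy => hG.notMem_side hy.symm
  · exact hG.side_pairwiseDisjoint u (by simp) (by simp)

end SimpleGraph

/-! ### Labeled directed trees: source sets as cuts, a recognition criterion, reversal. -/

section

open SimpleGraph

namespace LabeledDigraph

variable {V : Type*} {S : LabeledDigraph V}

theorem node_eq_node {x y : V} : S.node x = S.node y ↔ S.same x y := Quotient.eq (r := S.same)

theorem node_surjective : Function.Surjective S.node := Quotient.mk_surjective

theorem nodeArc_node {x y : V} : S.NodeArc (S.node x) (S.node y) ↔ S.arc x y :=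
  ⟨fun ⟨_, _, hu, hv, h⟩ => S.arc_congr _ _ _ _ (node_eq_node.1 hu) (node_eq_node.1 hv) h,
    fun h => ⟨x, y, rfl, rfl, h⟩⟩

theorem graph_adj_node {x y : V} :
    S.graph.Adj (S.node x) (S.node y) ↔ ¬ S.same x y ∧ (S.arc x y ∨ S.arc y x) := by
  rw [graph, SimpleGraph.fromRel_adj, nodeArc_node, nodeArc_node, Ne, node_eq_node]

theorem mem_sourceSet {u v x : V} :
    x ∈ S.sourceSet u v ↔ S.node x ∈ S.graph.side (S.node u) (S.node v) := Iff.rfl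

theorem mem_sourceSet_congr {u v x y : V} (h : S.same x y) :
    x ∈ S.sourceSet u v ↔ y ∈ S.sourceSet u v := by
  rw [mem_sourceSet, mem_sourceSet, node_eq_node.2 h]

theorem sourceSet_congr {u v u' v' : V} (hu : S.same u u') (hv : S.same v v') :
    S.sourceSet u v = S.sourceSet u' v' := by
  rw [sourceSet, sourceSet, node_eq_node.2 hu, node_eq_node.2 hv]

theorem mem_sourceSet_self (u v : V) : u ∈ S.sourceSet u v := SimpleGraph.self_mem_side _ _

/-- There is an arc between `x` and `y`, or they are in the same label. -/
def Link (S : LabeledDigraph V) (x y : V) : Prop := S.same x y ∨ S.arc x y ∨ S.arc y x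

theorem Link.symm {x y : V} (h : S.Link x y) : S.Link y x :=
  h.imp S.same.symm Or.symm

theorem reflTransGen_link_symm {x y : V} (h : Relation.ReflTransGen S.Link x y) :
    Relation.ReflTransGen S.Link y x := by
  have : Std.Symm S.Link := ⟨fun _ _ h => h.symm⟩
  exact Std.Symm.symm _ _ h

theorem reachable_of_links {x y : V} (h : Relation.ReflTransGen S.Link x y) :
    S.graph.Reachable (S.node x) (S.node y) := by
  induction h with
  | refl => exact Reachable.refl _
  | tail _ h ih =>
    refine ih.trans ?_
    rename_i b c _
    by_cases hs : S.same b c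
    · rw [node_eq_node.2 hs]
    · exact (graph_adj_node.2 ⟨hs, h.resolve_left hs⟩).reachable

theorem links_of_reachable {x y : V} (h : S.graph.Reachable (S.node x) (S.node y)) :
    Relation.ReflTransGen S.Link x y := by
  rw [reachable_iff_reflTransGen] at h
  have key : ∀ A, Relation.ReflTransGen S.graph.Adj (S.node x) A →
      ∀ z, S.node z = A → Relation.ReflTransGen S.Link x z := by
    intro A hA
    induction hA with
    | refl => exact fun z hz => Relation.ReflTransGen.single (Or.inl (node_eq_node.1 hz.symm))
    | tail _ hAB ih =>
      rintro z rfl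
      rename_i A' _
      obtain ⟨w, rfl⟩ := node_surjective A'
      exact (ih w rfl).tail (Or.inr (graph_adj_node.1 hAB).2)
  exact key _ h y rfl

namespace IsDirectedTree

variable (hS : S.IsDirectedTree)
include hS

theorem not_same {x y : V} (h : S.arc x y) : ¬ S.same x y := fun hs =>
  hS.2 x y h (S.arc_congr _ _ _ _ hs (S.same.symm hs) h)

theorem adj {x y : V} (h : S.arc x y) : S.graph.Adj (S.node x) (S.node y) :=
  graph_adj_node.2 ⟨hS.not_same h, Or.inl h⟩

theorem links (x y : V) : Relation.ReflTransGen S.Link x y :=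
  links_of_reachable (hS.1.connected.preconnected _ _)

theorem notMem_sourceSet {u v : V} (h : S.arc u v) : v ∉ S.sourceSet u v :=
  hS.1.notMem_side (hS.adj h)

theorem sinkSet_eq {u v : V} (h : S.arc u v) : S.sinkSet u v = (S.sourceSet u v)ᶜ := by
  have := hS.1.side_swap (hS.adj h)
  ext x
  have hx := Set.ext_iff.1 this (S.node x)
  rw [SimpleGraph.side, Sym2.eq_swap] at hx
  exact hx

/-- The source set is left only by the arc itself; an arc entering it would be antiparallel to that
arc. This one-way cut is what makes source sets lower sets. -/
theorem cut {u v x y : V} (h : S.arc u v) (hxy : S.arc x y) :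
    (x ∈ S.sourceSet u v ↔ y ∈ S.sourceSet u v) ∨ (S.same x u ∧ S.same y v) := by
  by_cases hx : x ∈ S.sourceSet u v <;> by_cases hy : y ∈ S.sourceSet u v
  · exact Or.inl ⟨fun _ => hy, fun _ => hx⟩
  · obtain ⟨h1, h2⟩ := hS.1.eq_of_crossing (hS.adj h) (hS.adj hxy) hx hy
    exact Or.inr ⟨node_eq_node.1 h1, node_eq_node.1 h2⟩
  · obtain ⟨h1, h2⟩ := hS.1.eq_of_crossing (hS.adj h) (hS.adj hxy).symm hy hx
    exact (hS.2 _ _ h (S.arc_congr _ _ _ _ (node_eq_node.1 h2) (node_eq_node.1 h1) hxy)).elim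
  · exact Or.inl ⟨fun h => absurd h hx, fun h => absurd h hy⟩

theorem mem_sourceSet_of_arc {u v x y : V} (h : S.arc u v) (hxy : S.arc x y)
    (hy : y ∈ S.sourceSet u v) : x ∈ S.sourceSet u v := by
  rcases hS.cut h hxy with h' | ⟨h', -⟩
  · exact h'.2 hy
  · exact (mem_sourceSet_congr h').2 (mem_sourceSet_self _ _)

theorem mem_sourceSet_of_below {u v x y : V} (h : S.arc u v) (hxy : S.Below x y)
    (hy : y ∈ S.sourceSet u v) : x ∈ S.sourceSet u v := by
  induction hxy with
  | single hxy => exact hS.mem_sourceSet_of_arc h hxy hy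
  | tail _ hbc ih => exact ih (hS.mem_sourceSet_of_arc h hbc hy)

theorem not_below_self (x : V) : ¬ S.Below x x := by
  intro h
  obtain ⟨y, hxy, hyx⟩ := Relation.TransGen.head'_iff.1 h
  refine hS.notMem_sourceSet hxy ?_
  rcases Relation.reflTransGen_iff_eq_or_transGen.1 hyx with h' | h'
  · rw [← h']; exact mem_sourceSet_self _ _
  · exact hS.mem_sourceSet_of_below hxy h' (mem_sourceSet_self _ _)

/-- Source sets of distinct incoming arcs are disjoint. -/
theorem disjoint_sources {a b w x : V} (ha : S.arc a w) (hb : S.arc b w) (hne : ¬ S.same a b)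
    (hx : x ∈ S.sourceSet a w) : x ∉ S.sourceSet b w :=
  hS.1.notMem_side_of_ne (hS.adj ha).symm (hS.adj hb).symm
    (fun h => hne (node_eq_node.1 h)) hx

end IsDirectedTree

/-- A criterion for directed trees, which computes the source label sets: the labeled digraph is
connected and each arc is the only one which leaves or enters some set `B` of nodes. -/
theorem isDirectedTree_of_cuts [Nonempty V] (hl : ∀ x y, Relation.ReflTransGen S.Link x y)
    (B : V → V → Set V)
    (hB : ∀ u v, S.arc u v → ∀ x y, S.same x y → x ∈ B u v → y ∈ B u v)
    (hu : ∀ u v, S.arc u v → u ∈ B u v) (hv : ∀ u v, S.arc u v → v ∉ B u v)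
    (hc : ∀ u v, S.arc u v → ∀ x y, S.arc x y →
      (x ∈ B u v ↔ y ∈ B u v) ∨ (S.same x u ∧ S.same y v)) :
    S.IsDirectedTree ∧ ∀ u v, S.arc u v → S.sourceSet u v = B u v := by
  -- `B u v` cannot be left without using the deleted arc. Hence every arc is a bridge, and a
  -- connected graph whose edges are all bridges is a tree.
  have hsub : ∀ u v, S.arc u v → ∀ x ∈ S.sourceSet u v, x ∈ B u v := by
    intro u v huv x hx
    have hx' : (S.graph.deleteEdges {s(S.node u, S.node v)}).Reachable (S.node u) (S.node x) := hx
    rw [reachable_iff_reflTransGen] at hx'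
    have key : ∀ A, Relation.ReflTransGen
        (S.graph.deleteEdges {s(S.node u, S.node v)}).Adj (S.node u) A →
        ∀ z, S.node z = A → z ∈ B u v := by
      intro A hA
      induction hA with
      | refl => exact fun z hz => hB u v huv _ _ (node_eq_node.1 hz.symm) (hu u v huv)
      | tail _ hAB ih =>
        rintro z rfl
        rename_i A' _
        obtain ⟨w, rfl⟩ := node_surjective A'
        have hw := ih w rfl
        rw [deleteEdges_adj] at hAB
        rcases (graph_adj_node.1 hAB.1).2 with h | h
        · rcases hc u v huv w z h with h' | ⟨h', h''⟩
          · exact h'.1 hw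
          · refine absurd ?_ hAB.2
            rw [node_eq_node.2 h', node_eq_node.2 h'']
            rfl
        · rcases hc u v huv z w h with h' | ⟨h', h''⟩
          · exact h'.2 hw
          · exact hB u v huv _ _ (S.same.symm h') (hu u v huv)
    exact key _ hx' x rfl
  have hns : ∀ u v, S.arc u v → ¬ S.same u v := fun u v huv h =>
    hv u v huv (hB u v huv _ _ h (hu u v huv))
  have hasym : ∀ u v, S.arc u v → ¬ S.arc v u := by
    intro u v huv hvu
    rcases hc u v huv v u hvu with h | ⟨h, -⟩
    · exact hv u v huv (h.2 (hu u v huv))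
    · exact hns u v huv (S.same.symm h)
  have hbr : ∀ u v, S.arc u v → S.graph.IsBridge s(S.node u, S.node v) := fun u v huv =>
    isBridge_iff.2 fun h => hv u v huv (hsub u v huv v h)
  have htree : S.graph.IsTree := by
    have : Nonempty S.Node := Nonempty.map S.node ‹_›
    refine ⟨⟨?_⟩, ?_⟩
    · intro A A'
      obtain ⟨x, rfl⟩ := node_surjective A
      obtain ⟨y, rfl⟩ := node_surjective A'
      exact reachable_of_links (hl x y)
    · rw [isAcyclic_iff_forall_adj_isBridge]
      intro A A' h
      obtain ⟨x, rfl⟩ := node_surjective A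
      obtain ⟨y, rfl⟩ := node_surjective A'
      rcases (graph_adj_node.1 h).2 with h | h
      · exact hbr x y h
      · rw [Sym2.eq_swap]; exact hbr y x h
  have hS : S.IsDirectedTree := ⟨htree, hasym⟩
  -- For the other inclusion, walk from `v`, which is outside `B u v`: the walk can enter this set
  -- only at the node of `u`, and then stays in the source set as long as it stays in `B u v`.
  refine ⟨hS, fun u v huv => Set.Subset.antisymm (hsub u v huv) ?_⟩
  intro x
  have hx := hl v x
  induction hx with
  | refl => exact fun h => absurd h (hv u v huv)
  | tail _ hbc ih =>
    rename_i b c _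
    intro hcB
    by_cases hbB : b ∈ B u v
    · have hb := ih hbB
      rcases hbc with h | h | h
      · exact (mem_sourceSet_congr h).1 hb
      · rcases hS.cut huv h with h' | ⟨h', h''⟩
        · exact h'.1 hb
        · exact absurd (hB u v huv _ _ h'' hcB) (hv u v huv)
      · exact hS.mem_sourceSet_of_arc huv h hb
    · rcases hbc with h | h | h
      · exact absurd (hB u v huv _ _ (S.same.symm h) hcB) hbB
      · rcases hc u v huv _ _ h with h' | ⟨h', h''⟩
        · exact absurd (h'.2 hcB) hbB
        · exact absurd (hB u v huv _ _ h'' hcB) (hv u v huv)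
      · rcases hc u v huv _ _ h with h' | ⟨h', h''⟩
        · exact absurd (h'.1 hcB) hbB
        · exact (mem_sourceSet_congr h').2 (mem_sourceSet_self _ _)

/-- Reversal of all arcs. -/
def op (S : LabeledDigraph V) : LabeledDigraph V where
  same := S.same
  arc u v := S.arc v u
  arc_congr u u' v v' hu hv h := S.arc_congr v v' u u' hv hu h

theorem op_op (S : LabeledDigraph V) : S.op.op = S := rfl

theorem graph_op (S : LabeledDigraph V) : S.op.graph = S.graph := by
  ext A B
  obtain ⟨x, rfl⟩ := node_surjective (S := S) A
  obtain ⟨y, rfl⟩ := node_surjective (S := S) B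
  rw [graph_adj_node (S := S)]
  refine (graph_adj_node (S := S.op)).trans ?_
  simp only [op]
  tauto

theorem sourceSet_op (S : LabeledDigraph V) (u v : V) : S.op.sourceSet u v = S.sinkSet v u := by
  ext x
  have h : x ∈ S.op.sourceSet u v ↔
    (S.op.graph.deleteEdges {s(S.node u, S.node v)}).Reachable (S.node u) (S.node x) := Iff.rfl
  rw [h, graph_op, Sym2.eq_swap]
  rfl

theorem sinkSet_op (S : LabeledDigraph V) (u v : V) : S.op.sinkSet u v = S.sourceSet v u := by
  have := S.op.sourceSet_op v u
  rw [op_op] at this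
  exact this.symm

theorem IsDirectedTree.op (hS : S.IsDirectedTree) : S.op.IsDirectedTree :=
  ⟨by rw [graph_op]; exact hS.1, fun u v h h' => hS.2 u v h' h⟩

theorem below_op {u v : V} : S.op.Below u v ↔ S.Below v u := by
  rw [Below, Below, ← Relation.transGen_swap]
  rfl

theorem contract_op (u v : V) : S.op.contract u v = (S.contract v u).op := by
  refine LabeledDigraph.ext ?_ ?_
  · ext x y
    change (_ ∨ _) ↔ (_ ∨ _)
    rw [or_comm (a := S.op.same u x), or_comm (a := S.op.same u y)]
    rfl
  · funext x y
    simp only [contract, LabeledDigraph.op]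
    have h1 : ∀ z, (S.same v z ∨ S.same u z) = (S.same u z ∨ S.same v z) := fun z =>
      propext or_comm
    simp only [h1, eq_iff_iff]
    refine and_congr (not_congr ?_) ?_
    · rw [and_comm, S.same.comm']
      exact Iff.rfl
    · constructor
      · rintro ⟨x', y', a, b, c⟩; exact ⟨y', x', b, a, c⟩
      · rintro ⟨x', y', a, b, c⟩; exact ⟨y', x', b, a, c⟩

end LabeledDigraph

end

/-! ### Components of the ground tree, exchange of signs, and splitting a label. -/

section

open SimpleGraph

namespace SignedTree

variable {V : Type*} {T : SignedTree V} {X Y : Set V} {x y z : V}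

theorem sameComponent_iff :
    T.SameComponent X x y ↔ ∃ p : T.graph.Walk x y, ∀ z ∈ p.support, z ∉ X := by
  constructor
  · rintro ⟨hx, hy, ⟨p⟩⟩
    refine ⟨p.map (Embedding.induce Xᶜ).toHom, fun z hz => ?_⟩
    have hz' : z ∈ p.support.map (Embedding.induce Xᶜ).toHom :=
      (congrArg (z ∈ ·) (Walk.support_map (Embedding.induce Xᶜ).toHom p)).mp hz
    obtain ⟨w, -, rfl⟩ := List.mem_map.1 hz'
    exact w.2
  · rintro ⟨p, hp⟩
    exact ⟨hp _ p.start_mem_support, hp _ p.end_mem_support, ⟨p.induce Xᶜ hp⟩⟩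

theorem SameComponent.symm (h : T.SameComponent X x y) : T.SameComponent X y x := by
  obtain ⟨hx, hy, h⟩ := h
  exact ⟨hy, hx, h.symm⟩

theorem SameComponent.trans (h : T.SameComponent X x y) (h' : T.SameComponent X y z) :
    T.SameComponent X x z := by
  obtain ⟨hx, hy, h⟩ := h
  obtain ⟨_, hz, h'⟩ := h'
  exact ⟨hx, hz, h.trans h'⟩

theorem SameComponent.mono (h : T.SameComponent Y x y) (hXY : X ⊆ Y) : T.SameComponent X x y := by
  obtain ⟨p, hp⟩ := sameComponent_iff.1 h
  exact sameComponent_iff.2 ⟨p, fun z hz hX => hp z hz (hXY hX)⟩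

theorem sameComponent_refl (hx : x ∉ X) : T.SameComponent X x x := ⟨hx, hx, Reachable.refl _⟩

theorem SameComponent.notMem_of_mem_path (h : T.SameComponent X x y) {p : T.graph.Walk x y}
    (hp : p.IsPath) (hz : z ∈ p.support) : z ∉ X := by
  obtain ⟨q, hq⟩ := sameComponent_iff.1 h
  exact hq z (T.isTree.mem_support hp hz q)

theorem SameComponent.of_mem_path (h : T.SameComponent X x y) {p : T.graph.Walk x y}
    (hp : p.IsPath) (hz : z ∈ p.support) : T.SameComponent X x z := by
  classical
  refine sameComponent_iff.2 ⟨p.takeUntil z hz, fun w hw => ?_⟩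
  exact h.notMem_of_mem_path hp (p.support_takeUntil_subset_support hz hw)

theorem sameComponent_of_eq_empty (hX : X = ∅) (x y : V) : T.SameComponent X x y := by
  obtain ⟨p⟩ := T.isTree.connected.preconnected x y
  exact sameComponent_iff.2 ⟨p, by simp [hX]⟩

/-- Both hypotheses concern the unique path from `x` to `y`, so the avoided sets add up; this would
fail in a graph with cycles. -/
theorem SameComponent.union (h : T.SameComponent X x y) (h' : T.SameComponent Y x y) :
    T.SameComponent (X ∪ Y) x y := by
  obtain ⟨p, hp, -⟩ := T.isTree.existsUnique_path x y
  exact sameComponent_iff.2 ⟨p, fun z hz hXY => hXY.elim (h.notMem_of_mem_path hp hz)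
    (h'.notMem_of_mem_path hp hz)⟩

theorem SameComponent.singleton_union (h : T.SameComponent X x y) (hx : ¬ T.SameComponent X x z) :
    T.SameComponent ({z} ∪ X) x y := by
  obtain ⟨p, hp, -⟩ := T.isTree.existsUnique_path x y
  refine sameComponent_iff.2 ⟨p, fun w hw hXY => ?_⟩
  rcases hXY with rfl | hX
  · exact hx (h.of_mem_path hp hw)
  · exact h.notMem_of_mem_path hp hw hX

/-- The same tree with exchanged signs. -/
def op (T : SignedTree V) : SignedTree V where
  graph := T.graph
  isTree := T.isTree
  neg := T.negᶜ

/-- Reversing arcs while exchanging signs preserves the definition of a spine, so one-sided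
statements need a proof for one sign only. -/
theorem IsSpine.op {S : LabeledDigraph V} (h : T.IsSpine S) : T.op.IsSpine S.op where
  isDirectedTree := h.isDirectedTree.op
  source_subset u w huw x hx y hy := by
    rw [S.sourceSet_op] at hx hy
    exact h.sink_subset w u huw x hx y hy
  source_distinct u u' w hu hu' hne x hx y hy := by
    rw [S.sourceSet_op] at hx hy
    exact h.sink_distinct w u u' hu hu' hne x hx y hy
  sink_subset w v hwv x hx y hy := by
    rw [S.sinkSet_op] at hx hy
    have := h.source_subset v w hwv x hx y hy
    rw [← compl_compl T.neg] at this
    exact this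
  sink_distinct w v v' hv hv' hne x hx y hy := by
    rw [S.sinkSet_op] at hx hy
    have := h.source_distinct v v' w hv hv' hne x hx y hy
    rw [← compl_compl T.neg] at this
    exact this

theorem op_op (T : SignedTree V) : T.op.op = T := by
  simp [op]

variable {S : LabeledDigraph V}

/-- The condition that an incoming arc of the node of `u` with source `x` is attached to the new node
`{u}` when `{u}` is split off the node of `u`. -/
def SplitBelow (T : SignedTree V) (S : LabeledDigraph V) (u x : V) : Prop :=
  T.SameComponent ((S.label u ∩ T.neg) \ {u}) x u

theorem splitBelow_congr (hS : T.IsSpine S) {u a x y : V} (h : S.arc a u)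
    (hx : x ∈ S.sourceSet a u) (hy : y ∈ S.sourceSet a u) :
    T.SplitBelow S u x ↔ T.SplitBelow S u y := by
  have hxy : T.SameComponent ((S.label u ∩ T.neg) \ {u}) x y :=
    (hS.source_subset a u h x hx y hy).mono Set.sdiff_subset
  exact ⟨fun h => hxy.symm.trans h, fun h => hxy.trans h⟩

/-- A negative vertex `u` is split off its node, as a new node below the rest of this node. -/
def split (T : SignedTree V) (S : LabeledDigraph V) (hS : T.IsSpine S) (u : V) :
    LabeledDigraph V where
  same :=
    { r := fun x y => S.same x y ∧ (x = u ↔ y = u)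
      iseqv :=
        { refl := fun x => ⟨S.same.refl x, Iff.rfl⟩
          symm := fun h => ⟨S.same.symm h.1, h.2.symm⟩
          trans := fun h h' => ⟨S.same.trans h.1 h'.1, h.2.trans h'.2⟩ } }
  arc := fun x y => (x = u ∧ S.same u y ∧ y ≠ u) ∨ (x ≠ u ∧ y = u ∧ S.arc x u ∧ T.SplitBelow S u x) ∨
    (x ≠ u ∧ y ≠ u ∧ S.arc x y ∧ (S.same u y → ¬ T.SplitBelow S u x))
  arc_congr := by
    rintro x x' y y' ⟨hx, hxu⟩ ⟨hy, hyu⟩ (⟨rfl, h, hne⟩ | ⟨hne, rfl, h, hb⟩ | ⟨hne, hne', h, hb⟩)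
    · exact Or.inl ⟨hxu.1 rfl, S.same.trans h hy, fun h => hne (hyu.2 h)⟩
    · obtain rfl := hyu.1 rfl
      have h' := S.arc_congr _ _ _ _ hx (S.same.refl y') h
      exact Or.inr (Or.inl ⟨fun h => hne (hxu.2 h), rfl, h',
        (splitBelow_congr hS h (S.mem_sourceSet_self _ _)
          ((S.mem_sourceSet_congr hx).1 (S.mem_sourceSet_self _ _))).1 hb⟩)
    · have h' := S.arc_congr _ _ _ _ hx hy h
      refine Or.inr (Or.inr ⟨fun h => hne (hxu.2 h), fun h => hne' (hyu.2 h), h', fun hs => ?_⟩)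
      have huy := S.same.trans hs (S.same.symm hy)
      have h3 := S.arc_congr _ _ _ _ (S.same.refl x) (S.same.symm huy) h
      rw [← splitBelow_congr hS h3 (S.mem_sourceSet_self _ _)
        ((S.mem_sourceSet_congr hx).1 (S.mem_sourceSet_self _ _))]
      exact hb huy

theorem split_contract (hS : T.IsSpine S) {u u' : V} (hu : S.same u u') (hne : u' ≠ u) :
    (T.split S hS u).contract u u' = S := by
  have hsame : ∀ x y, ((T.split S hS u).same x y ∨ (((T.split S hS u).same u x ∨
      (T.split S hS u).same u' x) ∧ ((T.split S hS u).same u y ∨ (T.split S hS u).same u' y))) ↔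
      S.same x y := by
    intro x y
    have h1 : ∀ z, ((T.split S hS u).same u z ∨ (T.split S hS u).same u' z) ↔ S.same u z := by
      intro z
      change (S.same u z ∧ (u = u ↔ z = u)) ∨ (S.same u' z ∧ (u' = u ↔ z = u)) ↔ _
      constructor
      · rintro (h | h)
        · exact h.1
        · exact S.same.trans hu h.1
      · intro h
        by_cases hz : z = u
        · exact Or.inl ⟨h, by simp [hz]⟩
        · exact Or.inr ⟨S.same.trans (S.same.symm hu) h, by simp [hz, hne]⟩
    rw [h1, h1]
    change (S.same x y ∧ (x = u ↔ y = u)) ∨ _ ↔ _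
    constructor
    · rintro (h | ⟨h, h'⟩)
      · exact h.1
      · exact S.same.trans (S.same.symm h) h'
    · intro h
      by_cases hx : S.same u x
      · exact Or.inr ⟨hx, S.same.trans hx h⟩
      · have hy : ¬ S.same u y := fun hy => hx (S.same.trans hy (S.same.symm h))
        refine Or.inl ⟨h, ?_⟩
        constructor
        · rintro rfl; exact absurd (S.same.refl _) hx
        · rintro rfl; exact absurd (S.same.refl _) hy
  refine LabeledDigraph.ext ?_ ?_
  · ext x y
    exact hsame x y
  · funext x y
    refine propext ?_
    simp only [LabeledDigraph.contract, hsame]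
    constructor
    · rintro ⟨hn, x', y', hx, hy, h⟩
      rcases h with ⟨rfl, h, -⟩ | ⟨-, rfl, h, -⟩ | ⟨-, -, h, -⟩
      · exact absurd (S.same.trans hx (S.same.trans h (S.same.symm hy))) hn
      · exact S.arc_congr _ _ _ _ (S.same.symm hx) (S.same.symm hy) h
      · exact S.arc_congr _ _ _ _ (S.same.symm hx) (S.same.symm hy) h
    · intro h
      refine ⟨hS.isDirectedTree.not_same h, ?_⟩
      by_cases hx : S.same u x
      · have hy : ¬ S.same u y := fun hy =>
          hS.isDirectedTree.not_same h (S.same.trans (S.same.symm hx) hy)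
        refine ⟨u', y, S.same.trans (S.same.symm hx) hu, S.same.refl y, Or.inr (Or.inr ⟨hne, ?_,
          S.arc_congr _ _ _ _ (S.same.trans (S.same.symm hx) hu) (S.same.refl y) h,
          fun h => absurd h hy⟩)⟩
        rintro rfl; exact hy (S.same.refl _)
      · have hxu : x ≠ u := by rintro rfl; exact hx (S.same.refl _)
        by_cases hy : S.same u y
        · by_cases hb : T.SplitBelow S u x
          · exact ⟨x, u, S.same.refl x, S.same.symm hy, Or.inr (Or.inl ⟨hxu, rfl,
              S.arc_congr _ _ _ _ (S.same.refl x) (S.same.symm hy) h, hb⟩)⟩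
          · exact ⟨x, u', S.same.refl x, S.same.trans (S.same.symm hy) hu, Or.inr (Or.inr ⟨hxu, hne,
              S.arc_congr _ _ _ _ (S.same.refl x) (S.same.trans (S.same.symm hy) hu) h,
              fun _ => hb⟩)⟩
        · refine ⟨x, y, S.same.refl x, S.same.refl y, Or.inr (Or.inr ⟨hxu, ?_, h,
            fun h => absurd h hy⟩)⟩
          rintro rfl; exact hy (S.same.refl _)

/-- The vertices below the arc from the new node `{u}` to the rest of the split node. -/
def splitSource (T : SignedTree V) (S : LabeledDigraph V) (u : V) : Set V :=
  {z | z = u ∨ ∃ a, S.arc a u ∧ T.SplitBelow S u a ∧ z ∈ S.sourceSet a u}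

/-- The cuts fed to `isDirectedTree_of_cuts` are the old source sets for the old arcs, and `u` with
the branches moved below it for the new arc. -/
theorem split_isDirectedTree (hS : T.IsSpine S) {u u' : V} (hu : S.same u u') (hne : u' ≠ u) :
    (T.split S hS u).IsDirectedTree ∧ (∀ v, S.same u v → v ≠ u →
      (T.split S hS u).sourceSet u v = T.splitSource S u) ∧
    ∀ x y, x ≠ u → (T.split S hS u).arc x y → (T.split S hS u).sourceSet x y = S.sourceSet x y := by
  classical
  have hD := hS.isDirectedTree
  have : Nonempty V := ⟨u⟩
  set S' := T.split S hS u with hS'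
  have arc_iff : ∀ x y, S'.arc x y ↔ (x = u ∧ S.same u y ∧ y ≠ u) ∨
    (x ≠ u ∧ y = u ∧ S.arc x u ∧ T.SplitBelow S u x) ∨
    (x ≠ u ∧ y ≠ u ∧ S.arc x y ∧ (S.same u y → ¬ T.SplitBelow S u x)) := fun _ _ => Iff.rfl
  have same_iff : ∀ x y, S'.same x y ↔ S.same x y ∧ (x = u ↔ y = u) := fun _ _ => Iff.rfl
  have arcS : ∀ x y, S'.arc x y → x ≠ u → S.arc x y := by
    rintro x y (⟨rfl, -⟩ | ⟨-, rfl, h, -⟩ | ⟨-, -, h, -⟩) hx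
    · exact absurd rfl hx
    · exact h
    · exact h
  have below_congr : ∀ x y, S.arc x u → S.same x y → (T.SplitBelow S u x ↔ T.SplitBelow S u y) :=
    fun x y h hxy => splitBelow_congr hS h (S.mem_sourceSet_self _ _)
      ((S.mem_sourceSet_congr hxy).1 (S.mem_sourceSet_self _ _))
  have notMem : ∀ a v, S.arc a u → S.same u v → v ∉ S.sourceSet a u := fun a v ha hv h =>
    hD.notMem_sourceSet ha ((S.mem_sourceSet_congr hv).2 h)
  have links : ∀ x y, S.Link x y → Relation.ReflTransGen S'.Link x y := by
    have hsame : ∀ x y, S.same x y → Relation.ReflTransGen S'.Link x y := by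
      intro x y h
      refine Relation.ReflTransGen.single ?_
      by_cases hx : x = u <;> by_cases hy : y = u
      · exact Or.inl ⟨h, by simp [hx, hy]⟩
      · exact Or.inr (Or.inl (Or.inl ⟨hx, hx ▸ h, hy⟩))
      · exact Or.inr (Or.inr (Or.inl ⟨hy, hy ▸ S.same.symm h, hx⟩))
      · exact Or.inl ⟨h, by simp [hx, hy]⟩
    have harc : ∀ x y, S.arc x y → Relation.ReflTransGen S'.Link x y := by
      intro x y h
      -- Since `S` is a contraction of `S'`, its arc lifts to an arc of `S'` between vertices of the
      -- same labels of `S`.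
      have hc : (S'.contract u u').arc x y := by rw [hS', split_contract hS hu hne]; exact h
      obtain ⟨-, x', y', hx, hy, h'⟩ := hc
      have hsame' : ∀ x y, (S'.same x y ∨ ((S'.same u x ∨ S'.same u' x) ∧
          (S'.same u y ∨ S'.same u' y))) → S.same x y := by
        rintro x y (h | ⟨h, h'⟩)
        · exact h.1
        · have aux : ∀ z, (S'.same u z ∨ S'.same u' z) → S.same u z := by
            rintro z (h | h)
            · exact h.1
            · exact S.same.trans hu h.1
          exact S.same.trans (S.same.symm (aux x h)) (aux y h')
      exact ((hsame x x' (hsame' _ _ hx)).tail (Or.inr (Or.inl h'))).trans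
        (hsame _ _ (S.same.symm (hsame' _ _ hy)))
    rintro x y (h | h | h)
    · exact hsame x y h
    · exact harc x y h
    · exact LabeledDigraph.reflTransGen_link_symm (harc y x h)
  have conn : ∀ x y, Relation.ReflTransGen S'.Link x y := by
    intro x y
    have h := hD.links x y
    induction h with
    | refl => exact Relation.ReflTransGen.refl
    | tail _ h ih => exact ih.trans (links _ _ h)
  have main := LabeledDigraph.isDirectedTree_of_cuts (S := S') conn
    (fun x y => if x = u then T.splitSource S u else S.sourceSet x y) ?_ ?_ ?_ ?_
  · refine ⟨main.1, fun v hv hvu => ?_, fun x y hx h => ?_⟩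
    · rw [main.2 u v (Or.inl ⟨rfl, hv, hvu⟩), if_pos rfl]
    · rw [main.2 x y h, if_neg hx]
  · intro x y h a b hab ha
    by_cases hx : x = u
    · simp only [hx, if_true] at ha ⊢
      rcases ha with ha | ⟨c, hc, hc', ha⟩
      · exact Or.inl (hab.2.1 ha)
      · exact Or.inr ⟨c, hc, hc', (S.mem_sourceSet_congr hab.1).1 ha⟩
    · simp only [hx, if_false] at ha ⊢
      exact (S.mem_sourceSet_congr hab.1).1 ha
  · intro x y h
    by_cases hx : x = u
    · simp only [hx, if_true]
      exact Or.inl rfl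
    · simp only [hx, if_false]
      exact S.mem_sourceSet_self _ _
  · intro x y h
    by_cases hx : x = u
    · subst hx
      simp only [if_true]
      rcases h with ⟨-, hs, hy⟩ | ⟨h, -⟩ | ⟨h, -⟩
      · rintro (h | ⟨c, hc, -, h⟩)
        · exact hy h
        · exact notMem c y hc hs h
      · exact absurd rfl h
      · exact absurd rfl h
    · simp only [hx, if_false]
      exact hD.notMem_sourceSet (arcS x y h hx)
  · intro x y h p q hpq
    by_cases hx : x = u
    · subst hx
      simp only [if_true]
      have hxy : S.same x y := by
        rcases h with ⟨-, hs, hy⟩ | ⟨h, -⟩ | ⟨h, -⟩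
        · exact hs
        · exact absurd rfl h
        · exact absurd rfl h
      rcases hpq with ⟨rfl, hs, hq⟩ | ⟨hp, rfl, h', hb⟩ | ⟨hp, hq, h', hb⟩
      · refine Or.inr ⟨S'.same.refl _, S.same.trans (S.same.symm hs) hxy, ?_⟩
        rcases h with ⟨-, hs, hy⟩ | ⟨h, -⟩ | ⟨h, -⟩
        · simp [hq, hy]
        · exact absurd rfl h
        · exact absurd rfl h
      · exact Or.inl ⟨fun _ => Or.inl rfl, fun _ => Or.inr ⟨p, h', hb, S.mem_sourceSet_self _ _⟩⟩
      · refine Or.inl ⟨?_, ?_⟩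
        · rintro (h | ⟨c, hc, hcb, h⟩)
          · exact absurd h hp
          · rcases hD.cut hc h' with h'' | ⟨h1, h2⟩
            · exact Or.inr ⟨c, hc, hcb, h''.1 h⟩
            · exact absurd ((below_congr c p hc (S.same.symm h1)).1 hcb) (hb (S.same.symm h2))
        · rintro (h | ⟨c, hc, hcb, h⟩)
          · exact absurd h hq
          · exact Or.inr ⟨c, hc, hcb, hD.mem_sourceSet_of_arc hc h' h⟩
    · simp only [hx, if_false]
      have hxy := arcS x y h hx
      by_cases hp : p = u
      · subst hp
        rcases hpq with ⟨-, hs, hq⟩ | ⟨h, -⟩ | ⟨h, -⟩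
        · exact Or.inl (S.mem_sourceSet_congr hs)
        · exact absurd rfl h
        · exact absurd rfl h
      · rcases hD.cut hxy (arcS p q hpq hp) with h' | ⟨h1, h2⟩
        · exact Or.inl h'
        · refine Or.inr ⟨⟨h1, by simp [hp, hx]⟩, h2, ?_⟩
          rcases h with ⟨h, -⟩ | ⟨-, rfl, h, hb⟩ | ⟨-, hy, h, hb⟩
          · exact absurd h hx
          · rcases hpq with ⟨h, -⟩ | ⟨-, rfl, h', hb'⟩ | ⟨-, hq, h', hb'⟩
            · exact absurd h hp
            · rfl
            · exact absurd ((below_congr x p h (S.same.symm h1)).1 hb) (hb' (S.same.symm h2))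
          · rcases hpq with ⟨h, -⟩ | ⟨-, rfl, h', hb'⟩ | ⟨-, hq, h', hb'⟩
            · exact absurd h hp
            · exact absurd ((below_congr p x h' h1).1 hb') (hb h2)
            · simp [hq, hy]

end SignedTree

end

/-! ### Splitting preserves spines; labels of maximal spines are singletons. -/

section

open SimpleGraph

namespace SignedTree

variable {V : Type*} {T : SignedTree V} {S : LabeledDigraph V}

/-- Let U be the label of `u`; only the two nodes replacing U need care. Branches moved to {u} lie
in the component of `u` in T∖(U⁻∖{u}), so two of them connected in T∖{u} would be connected in T∖U⁻.
Branches left at the rest are outside this component, so a path joining two of them and avoiding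
U⁻∖{u} also avoids `u`. As `u` is negative, {u} has no positive part to delete, and the rest keeps
all of U⁺. -/
theorem split_isSpine (hS : T.IsSpine S) {u u' : V} (hu : S.same u u') (hne : u' ≠ u)
    (hneg : u ∈ T.neg) : T.IsSpine (T.split S hS u) := by
  have hD := hS.isDirectedTree
  obtain ⟨hD', hsplit, hother⟩ := split_isDirectedTree hS hu hne
  set S' := T.split S hS u with hS'
  have arcS : ∀ x y, S'.arc x y → x ≠ u → S.arc x y := by
    rintro x y (⟨rfl, -⟩ | ⟨-, rfl, h, -⟩ | ⟨-, -, h, -⟩) hx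
    · exact absurd rfl hx
    · exact h
    · exact h
  have hsame : ∀ x y, S.same x y → x ≠ u → y ≠ u → S'.same x y := fun x y h hx hy =>
    ⟨h, by simp [hx, hy]⟩
  have label_u : S'.label u = {u} := by
    ext x
    exact ⟨fun h => h.2.1 rfl, fun h => by rw [h]; exact S'.same.refl u⟩
  have label_rest : ∀ w, S.same u w → w ≠ u → S'.label w = S.label u \ {u} := by
    intro w hw hwu
    ext x
    constructor
    · exact fun h => ⟨S.same.trans hw h.1, fun hx => hwu (h.2.2 hx)⟩
    · exact fun h => hsame _ _ (S.same.trans (S.same.symm hw) h.1) hwu h.2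
  have label_other : ∀ w, ¬ S.same u w → S'.label w = S.label w := by
    intro w hw
    ext x
    constructor
    · exact fun h => h.1
    · refine fun h => hsame _ _ h ?_ ?_
      · rintro rfl; exact hw (S.same.refl _)
      · rintro rfl; exact hw (S.same.symm h)
  have label_eq : ∀ w, S.same u w → S.label w = S.label u := by
    intro w hw
    ext x
    exact ⟨fun h => S.same.trans hw h, fun h => S.same.trans (S.same.symm hw) h⟩
  have rest_neg : (S.label u \ {u}) ∩ T.neg = (S.label u ∩ T.neg) \ {u} := by
    ext x; simp only [Set.mem_inter_iff, Set.mem_sdiff]; tauto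
  have union_neg : {u} ∪ (S.label u ∩ T.neg) \ {u} = S.label u ∩ T.neg := by
    rw [Set.singleton_union, Set.insert_sdiff_singleton, Set.insert_eq_of_mem]
    exact ⟨S.same.refl u, hneg⟩
  have rest_pos : (S.label u \ {u}) ∩ T.negᶜ = S.label u ∩ T.negᶜ := by
    ext x
    constructor
    · exact fun h => ⟨h.1.1, h.2⟩
    · exact fun h => ⟨⟨h.1, fun hx => h.2 (hx ▸ hneg)⟩, h.2⟩
  have source_u : ∀ x w, S'.arc x w → x ≠ u → S.same u w → S.arc x u := fun x w h hx hw =>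
    S.arc_congr _ _ _ _ (S.same.refl x) (S.same.symm hw) (arcS x w h hx)
  have sources : ∀ x w, S'.arc x w → x ≠ u → S.same u w →
      S'.sourceSet x w = S.sourceSet x u := fun x w h hx hw => by
    rw [hother x w hx h, S.sourceSet_congr (S.same.refl x) (S.same.symm hw)]
  have below_u : ∀ x, S'.arc x u → x ≠ u ∧ T.SplitBelow S u x := by
    rintro x (⟨-, -, h⟩ | ⟨h, -, -, h'⟩ | ⟨-, h, -⟩)
    · exact absurd rfl h
    · exact ⟨h, h'⟩
    · exact absurd rfl h
  have not_below : ∀ x w, S'.arc x w → x ≠ u → S.same u w → w ≠ u → ¬ T.SplitBelow S u x := by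
    rintro x w (⟨h, -⟩ | ⟨-, h, -⟩ | ⟨-, -, -, h⟩) hx hw hwu
    · exact absurd h hx
    · exact absurd h hwu
    · exact h hw
  have split_same : ∀ z ∈ T.splitSource S u, T.SameComponent ((S.label u ∩ T.neg) \ {u}) z u := by
    rintro z (rfl | ⟨a, ha, hb, hz⟩)
    · exact sameComponent_refl (fun h => h.2 rfl)
    · exact (splitBelow_congr hS ha (S.mem_sourceSet_self _ _) hz).1 hb
  have arc_from_u : ∀ w, S'.arc u w → S.same u w ∧ w ≠ u := by
    rintro w (⟨-, h⟩ | ⟨h, -⟩ | ⟨h, -⟩)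
    · exact h
    · exact absurd rfl h
    · exact absurd rfl h
  have sink_eq : ∀ w v, S'.arc w v → w ≠ u → S'.sinkSet w v = S.sinkSet w v := fun w v h hw => by
    rw [hD'.sinkSet_eq h, hD.sinkSet_eq (arcS _ _ h hw), hother w v hw h]
  refine ⟨hD', ?_, ?_, ?_, ?_⟩
  · intro p w hpw x hx y hy
    by_cases hp : p = u
    · subst hp
      obtain ⟨hw, hwu⟩ := arc_from_u w hpw
      rw [hsplit w hw hwu] at hx hy
      rw [label_rest w hw hwu, rest_neg]
      exact (split_same x hx).trans (split_same y hy).symm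
    · by_cases hw : S.same u w
      · rw [sources p w hpw hp hw] at hx hy
        refine (hS.source_subset p u (source_u p w hpw hp hw) x hx y hy).mono ?_
        refine Set.inter_subset_inter_left _ ?_
        rw [← label_eq w hw]
        exact fun z hz => hz.1
      · rw [hother p w hp hpw] at hx hy
        rw [label_other w hw]
        exact hS.source_subset p w (arcS p w hpw hp) x hx y hy
  · intro p p' w hp hp' hpp x hx y hy hc
    have rest : ∀ q, S'.arc q w → q ≠ u → S.same u w → w ≠ u → ∀ z ∈ S'.sourceSet q w,
        ¬ T.SameComponent ((S.label u ∩ T.neg) \ {u}) z u := by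
      intro q hq hqu hw hwu z hz hzu
      rw [sources q w hq hqu hw] at hz
      refine not_below q w hq hqu hw hwu ?_
      exact (splitBelow_congr hS (source_u q w hq hqu hw) hz (S.mem_sourceSet_self _ _)).1 hzu
    by_cases hpu : p = u
    · have hpu' : p' ≠ u := fun h => hpp (by rw [hpu, h])
      subst hpu
      obtain ⟨hw, hwu⟩ := arc_from_u w hp
      rw [hsplit w hw hwu] at hx
      rw [label_rest w hw hwu, rest_neg] at hc
      exact rest p' hp' hpu' hw hwu y hy (hc.symm.trans (split_same x hx))
    by_cases hpu' : p' = u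
    · subst hpu'
      obtain ⟨hw, hwu⟩ := arc_from_u w hp'
      rw [hsplit w hw hwu] at hy
      rw [label_rest w hw hwu, rest_neg] at hc
      exact rest p hp hpu hw hwu x hx (hc.trans (split_same y hy))
    have hpp' : ¬ S.same p p' := fun h => hpp (hsame _ _ h hpu hpu')
    by_cases hw : S.same u w
    · have key : ¬ T.SameComponent (S.label u ∩ T.neg) x y := by
        rw [sources p w hp hpu hw] at hx
        rw [sources p' w hp' hpu' hw] at hy
        exact hS.source_distinct p p' u (source_u p w hp hpu hw) (source_u p' w hp' hpu' hw) hpp'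
          x hx y hy
      by_cases hwu : w = u
      · subst hwu
        rw [label_u] at hc
        rw [sources p w hp hpu hw] at hx
        rw [sources p' w hp' hpu' hw] at hy
        refine key ?_
        have h1 := (splitBelow_congr hS (source_u p w hp hpu hw) (S.mem_sourceSet_self _ _) hx).1
          (below_u p hp).2
        have h2 := (splitBelow_congr hS (source_u p' w hp' hpu' hw) (S.mem_sourceSet_self _ _) hy).1
          (below_u p' hp').2
        rw [Set.inter_eq_left.2 (Set.singleton_subset_iff.2 hneg)] at hc
        have := hc.union (SameComponent.trans h1 (SameComponent.symm h2))
        rwa [union_neg] at this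
      · rw [label_rest w hw hwu, rest_neg] at hc
        have := hc.singleton_union (rest p hp hpu hw hwu x hx)
        rw [union_neg] at this
        exact key this
    · rw [hother p w hpu hp] at hx
      rw [hother p' w hpu' hp'] at hy
      rw [label_other w hw] at hc
      exact hS.source_distinct p p' w (arcS p w hp hpu) (arcS p' w hp' hpu') hpp' x hx y hy hc
  · intro w v hwv x hx y hy
    by_cases hw : w = u
    · subst hw
      rw [label_u]
      refine sameComponent_of_eq_empty ?_ x y
      rw [← Set.disjoint_iff_inter_eq_empty, Set.disjoint_singleton_left]
      exact fun h => h hneg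
    · rw [sink_eq w v hwv hw] at hx hy
      have := hS.sink_subset w v (arcS w v hwv hw) x hx y hy
      by_cases hwu : S.same u w
      · rw [label_rest w hwu hw, rest_pos]
        rwa [label_eq w hwu] at this
      · rwa [label_other w hwu]
  · intro w v v' hv hv' hvv x hx y hy
    by_cases hw : w = u
    · subst hw
      obtain ⟨h1, h2⟩ := arc_from_u v hv
      obtain ⟨h3, h4⟩ := arc_from_u v' hv'
      exact absurd (hsame _ _ (S.same.trans (S.same.symm h1) h3) h2 h4) hvv
    · have hvv' : ¬ S.same v v' := by
        intro h
        by_cases h1 : v = u <;> by_cases h2 : v' = u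
        · exact hvv (by rw [h1, h2])
        · exact not_below w v' hv' hw (h1 ▸ h) h2 (below_u w (h1 ▸ hv)).2
        · exact not_below w v hv hw (h2 ▸ S.same.symm h) h1 (below_u w (h2 ▸ hv')).2
        · exact hvv (hsame _ _ h h1 h2)
      rw [sink_eq w v hv hw] at hx
      rw [sink_eq w v' hv' hw] at hy
      have := hS.sink_distinct w v v' (arcS w v hv hw) (arcS w v' hv' hw) hvv' x hx y hy
      by_cases hwu : S.same u w
      · rw [label_rest w hwu hw, rest_pos]
        rwa [label_eq w hwu] at this
      · rwa [label_other w hwu]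

theorem exists_refinement (hS : T.IsSpine S) {u u' : V} (hu : S.same u u') (hne : u' ≠ u)
    (hneg : u ∈ T.neg) :
    ∃ S', T.IsSpine S' ∧ (∃ a b, S'.arc a b ∧ S = S'.contract a b) ∧ ¬ S'.same u u' := by
  refine ⟨T.split S hS u, split_isSpine hS hu hne hneg,
    ⟨u, u', Or.inl ⟨rfl, hu, hne⟩, (split_contract hS hu hne).symm⟩, fun h => hne (h.2.1 rfl)⟩

/-- From a label with two elements one can split off `u`: directly if it is negative, after
reversing arcs and signs if it is positive. -/
theorem IsMaximalSpine.eq_of_same (hS : T.IsMaximalSpine S) {u u' : V} (hu : S.same u u') :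
    u = u' := by
  by_contra hne
  have hne' : u' ≠ u := fun h => hne h.symm
  suffices h : ∃ S', T.IsSpine S' ∧ (∃ a b, S'.arc a b ∧ S = S'.contract a b) ∧ ¬ S'.same u u' by
    obtain ⟨S', hS', ⟨a, b, hab, h⟩, hn⟩ := h
    have := hS.2 S' hS' (Relation.ReflTransGen.single ⟨a, b, hab, h⟩)
    exact hn (this ▸ hu)
  by_cases hneg : u ∈ T.neg
  · exact exists_refinement hS.1 hu hne' hneg
  · obtain ⟨S', hS', ⟨a, b, hab, h⟩, hn⟩ := exists_refinement (T := T.op) hS.1.op hu hne' hneg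
    refine ⟨S'.op, ?_, ⟨b, a, hab, ?_⟩, hn⟩
    · have := hS'.op
      rwa [op_op] at this
    · rw [LabeledDigraph.contract_op, ← h, LabeledDigraph.op_op]

end SignedTree

end

/-! ### Turns of paths, and uniqueness of the spine with a given linear extension. -/

section

open SimpleGraph

namespace LabeledDigraph

variable {V : Type*} {S : LabeledDigraph V}

/-- All labels are singletons. -/
def IsSimple (S : LabeledDigraph V) : Prop := ∀ x y, S.same x y → x = y

/-- The path from `x` to `y` enters and leaves `w` by incoming arcs of `w`. -/
def Peak (S : LabeledDigraph V) (x y w : V) : Prop :=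
  ∃ a b, S.arc a w ∧ S.arc b w ∧ a ≠ b ∧ x ∈ S.sourceSet a w ∧ y ∈ S.sourceSet b w

/-- The path from `x` to `y` enters and leaves `w` by outgoing arcs of `w`. -/
def Valley (S : LabeledDigraph V) (x y w : V) : Prop :=
  ∃ a b, S.arc w a ∧ S.arc w b ∧ a ≠ b ∧ x ∉ S.sourceSet w a ∧ y ∉ S.sourceSet w b

theorem IsSimple.label_eq (h : S.IsSimple) (v : V) : S.label v = {v} := by
  ext x
  exact ⟨fun hx => (h _ _ hx).symm, fun hx => by rw [hx]; exact S.same.refl v⟩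

theorem IsSimple.cut (h : S.IsSimple) (hD : S.IsDirectedTree) {u v x y : V} (huv : S.arc u v)
    (hxy : S.arc x y) : (x ∈ S.sourceSet u v ↔ y ∈ S.sourceSet u v) ∨ (x = u ∧ y = v) :=
  (hD.cut huv hxy).imp_right fun ⟨h1, h2⟩ => ⟨h _ _ h1, h _ _ h2⟩

theorem IsSimple.node_bijective (h : S.IsSimple) : Function.Bijective S.node :=
  ⟨fun _ _ hxy => h _ _ (node_eq_node.1 hxy), node_surjective⟩

/-- Two vertices are comparable, or the path joining them has a first turn. -/
theorem IsSimple.turn (h : S.IsSimple) (hD : S.IsDirectedTree) (x y : V) :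
    x = y ∨ S.Below x y ∨ S.Below y x ∨ (∃ w, S.Below x w ∧ S.Peak x y w) ∨
      ∃ w, S.Below w x ∧ S.Valley x y w := by
  -- The walk may backtrack, so each case allows the last arc to shorten a directed path or to undo
  -- a turn; the cut of the arc crossed decides which.
  induction hD.links x y with
  | refl => exact Or.inl rfl
  | tail _ hl ih =>
    rename_i y y' _
    rcases hl with hl | hl | hl
    · rw [← h _ _ hl]; exact ih
    · rcases ih with rfl | ih | ih | ⟨w, hw, a, b, ha, hb, hab, hx, hy⟩ |
        ⟨w, hw, a, b, ha, hb, hab, hx, hy⟩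
      · exact Or.inr (Or.inl (Relation.TransGen.single hl))
      · exact Or.inr (Or.inl (Relation.TransGen.tail ih hl))
      · obtain ⟨c, hc, hcx⟩ := Relation.TransGen.head'_iff.1 ih
        by_cases hcy : c = y'
        · subst hcy
          rcases Relation.reflTransGen_iff_eq_or_transGen.1 hcx with h' | h'
          · exact Or.inl h'
          · exact Or.inr (Or.inr (Or.inl h'))
        · refine Or.inr (Or.inr (Or.inr (Or.inr ⟨y, ih, c, y', hc, hl, hcy, fun hx => ?_,
            hD.notMem_sourceSet hl⟩)))
          refine hD.notMem_sourceSet hc ?_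
          rcases Relation.reflTransGen_iff_eq_or_transGen.1 hcx with h' | h'
          · subst h'; exact hx
          · exact hD.mem_sourceSet_of_below hc h' hx
      · by_cases hy' : y' ∈ S.sourceSet b w
        · exact Or.inr (Or.inr (Or.inr (Or.inl ⟨w, hw, a, b, ha, hb, hab, hx, hy'⟩)))
        · rcases h.cut hD hb hl with h' | ⟨-, h'⟩
          · exact absurd (h'.1 hy) hy'
          · exact Or.inr (Or.inl (h' ▸ hw))
      · refine Or.inr (Or.inr (Or.inr (Or.inr ⟨w, hw, a, b, ha, hb, hab, hx, fun hy' => ?_⟩)))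
        exact hy (hD.mem_sourceSet_of_arc hb hl hy')
    · rcases ih with rfl | ih | ih | ⟨w, hw, a, b, ha, hb, hab, hx, hy⟩ |
        ⟨w, hw, a, b, ha, hb, hab, hx, hy⟩
      · exact Or.inr (Or.inr (Or.inl (Relation.TransGen.single hl)))
      · obtain ⟨c, hcx, hc⟩ := Relation.TransGen.tail'_iff.1 ih
        by_cases hcy : c = y'
        · subst hcy
          rcases Relation.reflTransGen_iff_eq_or_transGen.1 hcx with h' | h'
          · exact Or.inl h'.symm
          · exact Or.inr (Or.inl h')
        · refine Or.inr (Or.inr (Or.inr (Or.inl ⟨y, ih, c, y', hc, hl, hcy, ?_,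
            S.mem_sourceSet_self _ _⟩)))
          rcases Relation.reflTransGen_iff_eq_or_transGen.1 hcx with h' | h'
          · rw [← h']; exact S.mem_sourceSet_self _ _
          · exact hD.mem_sourceSet_of_below hc h' (S.mem_sourceSet_self _ _)
      · exact Or.inr (Or.inr (Or.inl (Relation.TransGen.head hl ih)))
      · exact Or.inr (Or.inr (Or.inr (Or.inl ⟨w, hw, a, b, ha, hb, hab, hx,
          hD.mem_sourceSet_of_arc hb hl hy⟩)))
      · by_cases hy' : y' ∈ S.sourceSet w b
        · rcases h.cut hD hb hl with h' | ⟨h', -⟩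
          · exact absurd (h'.1 hy') hy
          · exact Or.inr (Or.inr (Or.inl (h' ▸ hw)))
        · exact Or.inr (Or.inr (Or.inr (Or.inr ⟨w, hw, a, b, ha, hb, hab, hx, hy'⟩)))

/-- Arcs are the cover relations. -/
theorem IsSimple.arc_iff (h : S.IsSimple) (hD : S.IsDirectedTree) {u v : V} :
    S.arc u v ↔ S.Below u v ∧ ∀ w, S.Below u w → ¬ S.Below w v := by
  constructor
  · intro huv
    refine ⟨Relation.TransGen.single huv, fun w hw hwv => ?_⟩
    obtain ⟨c, hc, hcw⟩ := Relation.TransGen.head'_iff.1 hw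
    have hcv : S.Below c v := Relation.TransGen.trans_right hcw hwv
    rcases h.cut hD hc huv with h' | ⟨-, h'⟩
    · exact hD.notMem_sourceSet hc (hD.mem_sourceSet_of_below hc hcv
        (h'.1 (S.mem_sourceSet_self _ _)))
    · exact hD.not_below_self v (h' ▸ hcv)
  · rintro ⟨huv, hn⟩
    obtain ⟨c, hc, hcv⟩ := Relation.TransGen.head'_iff.1 huv
    rcases Relation.reflTransGen_iff_eq_or_transGen.1 hcv with h' | h'
    · rwa [h']
    · exact absurd h' (hn c (Relation.TransGen.single hc))

end LabeledDigraph

namespace SignedTree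

variable {V : Type*} {T : SignedTree V} {S : LabeledDigraph V}

theorem IsMaximalSpine.isSimple (hS : T.IsMaximalSpine S) : S.IsSimple := fun _ _ h =>
  hS.eq_of_same h

theorem mem_support_of_not_sameComponent {X : Set V} {x y w : V}
    (h : ¬ T.SameComponent ({w} ∩ X) x y) (p : T.graph.Walk x y) : w ∈ p.support ∧ w ∈ X := by
  by_contra hc
  refine h (sameComponent_iff.2 ⟨p, fun z hz hzX => hc ?_⟩)
  obtain ⟨rfl, hzX⟩ := hzX
  exact ⟨hz, hzX⟩

section

variable (hS : T.IsSpine S) (h : S.IsSimple)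
include hS h

theorem IsSpine.peak {x y w : V} (hw : S.Peak x y w) :
    ¬ T.SameComponent ({w} ∩ T.neg) x y := by
  obtain ⟨a, b, ha, hb, hab, hx, hy⟩ := hw
  have := hS.source_distinct a b w ha hb (fun h' => hab (h _ _ h')) x hx y hy
  rwa [h.label_eq] at this

theorem IsSpine.valley {x y w : V} (hw : S.Valley x y w) :
    ¬ T.SameComponent ({w} ∩ T.negᶜ) x y := by
  obtain ⟨a, b, ha, hb, hab, hx, hy⟩ := hw
  have hD := hS.isDirectedTree
  have := hS.sink_distinct w a b ha hb (fun h' => hab (h _ _ h')) x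
    (by rw [hD.sinkSet_eq ha]; exact hx) y (by rw [hD.sinkSet_eq hb]; exact hy)
  rwa [h.label_eq] at this

theorem IsSpine.sameComponent_source {a w x y : V} (ha : S.arc a w) (hx : x ∈ S.sourceSet a w)
    (hy : y ∈ S.sourceSet a w) : T.SameComponent ({w} ∩ T.neg) x y := by
  have := hS.source_subset a w ha x hx y hy
  rwa [h.label_eq] at this

theorem IsSpine.sameComponent_sink {a w x y : V} (ha : S.arc w a) (hx : x ∉ S.sourceSet w a)
    (hy : y ∉ S.sourceSet w a) : T.SameComponent ({w} ∩ T.negᶜ) x y := by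
  have hD := hS.isDirectedTree
  have := hS.sink_subset w a ha x (by rw [hD.sinkSet_eq ha]; exact hx) y
    (by rw [hD.sinkSet_eq ha]; exact hy)
  rwa [h.label_eq] at this

/-- If `t` were above `u`, the arc would lie in one incoming branch of `t`, so `t` would not be on
the path of T. If the path of `S` from `t` to `u` turned at `w`, then `u` and `v` would lie on the
same side of `w`, hence `t` in the same component as them, against the turn. The exception is a peak
at `w = v`, where the piece of the path from `u` to `t` avoids `v`. -/
theorem IsSpine.below_of_neg {u v t : V} (huv : S.arc u v) {p : T.graph.Walk u v} (hp : p.IsPath)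
    (ht : t ∈ p.support) (htu : t ≠ u) (htv : t ≠ v) (htn : t ∈ T.neg) : S.Below t u := by
  have hD := hS.isDirectedTree
  rcases h.turn hD t u with h' | h' | h' | ⟨w, htw, a, b, ha, hb, hab, hx, hy⟩ |
    ⟨w, htw, a, b, ha, hb, hab, hx, hy⟩
  · exact absurd h' htu
  · exact h'
  · obtain ⟨a, hua, ha⟩ := Relation.TransGen.tail'_iff.1 h'
    have hu : u ∈ S.sourceSet a t := by
      rcases Relation.reflTransGen_iff_eq_or_transGen.1 hua with h' | h'
      · rw [← h']; exact S.mem_sourceSet_self _ _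
      · exact hD.mem_sourceSet_of_below ha h' (S.mem_sourceSet_self _ _)
    rcases h.cut hD ha huv with h2 | ⟨-, h2⟩
    · exact absurd ⟨rfl, htn⟩
        ((hS.sameComponent_source h ha hu (h2.1 hu)).notMem_of_mem_path hp ht)
    · exact absurd h2.symm htv
  · have hpk := hS.peak h ⟨a, b, ha, hb, hab, hx, hy⟩
    rcases h.cut hD hb huv with h2 | ⟨-, h2⟩
    · exact absurd ((hS.sameComponent_source h hb hy (h2.1 hy)).of_mem_path hp ht).symm hpk
    · subst h2
      obtain ⟨q, hq⟩ : ∃ q : T.graph.Walk u t, v ∉ q.support := by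
        classical
        exact ⟨p.takeUntil t ht, Walk.endpoint_notMem_support_takeUntil hp ht htv.symm⟩
      refine absurd (sameComponent_iff.2 ⟨q, fun z hz hzv => hq ?_⟩).symm hpk
      rw [← Set.mem_singleton_iff.1 hzv.1]
      exact hz
  · have hva := hS.valley h ⟨a, b, ha, hb, hab, hx, hy⟩
    have hv : v ∉ S.sourceSet w b := fun hv => hy (hD.mem_sourceSet_of_arc hb huv hv)
    exact absurd ((hS.sameComponent_sink h hb hy hv).of_mem_path hp ht).symm hva

theorem IsSpine.below_of_pos {u v t : V} (huv : S.arc u v) {p : T.graph.Walk u v} (hp : p.IsPath)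
    (ht : t ∈ p.support) (htu : t ≠ u) (htv : t ≠ v) (htn : t ∉ T.neg) : S.Below v t := by
  have ht' : t ∈ p.reverse.support := by simpa using ht
  have := hS.op.below_of_neg (S := S.op) h (u := v) (v := u) (t := t) huv
    (p := (p.reverse : T.graph.Walk v u)) hp.reverse ht' htv htu htn
  exact S.below_op.1 this

/-- A first peak `w` of `S'` between `u` and `v` is a negative vertex on their path in T, so `S`
puts it below `u` while `S'` puts it above. A first valley is a positive vertex, which `S` puts
above `v` and `S'` below `u`. Neither is compatible with a common linear extension. -/
theorem IsSpine.below_of_arc {S' : LabeledDigraph V} (hS' : T.IsSpine S') (h' : S'.IsSimple)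
    {lt : V → V → Prop} [IsStrictTotalOrder V lt] (hlt : S.IsLinearExtension lt)
    (hlt' : S'.IsLinearExtension lt) {u v : V} (huv : S.arc u v) : S'.Below u v := by
  have hltuv := hlt _ _ (Relation.TransGen.single huv)
  obtain ⟨p, hp, -⟩ := T.isTree.existsUnique_path u v
  have hD' := hS'.isDirectedTree
  rcases h'.turn hD' u v with e | e | e | ⟨w, hw, hpk⟩ | ⟨w, hw, hva⟩
  · subst e
    exact absurd hltuv (irrefl u)
  · exact e
  · exact absurd hltuv (asymm (hlt' _ _ e))
  · obtain ⟨h1, h2⟩ := mem_support_of_not_sameComponent (hS'.peak h' hpk) p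
    obtain ⟨a, b, ha, hb, hab, hx, hy⟩ := hpk
    have hwu : w ≠ u := by rintro rfl; exact hD'.notMem_sourceSet ha hx
    have hwv : w ≠ v := by rintro rfl; exact hD'.notMem_sourceSet hb hy
    exact absurd (hlt' _ _ hw) (asymm (hlt _ _ (hS.below_of_neg h huv hp h1 hwu hwv h2)))
  · obtain ⟨h1, h2⟩ := mem_support_of_not_sameComponent (hS'.valley h' hva) p
    obtain ⟨a, b, ha, hb, hab, hx, hy⟩ := hva
    have hwu : w ≠ u := by rintro rfl; exact hx (S'.mem_sourceSet_self _ _)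
    have hwv : w ≠ v := by rintro rfl; exact hy (S'.mem_sourceSet_self _ _)
    have := hlt _ _ (hS.below_of_pos h huv hp h1 hwu hwv h2)
    exact absurd (_root_.trans (hlt' _ _ hw) hltuv) (asymm this)

end

theorem IsSpine.eq_of_isLinearExtension {S' : LabeledDigraph V} (hS : T.IsSpine S)
    (h : S.IsSimple) (hS' : T.IsSpine S') (h' : S'.IsSimple) {lt : V → V → Prop}
    [IsStrictTotalOrder V lt] (hlt : S.IsLinearExtension lt) (hlt' : S'.IsLinearExtension lt) :
    S = S' := by
  have key : ∀ {S S' : LabeledDigraph V}, T.IsSpine S → S.IsSimple → T.IsSpine S' → S'.IsSimple →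
      S.IsLinearExtension lt → S'.IsLinearExtension lt → ∀ u v, S.Below u v → S'.Below u v := by
    intro S S' hS h hS' h' hlt hlt' u v huv
    induction huv with
    | single huv => exact hS.below_of_arc h hS' h' hlt hlt' huv
    | tail _ hbc ih => exact Relation.TransGen.trans ih (hS.below_of_arc h hS' h' hlt hlt' hbc)
  have hb : ∀ u v, S.Below u v ↔ S'.Below u v := fun u v =>
    ⟨key hS h hS' h' hlt hlt' u v, key hS' h' hS h hlt' hlt u v⟩
  refine LabeledDigraph.ext ?_ ?_
  · ext x y
    constructor
    · intro hxy
      rw [h _ _ hxy]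
    · intro hxy
      rw [h' _ _ hxy]
  · funext u v
    rw [eq_iff_iff, h.arc_iff hS.isDirectedTree, h'.arc_iff hS'.isDirectedTree]
    simp only [hb]

/-- `S` itself provides existence, so only uniqueness enters; that every linear order extends some
maximal spine is not needed. -/
theorem kappa_eq (hS : T.IsMaximalSpine S) {lt : V → V → Prop} [IsStrictTotalOrder V lt]
    (hlt : S.IsLinearExtension lt) : T.kappa lt = S := by
  have hex : ∃! S, T.IsMaximalSpine S ∧ S.IsLinearExtension lt :=
    ⟨S, ⟨hS, hlt⟩, fun S' hS' =>
      hS'.1.1.eq_of_isLinearExtension hS'.1.isSimple hS.1 hS.isSimple hS'.2 hlt⟩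
  rw [kappa, dif_pos hex]
  exact hex.unique hex.choose_spec.1 ⟨hS, hlt⟩

theorem isLinearExtension_of_kappa_eq {lt : V → V → Prop} (h : T.kappa lt = S) :
    S.IsLinearExtension lt := by
  by_cases hex : ∃! S, T.IsMaximalSpine S ∧ S.IsLinearExtension lt
  · rw [kappa, dif_pos hex] at h
    rw [← h]
    exact hex.choose_spec.1.2
  · rw [kappa, dif_neg hex] at h
    rw [← h]
    -- The default value of `kappa` has no arcs, so every order extends it.
    intro u v huv
    obtain ⟨c, hc, -⟩ := Relation.TransGen.head'_iff.1 huv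
    exact hc.elim

theorem mem_kappaFiber (hS : T.IsMaximalSpine S) {lt : V → V → Prop} :
    lt ∈ T.kappaFiber S ↔ IsStrictTotalOrder V lt ∧ S.IsLinearExtension lt :=
  and_congr_right fun _ => ⟨isLinearExtension_of_kappa_eq, kappa_eq hS⟩

end SignedTree

end

/-! ### Source label sets are signed building blocks. -/

section

open SimpleGraph

namespace LabeledDigraph

variable {V : Type*} {S : LabeledDigraph V}

/-- The source set of `s → t` is connected to `s` without using `a → v`, since `a` is outside it. -/
theorem IsSimple.sourceSet_subset (h : S.IsSimple) (hD : S.IsDirectedTree) {s t a v : V}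
    (hst : S.arc s t) (hav : S.arc a v) (ha : a ∉ S.sourceSet s t) (hs : s ∈ S.sourceSet a v) :
    S.sourceSet s t ⊆ S.sourceSet a v := by
  intro z
  induction hD.links s z with
  | refl => exact fun _ => hs
  | tail _ hl ih =>
    rename_i z z' _
    intro hz'
    rcases hl with hl | hl | hl
    · rw [← h _ _ hl] at hz' ⊢
      exact ih hz'
    · have hz := hD.mem_sourceSet_of_arc hst hl hz'
      rcases h.cut hD hav hl with h' | ⟨h', -⟩
      · exact h'.1 (ih hz)
      · exact absurd (h' ▸ hz) ha
    · by_cases hz : z ∈ S.sourceSet s t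
      · exact hD.mem_sourceSet_of_arc hav hl (ih hz)
      · rcases h.cut hD hst hl with h' | ⟨h', -⟩
        · exact absurd (h'.1 hz') hz
        · rwa [h']

theorem IsSimple.exists_arc_source_subset (h : S.IsSimple) (hD : S.IsDirectedTree) {s t v : V}
    (hst : S.arc s t) (hv : t = v ∨ S.Below t v) :
    ∃ a, S.arc a v ∧ S.sourceSet s t ⊆ S.sourceSet a v ∧ (t = a ∨ S.Below t a ∨ a = s) := by
  rcases hv with rfl | hv
  · exact ⟨s, hst, subset_rfl, Or.inr (Or.inr rfl)⟩
  · obtain ⟨a, hta, hav⟩ := Relation.TransGen.tail'_iff.1 hv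
    have hta' := Relation.reflTransGen_iff_eq_or_transGen.1 hta
    have hsa : S.Below s a := by
      rcases hta' with h' | h'
      · rw [h']; exact Relation.TransGen.single hst
      · exact Relation.TransGen.head hst h'
    refine ⟨a, hav, h.sourceSet_subset hD hst hav ?_ ?_, ?_⟩
    · intro ha
      refine hD.notMem_sourceSet hst ?_
      rcases hta' with h' | h'
      · subst h'; exact ha
      · exact hD.mem_sourceSet_of_below hst h' ha
    · exact hD.mem_sourceSet_of_below hav hsa (S.mem_sourceSet_self _ _)
    · rcases hta' with h' | h'
      · exact Or.inl h'.symm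
      · exact Or.inr (Or.inl h')

/-- The path leaving the source set of an arc towards `v` is directed or has a first peak. -/
theorem IsSimple.below_or_peak (h : S.IsSimple) (hD : S.IsDirectedTree) {s t v : V}
    (hst : S.arc s t) (hv : v ∉ S.sourceSet s t) :
    (t = v ∨ S.Below t v) ∨ ∃ w a b, (t = w ∨ S.Below t w) ∧ S.arc a w ∧ S.arc b w ∧ a ≠ b ∧
      S.sourceSet s t ⊆ S.sourceSet a w ∧ v ∈ S.sourceSet b w := by
  revert hv
  induction hD.links t v with
  | refl => exact fun _ => Or.inl (Or.inl rfl)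
  | tail _ hl ih =>
    rename_i z z' _
    intro hz'
    rcases hl with hl | hl | hl
    · rw [← h _ _ hl] at hz' ⊢
      exact ih hz'
    · by_cases hz : z ∈ S.sourceSet s t
      · rcases h.cut hD hst hl with h' | ⟨-, h'⟩
        · exact absurd (h'.1 hz) hz'
        · exact Or.inl (Or.inl h'.symm)
      · rcases ih hz with h' | ⟨w, a, b, htw, ha, hb, hab, hsub, hzb⟩
        · refine Or.inl (Or.inr ?_)
          rcases h' with rfl | h'
          · exact Relation.TransGen.single hl
          · exact Relation.TransGen.tail h' hl
        · by_cases hzb' : z' ∈ S.sourceSet b w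
          · exact Or.inr ⟨w, a, b, htw, ha, hb, hab, hsub, hzb'⟩
          · rcases h.cut hD hb hl with h' | ⟨h1, h2⟩
            · exact absurd (h'.1 hzb) hzb'
            · exact Or.inl (h2 ▸ htw)
    · have hz : z ∉ S.sourceSet s t := fun hz => hz' (hD.mem_sourceSet_of_arc hst hl hz)
      rcases ih hz with h' | ⟨w, a, b, htw, ha, hb, hab, hsub, hzb⟩
      · obtain ⟨a, ha, hsub, hta⟩ := h.exists_arc_source_subset hD hst h'
        by_cases haz : a = z'
        · subst haz
          rcases hta with h1 | h1 | h1
          · exact Or.inl (Or.inl h1)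
          · exact Or.inl (Or.inr h1)
          · exact absurd (h1 ▸ S.mem_sourceSet_self _ _) hz'
        · exact Or.inr ⟨z, a, z', h', ha, hl, haz, hsub, S.mem_sourceSet_self _ _⟩
      · exact Or.inr ⟨w, a, b, htw, ha, hb, hab, hsub, hD.mem_sourceSet_of_arc hb hl hzb⟩

end LabeledDigraph

namespace SignedTree

variable {V : Type*} {T : SignedTree V} {S : LabeledDigraph V}

/-- Let `v` be negative, outside the source set but between two of its elements. If `v` is above the
arc, the source set lies in one incoming branch of `v`, hence in one component of T∖{v}. Otherwise
some peak `w` has the source set in one incoming branch and `v` in another, although the path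
through `v` stays in one component after deletion of the negative part of {w}. -/
theorem IsSpine.convexFor_source (hS : T.IsSpine S) (h : S.IsSimple) {s t : V} (hst : S.arc s t) :
    T.ConvexFor T.neg (S.sourceSet s t) := by
  intro x hx y hy p hp v hv hvn
  have hD := hS.isDirectedTree
  by_contra hvs
  rcases h.below_or_peak hD hst hvs with h' | ⟨w, a, b, -, ha, hb, hab, hsub, hvb⟩
  · obtain ⟨a, ha, hsub, -⟩ := h.exists_arc_source_subset hD hst h'
    exact (hS.sameComponent_source h ha (hsub hx) (hsub hy)).notMem_of_mem_path hp hv ⟨rfl, hvn⟩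
  · exact hS.peak h ⟨a, b, ha, hb, hab, hsub hx, hvb⟩
      ((hS.sameComponent_source h ha (hsub hx) (hsub hy)).of_mem_path hp hv)

theorem IsSpine.isBuildingBlock_source (hS : T.IsSpine S) (h : S.IsSimple) {s t : V}
    (hst : S.arc s t) : T.IsBuildingBlock (S.sourceSet s t) := by
  refine ⟨hS.convexFor_source h hst, ?_⟩
  have := hS.op.convexFor_source (S := S.op) h (s := t) (t := s) hst
  rw [S.sourceSet_op, hS.isDirectedTree.sinkSet_eq hst] at this
  exact this

end SignedTree

end

/-! ### The coordinates of a(S): tightness on source sets. -/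

section

open SimpleGraph

namespace SimpleGraph

variable {N : Type*} {G : SimpleGraph N}

theorem IsTree.ncard_side_add (hG : G.IsTree) [Fintype N] {v w : N} (h : G.Adj v w) :
    (G.side v w).ncard + (G.side w v).ncard = Fintype.card N := by
  rw [hG.side_swap h, Set.ncard_add_ncard_compl, Nat.card_eq_fintype_card]

/-- The paths through `v` which use no edge from `v` to an element of `O`. -/
def pathsAvoiding (G : SimpleGraph N) (v : N) (O : Set N) : Set G.Subgraph :=
  {H | (∃ (A B : N) (p : G.Walk A B), p.IsPath ∧ H = p.toSubgraph) ∧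
    v ∈ H.verts ∧ ∀ w ∈ O, ¬ H.Adj v w}

theorem cast_succ_choose_two (n : ℕ) : ((n + 1).choose 2 : ℝ) = n * (n + 1) / 2 := by
  rw [Nat.cast_choose_two]
  push_cast
  ring

-- Written as the total minus one term per neighbour, to match the shape of the deficit in
-- `sum_side`.
open Classical in
theorem IsTree.ncard_pathsAvoiding (hG : G.IsTree) [Fintype N] (v : N) (O : Set N)
    (hO : ∀ w ∈ O, G.Adj v w) (hsub : O.Subsingleton) :
    ((G.pathsAvoiding v O).ncard : ℝ) = ((Fintype.card N + 1).choose 2 : ℝ) -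
      ∑ w with G.Adj v w ∧ w ∉ O, (((G.side w v).ncard + 1).choose 2 : ℝ) -
      ∑ w with w ∈ O, (((Fintype.card N + 1).choose 2 : ℝ) -
        (((G.side v w).ncard + 1).choose 2 : ℝ)) := by
  have h := hG.ncard_paths v O hO
  have h' : ((G.pathsAvoiding v O).ncard : ℝ) +
      ∑ w with G.Adj v w ∧ w ∉ O, (((G.side w v).ncard + 1).choose 2 : ℝ) =
      (({x | ∀ w ∈ O, x ∉ G.side w v}.ncard + 1).choose 2 : ℕ) := by
    rw [← h]; push_cast; rfl
  rcases hsub.eq_empty_or_singleton with rfl | ⟨w, rfl⟩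
  · have hD : {x | ∀ w ∈ (∅ : Set N), x ∉ G.side w v}.ncard = Fintype.card N := by
      have : {x | ∀ w ∈ (∅ : Set N), x ∉ G.side w v} = Set.univ := by ext; simp
      rw [this, Set.ncard_univ, Nat.card_eq_fintype_card]
    rw [hD] at h'
    have hs : @Finset.filter N (fun x => x ∈ (∅ : Set N)) (fun _ => Classical.propDecidable _)
        Finset.univ = ∅ := by ext; simp
    rw [hs, Finset.sum_empty]
    linarith
  · have hD : {x | ∀ w' ∈ ({w} : Set N), x ∉ G.side w' v} = G.side v w := by
      rw [hG.side_swap (hO w rfl).symm]; ext; simp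
    rw [hD] at h'
    have hs : @Finset.filter N (fun x => x ∈ ({w} : Set N)) (fun _ => Classical.propDecidable _)
        Finset.univ = {w} := by ext; simp
    rw [hs, Finset.sum_singleton]
    linarith

-- The reflection exchanges the two kinds of neighbours: for m + n = ν, the total C(ν+1,2) minus
-- C(m+1,2) is (ν+1)n - C(n+1,2), and the branches at `v` have ν - 1 vertices altogether. Positive
-- and negative vertices thus get the same formula in terms of source sets.
open Classical in
theorem IsTree.card_sub_ncard_pathsAvoiding (hG : G.IsTree) [Fintype N] (v : N) (O : Set N)
    (hO : ∀ w ∈ O, G.Adj v w) (hsub : O.Subsingleton) :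
    (Fintype.card N : ℝ) + 1 - ((G.pathsAvoiding v O).ncard : ℝ) =
      ((Fintype.card N + 1).choose 2 : ℝ) -
      ∑ w with w ∈ O, (((G.side w v).ncard + 1).choose 2 : ℝ) -
      ∑ w with G.Adj v w ∧ w ∉ O, (((Fintype.card N + 1).choose 2 : ℝ) -
        (((G.side v w).ncard + 1).choose 2 : ℝ)) := by
  have hc := hG.ncard_pathsAvoiding v O hO hsub
  have hflip : ∀ w, G.Adj v w → ((Fintype.card N + 1).choose 2 : ℝ) -
        (((G.side v w).ncard + 1).choose 2 : ℝ) =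
      ((Fintype.card N : ℝ) + 1) * ((G.side w v).ncard : ℝ) -
        (((G.side w v).ncard + 1).choose 2 : ℝ) := by
    intro w hw
    have h : ((G.side v w).ncard : ℝ) = Fintype.card N - ((G.side w v).ncard : ℝ) := by
      rw [eq_sub_iff_add_eq]
      exact_mod_cast hG.ncard_side_add hw
    simp only [cast_succ_choose_two, h]
    ring
  have hsplit : ∀ g : N → ℝ, ∑ w with G.Adj v w, g w =
      ∑ w with w ∈ O, g w + ∑ w with G.Adj v w ∧ w ∉ O, g w := by
    intro g
    rw [← Finset.sum_union]
    · refine Finset.sum_congr ?_ fun _ _ => rfl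
      ext w
      simp only [Finset.mem_filter, Finset.mem_univ, true_and, Finset.mem_union]
      have := hO w
      tauto
    · refine Finset.disjoint_left.2 fun w h1 h2 => ?_
      simp only [Finset.mem_filter, Finset.mem_univ, true_and] at h1 h2
      exact h2.2 h1
  have hcard : ∑ w with G.Adj v w, ((G.side w v).ncard : ℝ) = Fintype.card N - 1 := by
    rw [eq_sub_iff_add_eq]
    exact_mod_cast hG.sum_ncard_side v
  rw [hsplit] at hcard
  have h1 : ∑ w with w ∈ O, (((Fintype.card N + 1).choose 2 : ℝ) -
        (((G.side v w).ncard + 1).choose 2 : ℝ)) =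
      ((Fintype.card N : ℝ) + 1) * ∑ w with w ∈ O, ((G.side w v).ncard : ℝ) -
        ∑ w with w ∈ O, (((G.side w v).ncard + 1).choose 2 : ℝ) := by
    rw [Finset.mul_sum, ← Finset.sum_sub_distrib]
    exact Finset.sum_congr rfl fun w hw => hflip w (hO w (Finset.mem_filter.1 hw).2)
  have h2 : ∑ w with G.Adj v w ∧ w ∉ O, (((Fintype.card N + 1).choose 2 : ℝ) -
        (((G.side v w).ncard + 1).choose 2 : ℝ)) =
      ((Fintype.card N : ℝ) + 1) * ∑ w with G.Adj v w ∧ w ∉ O, ((G.side w v).ncard : ℝ) -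
        ∑ w with G.Adj v w ∧ w ∉ O, (((G.side w v).ncard + 1).choose 2 : ℝ) := by
    rw [Finset.mul_sum, ← Finset.sum_sub_distrib]
    exact Finset.sum_congr rfl fun w hw => hflip w (Finset.mem_filter.1 hw).2.1
  rw [hc, h1, h2, cast_succ_choose_two (Fintype.card N)]
  linear_combination ((Fintype.card N : ℝ) + 1) * hcard

end SimpleGraph

namespace SignedTree

open LabeledDigraph

variable {V : Type*} {T : SignedTree V} {S : LabeledDigraph V}

theorem IsSpine.eq_of_arc_of_neg (hS : T.IsSpine S) (h : S.IsSimple) {v w w' : V}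
    (hv : v ∈ T.neg) (hw : S.arc v w) (hw' : S.arc v w') : w = w' := by
  by_contra hne
  have hD := hS.isDirectedTree
  have hX : {v} ∩ T.negᶜ = ∅ := by simpa using hv
  exact hS.valley h ⟨w, w', hw, hw', hne, hD.notMem_sourceSet hw, hD.notMem_sourceSet hw'⟩
    (sameComponent_of_eq_empty hX _ _)

theorem IsSpine.eq_of_arc_of_pos (hS : T.IsSpine S) (h : S.IsSimple) {v w w' : V}
    (hv : v ∉ T.neg) (hw : S.arc w v) (hw' : S.arc w' v) : w = w' := by
  by_contra hne
  have hX : {v} ∩ T.neg = ∅ := by simpa using hv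
  exact hS.peak h ⟨w, w', hw, hw', hne, S.mem_sourceSet_self _ _, S.mem_sourceSet_self _ _⟩
    (sameComponent_of_eq_empty hX _ _)

theorem pathsAvoidingOut_eq (v : V) : S.pathsAvoidingOut v =
    S.graph.pathsAvoiding (S.node v) {A | S.NodeArc (S.node v) A} := by
  ext H
  refine and_congr_right fun _ => and_congr_right fun _ => ⟨fun h A hA => ?_, fun h w hw => ?_⟩
  · obtain ⟨w, rfl⟩ := S.node_surjective A
    exact h w (nodeArc_node.1 hA)
  · exact h _ (nodeArc_node.2 hw)

theorem pathsAvoidingIn_eq (v : V) : S.pathsAvoidingIn v =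
    S.graph.pathsAvoiding (S.node v) {A | S.NodeArc A (S.node v)} := by
  ext H
  refine and_congr_right fun _ => and_congr_right fun _ => ⟨fun h A hA => ?_, fun h w hw => ?_⟩
  · obtain ⟨w, rfl⟩ := S.node_surjective A
    exact fun h' => h w (nodeArc_node.1 hA) h'.symm
  · exact fun h' => h _ (nodeArc_node.2 hw) h'.symm

-- Give an arc with source set of size n the potential C(n+1,2), and the reversed arc its complement
-- to C(ν+1,2). The path counts say that a(S) is the deficit of this potential, so `sum_side`
-- returns the potential of each arc.
open Classical in
theorem IsSpine.sum_assoVertex [Fintype V] (hS : T.IsSpine S) (h : S.IsSimple) :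
    ∑ v, T.assoVertex S v = ((Fintype.card V + 1).choose 2 : ℝ) ∧
    ∀ (B : Finset V) (u w : V), S.arc u w → S.sourceSet u w = B →
      ∑ x ∈ B, T.assoVertex S x = ((B.card + 1).choose 2 : ℝ) := by
  have hD := hS.isDirectedTree
  have hG := hD.1
  let _ : Fintype S.Node := Fintype.ofFinite _
  let e : V ≃ S.Node := Equiv.ofBijective S.node h.node_bijective
  have he : ∀ v, e v = S.node v := fun _ => rfl
  have hcard : Fintype.card S.Node = Fintype.card V := (Fintype.card_congr e).symm
  let A : S.Node → S.Node → ℝ := fun P Q =>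
    if S.NodeArc P Q then (((S.graph.side P Q).ncard + 1).choose 2 : ℝ)
    else ((Fintype.card S.Node + 1).choose 2 : ℝ) - (((S.graph.side Q P).ncard + 1).choose 2 : ℝ)
  have hasym : ∀ P Q, S.NodeArc P Q → ¬ S.NodeArc Q P := by
    intro P Q
    obtain ⟨u, rfl⟩ := S.node_surjective P
    obtain ⟨w, rfl⟩ := S.node_surjective Q
    rw [nodeArc_node, nodeArc_node]
    exact hD.2 u w
  have hadj : ∀ P Q, S.graph.Adj P Q ↔ S.NodeArc P Q ∨ S.NodeArc Q P := by
    intro P Q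
    obtain ⟨u, rfl⟩ := S.node_surjective P
    obtain ⟨w, rfl⟩ := S.node_surjective Q
    rw [nodeArc_node, nodeArc_node, graph_adj_node]
    refine ⟨fun h => h.2, fun h => ⟨?_, h⟩⟩
    rcases h with h | h
    · exact hD.not_same h
    · exact fun h' => hD.not_same h (S.same.symm h')
  have hA : ∀ P Q, S.graph.Adj P Q → A P Q + A Q P =
      ((Fintype.card S.Node + 1).choose 2 : ℝ) := by
    intro P Q hPQ
    rcases (hadj P Q).1 hPQ with h1 | h1
    · simp only [A, if_pos h1, if_neg (hasym _ _ h1)]; ring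
    · simp only [A, if_pos h1, if_neg (hasym _ _ h1)]; ring
  have hsum : ∀ P, ∑ Q with S.graph.Adj P Q, A Q P =
      ∑ Q with S.NodeArc Q P, (((S.graph.side Q P).ncard + 1).choose 2 : ℝ) +
      ∑ Q with S.NodeArc P Q, (((Fintype.card S.Node + 1).choose 2 : ℝ) -
        (((S.graph.side P Q).ncard + 1).choose 2 : ℝ)) := by
    intro P
    rw [← Finset.sum_congr rfl (s₁ := Finset.univ.filter fun Q => S.NodeArc Q P)
      (f := fun Q => A Q P), ← Finset.sum_congr rfl (s₁ := Finset.univ.filter fun Q => S.NodeArc P Q)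
      (f := fun Q => A Q P), ← Finset.sum_union]
    · refine Finset.sum_congr ?_ fun _ _ => rfl
      ext Q
      simp only [Finset.mem_filter, Finset.mem_univ, true_and, Finset.mem_union, hadj]
      exact or_comm
    · refine Finset.disjoint_left.2 fun Q h1 h2 => ?_
      simp only [Finset.mem_filter, Finset.mem_univ, true_and] at h1 h2
      exact hasym _ _ h1 h2
    · intro Q hQ
      simp only [A, if_neg (hasym _ _ (Finset.mem_filter.1 hQ).2)]
    · intro Q hQ
      simp only [A, if_pos (Finset.mem_filter.1 hQ).2]
  have hα : ∀ P, T.assoVertex S (e.symm P) = ((Fintype.card S.Node + 1).choose 2 : ℝ) -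
      ∑ Q with S.graph.Adj P Q, A Q P := by
    intro P
    obtain ⟨v, rfl⟩ := e.surjective P
    rw [e.symm_apply_apply, he, hsum, assoVertex]
    by_cases hv : v ∈ T.neg
    · have hset : (Finset.univ.filter fun Q => S.graph.Adj (S.node v) Q ∧
          Q ∉ {A | S.NodeArc (S.node v) A}) = Finset.univ.filter fun Q => S.NodeArc Q (S.node v) := by
        ext Q
        simp only [Finset.mem_filter, Finset.mem_univ, true_and, hadj, Set.mem_ofPred_eq]
        have := hasym Q (S.node v)
        tauto
      rw [if_pos hv, pathsAvoidingOut_eq, hG.ncard_pathsAvoiding, hset]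
      · simp only [Set.mem_ofPred_eq]
        ring
      · exact fun Q hQ => (hadj _ _).2 (Or.inl hQ)
      · intro P hP Q hQ
        obtain ⟨p, rfl⟩ := S.node_surjective P
        obtain ⟨q, rfl⟩ := S.node_surjective Q
        rw [hS.eq_of_arc_of_neg h hv (nodeArc_node.1 hP) (nodeArc_node.1 hQ)]
    · have hset : (Finset.univ.filter fun Q => S.graph.Adj (S.node v) Q ∧
          Q ∉ {A | S.NodeArc A (S.node v)}) = Finset.univ.filter fun Q => S.NodeArc (S.node v) Q := by
        ext Q
        simp only [Finset.mem_filter, Finset.mem_univ, true_and, hadj, Set.mem_ofPred_eq]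
        have := hasym Q (S.node v)
        tauto
      rw [if_neg hv, pathsAvoidingIn_eq, ← hcard, hG.card_sub_ncard_pathsAvoiding, hset]
      · simp only [Set.mem_ofPred_eq]
        ring
      · exact fun Q hQ => (hadj _ _).2 (Or.inr hQ)
      · intro P hP Q hQ
        obtain ⟨p, rfl⟩ := S.node_surjective P
        obtain ⟨q, rfl⟩ := S.node_surjective Q
        rw [hS.eq_of_arc_of_pos h hv (nodeArc_node.1 hP) (nodeArc_node.1 hQ)]
  constructor
  · rw [← hcard, ← hG.sum_univ _ A _ hA hα]
    exact (Equiv.sum_comp e.symm _).symm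
  · intro B u w huw hB
    have h1 := hG.sum_side _ A _ hA hα (hD.adj huw)
    have hside : (Finset.univ.filter fun P => P ∈ S.graph.side (S.node u) (S.node w)) =
        B.map e.toEmbedding := by
      ext P
      obtain ⟨x, rfl⟩ := e.surjective P
      have hx : x ∈ S.sourceSet u w ↔ x ∈ B := by rw [hB]; rfl
      simp only [Finset.mem_filter, Finset.mem_univ, true_and, Finset.mem_map_equiv,
        e.symm_apply_apply, ← hx]
      rfl
    have hn : (S.graph.side (S.node u) (S.node w)).ncard = B.card := by
      rw [← Finset.card_map e.toEmbedding, ← hside, ← Set.ncard_coe_finset]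
      congr
      ext
      simp
    rw [hside, Finset.sum_map] at h1
    simp only [A, if_pos (nodeArc_node.2 huw), hn] at h1
    simpa using h1

end SignedTree

end

/-! ### The permutahedron, its cones, and Abel summation. -/

section Permutahedron

variable {V : Type*} [Fintype V]

theorem Finset.sum_range_succ_le_sum (s : Finset ℕ) :
    (s.card + 1).choose 2 ≤ ∑ i ∈ s, (i + 1) ∧
      (∑ i ∈ s, (i + 1) = (s.card + 1).choose 2 → s = Finset.range s.card) := by
  induction s using Finset.induction_on_max with
  | empty => simp
  | insert a s ha ih =>
    have has : a ∉ s := fun h => lt_irrefl _ (ha a h)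
    have hle : s.card ≤ a := by
      have := Finset.card_le_card (show s ⊆ Finset.range a from fun x hx => by simpa using ha x hx)
      simpa using this
    rw [Finset.sum_insert has, Finset.card_insert_of_notMem has]
    have hch : (s.card + 1 + 1).choose 2 = (s.card + 1) + (s.card + 1).choose 2 := by
      rw [Nat.choose_succ_succ' (s.card + 1) 1, Nat.choose_one_right]
    refine ⟨by omega, fun h => ?_⟩
    have h1 : a = s.card := by omega
    have h2 := ih.2 (by omega)
    rw [h1, Finset.range_add_one]
    conv_lhs => rw [h2]
    simp

theorem sum_permVertex_eq (σ : Fin (Fintype.card V) ≃ V) (B : Finset V) :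
    ∑ v ∈ B, permVertex σ v = ((∑ i ∈ B.image (fun v => (σ.symm v : ℕ)), (i + 1) : ℕ) : ℝ) := by
  rw [Finset.sum_image]
  · simp [permVertex]
  · intro x _ y _ h
    exact σ.symm.injective (Fin.ext h)

theorem card_image_symm (σ : Fin (Fintype.card V) ≃ V) (B : Finset V) :
    (B.image (fun v => (σ.symm v : ℕ))).card = B.card :=
  Finset.card_image_of_injective _ fun _ _ h => σ.symm.injective (Fin.ext h)

theorem le_sum_permVertex (σ : Fin (Fintype.card V) ≃ V) (B : Finset V) :
    ((B.card + 1).choose 2 : ℝ) ≤ ∑ v ∈ B, permVertex σ v := by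
  rw [sum_permVertex_eq, ← card_image_symm σ B]
  exact_mod_cast (Finset.sum_range_succ_le_sum _).1

/-- In the equality case the ranks of `B` are exactly the smallest ones. -/
theorem mem_of_sum_permVertex_eq (σ : Fin (Fintype.card V) ≃ V) {B : Finset V}
    (h : ∑ v ∈ B, permVertex σ v = ((B.card + 1).choose 2 : ℝ)) {x y : V}
    (hxy : σ.symm x < σ.symm y) (hy : y ∈ B) : x ∈ B := by
  rw [sum_permVertex_eq, ← card_image_symm σ B] at h
  have h' := (Finset.sum_range_succ_le_sum _).2 (by exact_mod_cast h)
  have hy' := Finset.mem_image_of_mem (fun v => (σ.symm v : ℕ)) hy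
  rw [h', Finset.mem_range] at hy'
  have hx : (σ.symm x : ℕ) ∈ Finset.range (B.image (fun v => (σ.symm v : ℕ))).card :=
    Finset.mem_range.2 (lt_trans hxy hy')
  rw [← h'] at hx
  obtain ⟨z, hz, hzx⟩ := Finset.mem_image.1 hx
  rwa [← σ.symm.injective (Fin.ext hzx)]

/-- The first `k` vertices. -/
def initialSet (σ : Fin (Fintype.card V) ≃ V) (k : ℕ) : Finset V :=
  Finset.univ.filter fun v => (σ.symm v : ℕ) < k

theorem mem_initialSet {σ : Fin (Fintype.card V) ≃ V} {k : ℕ} {v : V} :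
    v ∈ initialSet σ k ↔ (σ.symm v : ℕ) < k := by simp [initialSet]

theorem image_eq_initialSet (σ : Fin (Fintype.card V) ≃ V) (k : ℕ) :
    σ '' {i | (i : ℕ) < k} = initialSet σ k := by
  ext v
  rw [Finset.mem_coe, mem_initialSet]
  constructor
  · rintro ⟨i, hi, rfl⟩
    simpa using hi
  · intro h
    exact ⟨σ.symm v, h, by simp⟩

theorem initialSet_card (σ : Fin (Fintype.card V) ≃ V) :
    initialSet σ (Fintype.card V) = Finset.univ := by
  ext v; simp [mem_initialSet]

theorem initialSet_zero (σ : Fin (Fintype.card V) ≃ V) : initialSet σ 0 = ∅ := by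
  ext v; simp [mem_initialSet]

theorem sum_initialSet_succ (σ : Fin (Fintype.card V) ≃ V) (i : Fin (Fintype.card V)) (x : V → ℝ) :
    ∑ v ∈ initialSet σ (i + 1), x v = x (σ i) + ∑ v ∈ initialSet σ i, x v := by
  classical
  have : initialSet σ (i + 1) = insert (σ i) (initialSet σ i) := by
    ext v
    rw [Finset.mem_insert, mem_initialSet, mem_initialSet, Nat.lt_succ_iff_lt_or_eq, or_comm,
      ← Equiv.symm_apply_eq, Fin.ext_iff]
  rw [this, Finset.sum_insert (by simp [mem_initialSet])]

theorem sum_initialSet_permVertex (σ : Fin (Fintype.card V) ≃ V) {k : ℕ}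
    (hk : k ≤ Fintype.card V) :
    ∑ v ∈ initialSet σ k, permVertex σ v = ((k + 1).choose 2 : ℝ) := by
  induction k with
  | zero => simp [initialSet_zero]
  | succ k ih =>
    have := sum_initialSet_succ σ ⟨k, hk⟩ (permVertex σ)
    simp only at this
    rw [this, ih (by omega), Nat.choose_succ_succ' (k + 1) 1, Nat.choose_one_right]
    simp [permVertex]

theorem card_initialSet (σ : Fin (Fintype.card V) ≃ V) {k : ℕ} (hk : k ≤ Fintype.card V) :
    (initialSet σ k).card = k := by
  induction k with
  | zero => simp [initialSet_zero]
  | succ k ih =>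
    have := sum_initialSet_succ σ ⟨k, hk⟩ (fun _ => 1)
    simp only [Finset.sum_const, nsmul_eq_mul, mul_one, ih (by omega)] at this
    have h : (initialSet σ (k + 1)).card = 1 + k := by exact_mod_cast this
    omega

theorem eq_of_sum_initialSet_eq (σ : Fin (Fintype.card V) ≃ V) {x y : V → ℝ}
    (h : ∀ k ≤ Fintype.card V, ∑ v ∈ initialSet σ k, x v = ∑ v ∈ initialSet σ k, y v) : x = y := by
  funext v
  obtain ⟨i, rfl⟩ := σ.surjective v
  have h1 := h (i + 1) i.2
  rw [sum_initialSet_succ, sum_initialSet_succ, h i i.2.le] at h1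
  exact add_right_cancel h1

theorem permVertex_mem_hyperplaneH (σ : Fin (Fintype.card V) ≃ V) :
    permVertex σ ∈ hyperplaneH V := by
  have := sum_initialSet_permVertex σ le_rfl
  rwa [initialSet_card] at this

theorem permVertex_mem_Perm (σ : Fin (Fintype.card V) ≃ V) : permVertex σ ∈ Perm V :=
  subset_convexHull _ _ ⟨σ, rfl⟩

theorem convex_hyperplaneH : Convex ℝ (hyperplaneH V) := by
  intro x hx y hy a b _ _ hab
  change ∑ v, (a * x v + b * y v) = _
  rw [Finset.sum_add_distrib, ← Finset.mul_sum, ← Finset.mul_sum]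
  change ∑ v, x v = _ at hx
  change ∑ v, y v = _ at hy
  rw [hx, hy, ← add_mul, hab, one_mul]

omit [Fintype V] in
theorem convex_halfSpace (B : Finset V) : Convex ℝ (halfSpace B) := by
  intro x hx y hy a b ha hb hab
  change _ ≤ ∑ v ∈ B, (a * x v + b * y v)
  rw [Finset.sum_add_distrib, ← Finset.mul_sum, ← Finset.mul_sum]
  change _ ≤ ∑ v ∈ B, x v at hx
  change _ ≤ ∑ v ∈ B, y v at hy
  calc _ = a * ((B.card + 1).choose 2 : ℝ) + b * ((B.card + 1).choose 2 : ℝ) := by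
        rw [← add_mul, hab, one_mul]
    _ ≤ _ := add_le_add (mul_le_mul_of_nonneg_left hx ha) (mul_le_mul_of_nonneg_left hy hb)

theorem Perm_subset_hyperplaneH : Perm V ⊆ hyperplaneH V :=
  convexHull_min (by rintro _ ⟨σ, rfl⟩; exact permVertex_mem_hyperplaneH σ) convex_hyperplaneH

theorem Perm_subset_halfSpace (B : Finset V) : Perm V ⊆ halfSpace B :=
  convexHull_min (by rintro _ ⟨σ, rfl⟩; exact le_sum_permVertex σ B) (convex_halfSpace B)

theorem SignedTree.Perm_subset_Asso (T : SignedTree V) : Perm V ⊆ T.Asso := fun _ hx =>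
  ⟨Perm_subset_hyperplaneH hx, fun B _ => Perm_subset_halfSpace B hx⟩

theorem linear_nonneg_of_mem_hull {E : Type*} [AddCommGroup E] [Module ℝ E] {s : Set E}
    (L : E →ₗ[ℝ] ℝ) (h : ∀ x ∈ s, 0 ≤ L x) {y : E} (hy : y ∈ PointedCone.hull ℝ s) : 0 ≤ L y := by
  induction hy using Submodule.span_induction with
  | mem x hx => exact h x hx
  | zero => simp
  | add x y _ _ hx hy => rw [map_add]; exact add_nonneg hx hy
  | smul a x _ hx =>
    have : a • x = (a : ℝ) • x := rfl
    rw [this, map_smul]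
    exact mul_nonneg a.2 hx

open Classical in
/-- Abel summation: a vector whose initial sums are nonnegative and whose total sum vanishes is in the
incidence cone of the linear order. -/
theorem mem_incidenceCone_of_initial_sums [Nonempty V] (σ : Fin (Fintype.card V) ≃ V)
    {R : V → V → Prop} (hR : ∀ i j, i < j → R (σ i) (σ j)) {y : V → ℝ}
    (h : ∀ k < Fintype.card V, 0 ≤ ∑ v ∈ initialSet σ k, y v) (h0 : ∑ v, y v = 0) :
    y ∈ incidenceCone R := by
  have hpos : 0 < Fintype.card V := Fintype.card_pos
  -- The value 0 past the last index is never used: only `E i` with `i ≤ m < ν` occurs.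
  let E : ℕ → V → ℝ := fun i => if hi : i < Fintype.card V then Pi.single (σ ⟨i, hi⟩) 1 else 0
  have key : ∀ m, m < Fintype.card V →
      (fun v => if (σ.symm v : ℕ) < m + 1 then y v else 0) =
        (∑ v ∈ initialSet σ (m + 1), y v) • E m +
          ∑ i ∈ Finset.range m, (∑ v ∈ initialSet σ (i + 1), y v) • (E i - E (i + 1)) := by
    intro m
    induction m with
    | zero =>
      intro hm
      have hs := sum_initialSet_succ σ ⟨0, hm⟩ y
      simp only [initialSet_zero, Finset.sum_empty, add_zero] at hs
      rw [hs, Finset.sum_range_zero, add_zero]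
      funext v
      simp only [E, dif_pos hm, Pi.smul_apply, Pi.single_apply, smul_eq_mul, mul_ite, mul_one,
        mul_zero]
      by_cases hv : v = σ ⟨0, hm⟩
      · subst hv; simp
      · have hv' : (σ.symm v : ℕ) ≠ 0 := fun h' => hv (by
          rw [← Equiv.symm_apply_eq, Fin.ext_iff]; exact h')
        rw [if_neg hv, if_neg (by omega)]
    | succ m ih =>
      intro hm
      have hm' : m < Fintype.card V := by omega
      have hs := sum_initialSet_succ σ ⟨m + 1, hm⟩ y
      simp only at hs
      have hsplit : (fun v => if (σ.symm v : ℕ) < m + 1 + 1 then y v else 0) =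
          (fun v => if (σ.symm v : ℕ) < m + 1 then y v else 0) + y (σ ⟨m + 1, hm⟩) • E (m + 1) := by
        funext v
        simp only [E, dif_pos hm, Pi.add_apply, Pi.smul_apply, Pi.single_apply, smul_eq_mul,
          mul_ite, mul_one, mul_zero]
        by_cases hv : v = σ ⟨m + 1, hm⟩
        · subst hv; simp
        · have hv' : (σ.symm v : ℕ) ≠ m + 1 := fun h' => hv (by
            rw [← Equiv.symm_apply_eq, Fin.ext_iff]; exact h')
          rw [if_neg hv, add_zero]
          congr 1
          rw [eq_iff_iff]; omega
      rw [hsplit, ih hm', hs, Finset.sum_range_succ]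
      module
  obtain ⟨m, hm⟩ : ∃ m, Fintype.card V = m + 1 := ⟨Fintype.card V - 1, by omega⟩
  have hy : y = fun v => if (σ.symm v : ℕ) < m + 1 then y v else 0 := by
    funext v
    rw [if_pos (by rw [← hm]; exact (σ.symm v).2)]
  rw [hy, key m (by omega), ← hm, initialSet_card, h0, zero_smul, zero_add]
  refine Submodule.sum_mem _ fun i hi => ?_
  have him : i < m := Finset.mem_range.1 hi
  have hmem : E i - E (i + 1) ∈ incidenceCone R := by
    refine Submodule.subset_span ⟨σ ⟨i, by omega⟩, σ ⟨i + 1, by omega⟩, hR _ _ ?_, ?_⟩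
    · exact Fin.mk_lt_mk.2 (by omega)
    · simp only [E, dif_pos (show i < Fintype.card V by omega),
        dif_pos (show i + 1 < Fintype.card V by omega)]
  exact Submodule.smul_mem _ (⟨_, h (i + 1) (by omega)⟩ : {c : ℝ // 0 ≤ c}) hmem

-- Exchanging the values at `u` and `v` moves p(σ) along e_u - e_v by the positive difference of
-- their ranks.
open Classical in
theorem single_sub_single_mem_vertexCone (σ : Fin (Fintype.card V) ≃ V) {u v : V}
    (h : σ.symm u < σ.symm v) :
    (Pi.single u 1 - Pi.single v 1 : V → ℝ) ∈ vertexCone (Perm V) (permVertex σ) := by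
  let τ : Fin (Fintype.card V) ≃ V := σ.trans (Equiv.swap u v)
  have hd : (0 : ℝ) < (σ.symm v : ℕ) - (σ.symm u : ℕ) := by
    rw [sub_pos]; exact_mod_cast h
  have hne : u ≠ v := by rintro rfl; exact lt_irrefl _ h
  have hmem : permVertex τ - permVertex σ ∈ vertexCone (Perm V) (permVertex σ) :=
    Submodule.subset_span ⟨_, permVertex_mem_Perm τ, rfl⟩
  have heq : (Pi.single u 1 - Pi.single v 1 : V → ℝ) =
      ((σ.symm v : ℕ) - (σ.symm u : ℕ) : ℝ)⁻¹ • (permVertex τ - permVertex σ) := by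
    rw [eq_inv_smul_iff₀ hd.ne']
    funext z
    simp only [Pi.smul_apply, Pi.sub_apply, Pi.single_apply, smul_eq_mul, permVertex, τ,
      Equiv.symm_trans_apply, Equiv.symm_swap]
    by_cases hzu : z = u
    · subst hzu; simp [hne]
    · by_cases hzv : z = v
      · subst hzv; simp [hzu]
      · simp [hzu, hzv, Equiv.swap_apply_of_ne_of_ne hzu hzv]
  rw [heq]
  exact Submodule.smul_mem _ (⟨_, (inv_pos.2 hd).le⟩ : {c : ℝ // 0 ≤ c}) hmem

theorem incidenceCone_le_vertexCone (σ : Fin (Fintype.card V) ≃ V) {R : V → V → Prop}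
    (hR : ∀ u v, R u v → u = v ∨ σ.symm u < σ.symm v) :
    incidenceCone R ≤ vertexCone (Perm V) (permVertex σ) := by
  classical
  refine Submodule.span_le.2 ?_
  rintro _ ⟨u, v, huv, rfl⟩
  rcases hR u v huv with rfl | h
  · convert Submodule.zero_mem (vertexCone (Perm V) (permVertex σ))
    simp
  · exact SetLike.mem_coe.2 (by convert single_sub_single_mem_vertexCone σ h)

omit [Fintype V] in
theorem vertexCone_mono {P Q : Set (V → ℝ)} (h : P ⊆ Q) (p : V → ℝ) :
    vertexCone P p ≤ vertexCone Q p :=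
  Submodule.span_mono fun _ ⟨x, hx, e⟩ => ⟨x, h hx, e⟩

/-- The inequalities of the proper initial sets are tight at p(σ) and are all that Abel summation
needs, so the bound serves both Perm(V) and Asso(T). -/
theorem vertexCone_le_incidenceCone [Nonempty V] (σ : Fin (Fintype.card V) ≃ V)
    {R : V → V → Prop} (hR : ∀ i j, i < j → R (σ i) (σ j)) {P : Set (V → ℝ)}
    (hP : P ⊆ hyperplaneH V) (h : ∀ k, 1 ≤ k → k < Fintype.card V → P ⊆ halfSpace (initialSet σ k)) :
    vertexCone P (permVertex σ) ≤ incidenceCone R := by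
  refine Submodule.span_le.2 ?_
  rintro _ ⟨x, hx, rfl⟩
  refine mem_incidenceCone_of_initial_sums σ hR (fun k hk => ?_) ?_
  · simp only [Pi.sub_apply, Finset.sum_sub_distrib, sum_initialSet_permVertex σ hk.le, sub_nonneg]
    rcases Nat.eq_zero_or_pos k with rfl | hk0
    · simp [initialSet_zero]
    · have := h k hk0 hk hx
      change _ ≤ ∑ v ∈ initialSet σ k, x v at this
      rwa [card_initialSet σ hk.le] at this
  · simp only [Pi.sub_apply, Finset.sum_sub_distrib]
    have h1 : ∑ v, x v = _ := hP hx
    have h2 : ∑ v, permVertex σ v = _ := permVertex_mem_hyperplaneH σ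
    rw [h1, h2, sub_self]

/-- The functional `x ↦ ∑ g v * x v`. -/
def dotFunctional (g : V → ℝ) : (V → ℝ) →ₗ[ℝ] ℝ where
  toFun x := ∑ v, g v * x v
  map_add' x y := by simp [mul_add, Finset.sum_add_distrib]
  map_smul' a x := by
    simp only [Pi.smul_apply, smul_eq_mul, RingHom.id_apply, Finset.mul_sum]
    exact Finset.sum_congr rfl fun v _ => by ring

theorem mem_normalConeAt_iff {P : Set (V → ℝ)} {p g : V → ℝ} (hp : p ∈ P) :
    g ∈ normalConeAt P p ↔ g ∈ hyperplaneH V ∧ ∀ y ∈ vertexCone P p, ∑ v, g v * y v ≤ 0 := by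
  refine and_congr_right fun _ => ⟨fun h y hy => ?_, fun h => ⟨⟨p, hp, rfl⟩, ?_⟩⟩
  · have := linear_nonneg_of_mem_hull (-dotFunctional g) (fun x hx => ?_) hy
    · simpa [dotFunctional] using this
    · obtain ⟨z, hz, rfl⟩ := hx
      have hz' : ∑ v, g v * z v ≤ ∑ v, g v * p v := h.2 ⟨z, hz, rfl⟩
      simp only [dotFunctional, LinearMap.neg_apply, LinearMap.coe_mk, AddHom.coe_mk, Pi.sub_apply,
        mul_sub, Finset.sum_sub_distrib]
      linarith
  · rintro _ ⟨z, hz, rfl⟩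
    have := h (z - p) (Submodule.subset_span ⟨z, hz, rfl⟩)
    simp only [Pi.sub_apply, mul_sub, Finset.sum_sub_distrib] at this
    change ∑ v, g v * z v ≤ _
    linarith

theorem braidCone_subset_normalConeAt [Nonempty V] (σ : Fin (Fintype.card V) ≃ V) {g : V → ℝ}
    (hg : g ∈ hyperplaneH V) (h : ∀ i j, i < j → g (σ i) ≤ g (σ j)) :
    g ∈ normalConeAt (Perm V) (permVertex σ) := by
  classical
  refine (mem_normalConeAt_iff (permVertex_mem_Perm σ)).2 ⟨hg, fun y hy => ?_⟩
  have hy' := vertexCone_le_incidenceCone σ (R := fun u v => g u ≤ g v) h Perm_subset_hyperplaneH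
    (fun k _ _ => Perm_subset_halfSpace _) hy
  have := linear_nonneg_of_mem_hull (-dotFunctional g) (fun x hx => ?_) hy'
  · simpa [dotFunctional] using this
  · obtain ⟨u, v, huv, rfl⟩ := hx
    simpa [dotFunctional, mul_sub, Finset.sum_sub_distrib, Pi.single_apply] using huv

theorem le_of_mem_normalConeAt_Perm (σ : Fin (Fintype.card V) ≃ V) {g : V → ℝ}
    (hg : g ∈ normalConeAt (Perm V) (permVertex σ)) {u v : V} (h : σ.symm u < σ.symm v) :
    g u ≤ g v := by
  classical
  have := ((mem_normalConeAt_iff (permVertex_mem_Perm σ)).1 hg).2 _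
    (single_sub_single_mem_vertexCone σ h)
  simpa [mul_sub, Finset.sum_sub_distrib, Pi.single_apply] using this

/-- Functionals are required to lie in the hyperplane; a constant shift changes neither comparisons
of coordinates nor the maximizers on a polytope in the hyperplane. -/
theorem exists_add_const_mem_hyperplaneH [Nonempty V] (g : V → ℝ) :
    ∃ c : ℝ, (fun v => g v + c) ∈ hyperplaneH V := by
  have h : (Fintype.card V : ℝ) ≠ 0 := by exact_mod_cast Fintype.card_ne_zero
  refine ⟨(((Fintype.card V + 1).choose 2 : ℝ) - ∑ v, g v) / Fintype.card V, ?_⟩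
  change ∑ v, (g v + _) = _
  rw [Finset.sum_add_distrib, Finset.sum_const, Finset.card_univ, nsmul_eq_mul,
    mul_div_cancel₀ _ h]
  ring

end Permutahedron

/-! ### Spines whose source sets are initial segments. -/

namespace LabeledDigraph

variable {V : Type*} {S : LabeledDigraph V} {lt : V → V → Prop}

/-- All source label sets are initial segments of the order. -/
def SourcesInitial (S : LabeledDigraph V) (lt : V → V → Prop) : Prop :=
  ∀ u w, S.arc u w → ∀ x y, lt x y → y ∈ S.sourceSet u w → x ∈ S.sourceSet u w

/-- In each other case of `turn` some source set contains `y` but not `x`. -/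
theorem IsSimple.below_of_sourcesInitial (h : S.IsSimple) (hD : S.IsDirectedTree)
    [IsStrictTotalOrder V lt] (hT : S.SourcesInitial lt) {x y : V} (hxy : lt x y) :
    S.Below x y := by
  rcases h.turn hD x y with e | e | e | ⟨w, hw, a, b, ha, hb, hab, hx, hy⟩ |
    ⟨w, hw, a, b, ha, hb, hab, hx, hy⟩
  · subst e
    exact absurd hxy (irrefl x)
  · exact e
  · obtain ⟨c, hc, hcx⟩ := Relation.TransGen.head'_iff.1 e
    have hx := hT _ _ hc _ _ hxy (S.mem_sourceSet_self _ _)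
    refine absurd ?_ (hD.notMem_sourceSet hc)
    rcases Relation.reflTransGen_iff_eq_or_transGen.1 hcx with h' | h'
    · subst h'; exact hx
    · exact hD.mem_sourceSet_of_below hc h' hx
  · exact absurd (hT _ _ hb _ _ hxy hy)
      (hD.disjoint_sources ha hb (fun h' => hab (h _ _ h')) hx)
  · have hdis := hD.op.disjoint_sources (S := S.op) (a := b) (b := a) (w := w) (x := y) hb ha
      (fun h' => hab (h _ _ h').symm)
    rw [S.sourceSet_op, S.sourceSet_op, hD.sinkSet_eq ha, hD.sinkSet_eq hb] at hdis
    exact absurd (hT _ _ ha _ _ hxy (not_not.1 (hdis hy))) hx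

theorem IsDirectedTree.sourcesInitial (hD : S.IsDirectedTree)
    (h : ∀ x y, lt x y → S.Below x y) : S.SourcesInitial lt := fun _ _ huw x y hxy hy =>
  hD.mem_sourceSet_of_below huw (h x y hxy) hy

theorem IsDirectedTree.below_iff (hD : S.IsDirectedTree) [IsStrictTotalOrder V lt]
    (h : ∀ x y, lt x y → S.Below x y) (x y : V) : S.Below x y ↔ lt x y := by
  refine ⟨fun hb => ?_, h x y⟩
  rcases trichotomous_of lt x y with h' | rfl | h'
  · exact h'
  · exact absurd hb (hD.not_below_self x)
  · exact absurd (Relation.TransGen.trans hb (h _ _ h')) (hD.not_below_self x)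

theorem IsSimple.le_iff (h : S.IsSimple) (hD : S.IsDirectedTree) [IsStrictTotalOrder V lt]
    (hT : ∀ x y, lt x y → S.Below x y) (x y : V) : S.Le x y ↔ (x = y ∨ lt x y) := by
  refine or_congr ⟨h x y, ?_⟩ (hD.below_iff hT x y)
  rintro rfl
  exact S.same.refl _

theorem IsDirectedTree.mem_sourceSet_of_le (hD : S.IsDirectedTree) {u w x y : V} (h : S.arc u w)
    (hxy : S.Le x y) (hy : y ∈ S.sourceSet u w) : x ∈ S.sourceSet u w := by
  rcases hxy with h' | h'
  · exact (S.mem_sourceSet_congr h').2 hy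
  · exact hD.mem_sourceSet_of_below h h' hy

section

variable [Fintype V] [IsStrictTotalOrder V lt] {σ : Fin (Fintype.card V) ≃ V}

theorem IsSimple.arc_iff_consecutive (h : S.IsSimple) (hD : S.IsDirectedTree)
    (hσ : ∀ i j, lt (σ i) (σ j) ↔ i < j) (hT : ∀ x y, lt x y → S.Below x y)
    (i j : Fin (Fintype.card V)) : S.arc (σ i) (σ j) ↔ (i : ℕ) + 1 = j := by
  rw [h.arc_iff hD]
  simp only [hD.below_iff hT, hσ, σ.surjective.forall]
  constructor
  · rintro ⟨h1, h2⟩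
    by_contra hne
    have h1' : (i : ℕ) < j := h1
    exact h2 ⟨i + 1, by omega⟩ (Fin.mk_lt_mk.2 (by omega) : i < _)
      (show (i : ℕ) + 1 < j by omega)
  · intro hij
    refine ⟨show (i : ℕ) < j by omega, fun k hk hkj => ?_⟩
    have h1 : (i : ℕ) < k := hk
    have h2 : (k : ℕ) < j := hkj
    omega

omit [IsStrictTotalOrder V lt] in
theorem below_of_arc_consecutive (ha : ∀ i j : Fin (Fintype.card V), (i : ℕ) + 1 = j →
    S.arc (σ i) (σ j)) (hσ : ∀ i j, lt (σ i) (σ j) ↔ i < j) (x y : V) (hxy : lt x y) :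
    S.Below x y := by
  obtain ⟨i, rfl⟩ := σ.surjective x
  obtain ⟨⟨j, hj⟩, rfl⟩ := σ.surjective y
  rw [hσ] at hxy
  have hij : (i : ℕ) < j := hxy
  clear hxy
  induction j with
  | zero => omega
  | succ j ih =>
    have hlast : S.arc (σ ⟨j, by omega⟩) (σ ⟨j + 1, hj⟩) := ha _ _ rfl
    by_cases hi : (i : ℕ) = j
    · have : i = ⟨j, by omega⟩ := Fin.ext hi
      rw [this]
      exact Relation.TransGen.single hlast
    · exact Relation.TransGen.tail (ih (by omega) (by omega)) hlast

omit [IsStrictTotalOrder V lt] in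
theorem IsDirectedTree.sourceSet_consecutive (hD : S.IsDirectedTree)
    (hσ : ∀ i j, lt (σ i) (σ j) ↔ i < j) (hT : ∀ x y, lt x y → S.Below x y)
    {i j : Fin (Fintype.card V)} (hij : (i : ℕ) + 1 = j) (ha : S.arc (σ i) (σ j)) :
    S.sourceSet (σ i) (σ j) = initialSet σ j := by
  ext x
  obtain ⟨k, rfl⟩ := σ.surjective x
  rw [Finset.mem_coe, mem_initialSet, Equiv.symm_apply_apply]
  have hini := hD.sourcesInitial hT _ _ ha
  constructor
  · intro hk
    by_contra hc
    refine hD.notMem_sourceSet ha ?_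
    by_cases hkj : k = j
    · exact hkj ▸ hk
    · refine hini _ _ ((hσ _ _).2 ?_) hk
      exact lt_of_le_of_ne (show (j : ℕ) ≤ k by omega) (Ne.symm hkj)
  · intro hk
    by_cases hki : k = i
    · rw [hki]; exact S.mem_sourceSet_self _ _
    · refine hini _ _ ((hσ _ _).2 ?_) (S.mem_sourceSet_self _ _)
      exact lt_of_le_of_ne (show (k : ℕ) ≤ i by omega) hki

/-- The arc `a → b` cutting off the first `j` vertices starts inside and ends outside. If `a` were
earlier than `σ i`, it would also cross the cut of the first `i` vertices, hence be the arc of that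
cut, though the cuts differ; likewise for `b` with the first `j + 1`. -/
theorem IsSimple.arc_of_isSourceSet (h : S.IsSimple) (hD : S.IsDirectedTree)
    (hs : ∀ k, 1 ≤ k → k < Fintype.card V → S.IsSourceSet (initialSet σ k))
    {i j : Fin (Fintype.card V)} (hij : (i : ℕ) + 1 = j) : S.arc (σ i) (σ j) := by
  obtain ⟨a, b, hab, hset⟩ := hs j (by omega) j.2
  have mem : ∀ x, x ∈ S.sourceSet a b ↔ (σ.symm x : ℕ) < j := fun x => by
    rw [hset, Finset.mem_coe, mem_initialSet]
  have ha := (mem a).1 (S.mem_sourceSet_self _ _)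
  have hb : ¬ (σ.symm b : ℕ) < j := fun hb => hD.notMem_sourceSet hab ((mem b).2 hb)
  have hai : a = σ i := by
    by_contra hne
    have hne' : (σ.symm a : ℕ) ≠ i := fun e => hne (by
      rw [← Equiv.symm_apply_eq, Fin.ext_iff]; exact e)
    obtain ⟨a', b', hab', hset'⟩ := hs i (by omega) i.2
    have mem' : ∀ x, x ∈ S.sourceSet a' b' ↔ (σ.symm x : ℕ) < i := fun x => by
      rw [hset', Finset.mem_coe, mem_initialSet]
    rcases h.cut hD hab' hab with h' | ⟨rfl, rfl⟩
    · rw [mem', mem'] at h'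
      omega
    · have h1 := (mem (σ i)).2 (by simp; omega)
      rw [mem'] at h1
      simp at h1
  have hbj : b = σ j := by
    by_contra hne
    have hne' : (σ.symm b : ℕ) ≠ j := fun e => hne (by
      rw [← Equiv.symm_apply_eq, Fin.ext_iff]; exact e)
    obtain ⟨a', b', hab', hset'⟩ := hs (j + 1) (by omega) (by
      have := (σ.symm b).2; omega)
    have mem' : ∀ x, x ∈ S.sourceSet a' b' ↔ (σ.symm x : ℕ) < j + 1 := fun x => by
      rw [hset', Finset.mem_coe, mem_initialSet]
    rcases h.cut hD hab' hab with h' | ⟨rfl, rfl⟩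
    · rw [mem', mem'] at h'
      omega
    · have h1 := (mem' (σ j)).2 (by simp)
      rw [mem] at h1
      simp at h1
  rwa [hai, hbj] at hab

end

end LabeledDigraph

/-! ### Linear tests for initial source sets, and the equivalences. -/

namespace SignedTree

open LabeledDigraph

variable {V : Type*} [Fintype V] {T : SignedTree V} {S : LabeledDigraph V} {lt : V → V → Prop}

open Classical in
theorem IsSpine.sum_source_le (hS : T.IsSpine S) (h : S.IsSimple) {u w : V} (huw : S.arc u w)
    {x : V → ℝ} (hx : x ∈ T.Asso) :
    ∑ v with v ∈ S.sourceSet u w, T.assoVertex S v ≤ ∑ v with v ∈ S.sourceSet u w, x v := by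
  have hB : S.sourceSet u w = (Finset.univ.filter fun v => v ∈ S.sourceSet u w : Finset V) := by
    ext; simp
  rw [(hS.sum_assoVertex h).2 _ u w huw hB]
  refine hx.2 _ ?_
  rw [← hB]
  exact hS.isBuildingBlock_source h huw

open Classical in
/-- The sum of the coordinates in the source label set of an arc. -/
noncomputable def sourceSum (S : LabeledDigraph V) (u w : V) : (V → ℝ) →ₗ[ℝ] ℝ where
  toFun x := ∑ v with v ∈ S.sourceSet u w, x v
  map_add' x y := by simp [Finset.sum_add_distrib]
  map_smul' a x := by simp [Finset.mul_sum]

open Classical in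
theorem sourceSum_single_sub_single (u w x y : V) :
    sourceSum S u w (Pi.single x 1 - Pi.single y 1) =
      (if x ∈ S.sourceSet u w then 1 else 0) - (if y ∈ S.sourceSet u w then 1 else 0) := by
  simp [sourceSum, Pi.single_apply, Finset.sum_sub_distrib]

/-- A source sum is nonnegative on e_x - e_y exactly when `y` in the source set forces `x` into it.
-/
theorem sourcesInitial_of_sourceSum_nonneg {C : PointedCone ℝ (V → ℝ)}
    (hC : ∀ u w, S.arc u w → ∀ y ∈ C, 0 ≤ sourceSum S u w y)
    (hlt : incidenceCone (fun u v => u = v ∨ lt u v) ≤ C) : S.SourcesInitial lt := by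
  classical
  intro u w huw x y hxy hy
  by_contra hx
  have hmem : (Pi.single x 1 - Pi.single y 1 : V → ℝ) ∈ C := by
    refine hlt (Submodule.subset_span ⟨x, y, Or.inr hxy, ?_⟩)
    congr
  have := hC u w huw _ hmem
  rw [sourceSum_single_sub_single, if_neg hx, if_pos hy] at this
  linarith

theorem sourceSum_nonneg_of_mem_incidenceCone (hD : S.IsDirectedTree) {u w : V} (huw : S.arc u w)
    {y : V → ℝ} (hy : y ∈ incidenceCone S.Le) : 0 ≤ sourceSum S u w y := by
  classical
  refine linear_nonneg_of_mem_hull _ ?_ hy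
  rintro _ ⟨a, b, hab, rfl⟩
  have h1 := sourceSum_single_sub_single (S := S) u w a b
  have h2 : sourceSum S u w (Pi.single a 1 - Pi.single b 1) =
      (if a ∈ S.sourceSet u w then 1 else 0) - (if b ∈ S.sourceSet u w then 1 else 0) := by
    convert h1
  convert (show (0:ℝ) ≤ sourceSum S u w (Pi.single a 1 - Pi.single b 1) from ?_)
  rw [h2]
  by_cases hb : b ∈ S.sourceSet u w
  · rw [if_pos hb, if_pos (hD.mem_sourceSet_of_le huw hab hb), sub_self]
  · rw [if_neg hb, sub_zero]
    split_ifs <;> norm_num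

theorem IsSpine.sourceSum_nonneg_of_mem_vertexCone (hS : T.IsSpine S) (h : S.IsSimple) {u w : V}
    (huw : S.arc u w) {y : V → ℝ} (hy : y ∈ vertexCone T.Asso (T.assoVertex S)) :
    0 ≤ sourceSum S u w y := by
  refine linear_nonneg_of_mem_hull _ ?_ hy
  rintro _ ⟨x, hx, rfl⟩
  rw [map_sub, sub_nonneg]
  exact hS.sum_source_le h huw hx

open Classical in
/-- If the braid cone of the order contains all shifted indicators of the sink label sets, then the
source label sets are initial. -/
theorem sourcesInitial_of_indicator
    (hI : ∀ u w, S.arc u w → ∀ c : ℝ,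
      (fun v => (if v ∈ S.sourceSet u w then (0 : ℝ) else 1) + c) ∈ hyperplaneH V →
      ∀ x y, lt x y → (if x ∈ S.sourceSet u w then (0 : ℝ) else 1) + c ≤
        (if y ∈ S.sourceSet u w then (0 : ℝ) else 1) + c) :
    S.SourcesInitial lt := by
  intro u w huw x y hxy hy
  have : Nonempty V := ⟨u⟩
  obtain ⟨c, hc⟩ := exists_add_const_mem_hyperplaneH
    (fun v => if v ∈ S.sourceSet u w then (0 : ℝ) else 1)
  have := hI u w huw c hc x y hxy
  by_contra hx
  rw [if_neg hx, if_pos hy] at this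
  linarith

end SignedTree

namespace SignedTree

open LabeledDigraph

variable {V : Type*} [Fintype V] {T : SignedTree V} {S : LabeledDigraph V} {lt : V → V → Prop}
  {σ : Fin (Fintype.card V) ≃ V}

theorem lt_iff_symm_lt (hσ : ∀ i j, lt (σ i) (σ j) ↔ i < j) (x y : V) :
    lt x y ↔ σ.symm x < σ.symm y := by
  rw [← hσ, σ.apply_symm_apply, σ.apply_symm_apply]

theorem IsSpine.sourcesInitial_of_assoVertex_eq (hS : T.IsSpine S) (h : S.IsSimple)
    (hσ : ∀ i j, lt (σ i) (σ j) ↔ i < j) (he : T.assoVertex S = permVertex σ) :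
    S.SourcesInitial lt := by
  classical
  intro u w huw x y hxy hy
  have hB : S.sourceSet u w = (Finset.univ.filter fun v => v ∈ S.sourceSet u w : Finset V) := by
    ext; simp
  have hs := (hS.sum_assoVertex h).2 _ u w huw hB
  rw [he] at hs
  have := mem_of_sum_permVertex_eq σ hs ((lt_iff_symm_lt hσ x y).1 hxy) (by simpa using hy)
  simpa using this

theorem IsSpine.assoVertex_eq (hS : T.IsSpine S) (h : S.IsSimple) [IsStrictTotalOrder V lt]
    (hσ : ∀ i j, lt (σ i) (σ j) ↔ i < j) (hT : ∀ x y, lt x y → S.Below x y) :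
    T.assoVertex S = permVertex σ := by
  have hD := hS.isDirectedTree
  refine eq_of_sum_initialSet_eq σ fun k hk => ?_
  rw [sum_initialSet_permVertex σ hk]
  rcases Nat.eq_zero_or_pos k with rfl | hk0
  · simp [initialSet_zero]
  · rcases hk.lt_or_eq with hk' | rfl
    · have hij : ((⟨k - 1, by omega⟩ : Fin (Fintype.card V)) : ℕ) + 1 =
          (⟨k, hk'⟩ : Fin (Fintype.card V)) := by simp; omega
      have ha := (h.arc_iff_consecutive hD hσ hT _ _).2 hij
      have := (hS.sum_assoVertex h).2 _ _ _ ha (hD.sourceSet_consecutive hσ hT hij ha)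
      rwa [card_initialSet σ hk] at this
    · rw [initialSet_card]
      exact (hS.sum_assoVertex h).1

theorem IsSpine.Asso_subset_halfSpace (hS : T.IsSpine S) (h : S.IsSimple) [IsStrictTotalOrder V lt]
    (hσ : ∀ i j, lt (σ i) (σ j) ↔ i < j) (hT : ∀ x y, lt x y → S.Below x y) {k : ℕ} (hk0 : 1 ≤ k)
    (hk : k < Fintype.card V) : T.Asso ⊆ halfSpace (initialSet σ k) := by
  have hD := hS.isDirectedTree
  have hij : ((⟨k - 1, by omega⟩ : Fin (Fintype.card V)) : ℕ) + 1 =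
      (⟨k, hk⟩ : Fin (Fintype.card V)) := by simp; omega
  have ha := (h.arc_iff_consecutive hD hσ hT _ _).2 hij
  refine fun x hx => hx.2 _ ?_
  rw [← hD.sourceSet_consecutive hσ hT hij ha]
  exact hS.isBuildingBlock_source h ha

/-- The initial segments are building blocks, so the cone of Asso(T) lies in the incidence cone of
the order, hence in the cone of Perm(V); the reverse inclusion is that of the polytopes. -/
theorem IsSpine.vertexCone_eq (hS : T.IsSpine S) (h : S.IsSimple) [IsStrictTotalOrder V lt]
    (hσ : ∀ i j, lt (σ i) (σ j) ↔ i < j) (hT : ∀ x y, lt x y → S.Below x y) :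
    vertexCone T.Asso (permVertex σ) = vertexCone (Perm V) (permVertex σ) := by
  have : Nonempty V := T.isTree.connected.nonempty
  refine le_antisymm ?_ (vertexCone_mono T.Perm_subset_Asso _)
  refine (vertexCone_le_incidenceCone σ (R := lt) (fun i j hij => (hσ i j).2 hij)
    (fun x hx => hx.1) fun k hk0 hk => hS.Asso_subset_halfSpace h hσ hT hk0 hk).trans ?_
  exact incidenceCone_le_vertexCone σ fun u v huv => Or.inr ((lt_iff_symm_lt hσ u v).1 huv)

theorem IsSpine.normalConeAt_eq (hS : T.IsSpine S) (h : S.IsSimple) [IsStrictTotalOrder V lt]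
    (hσ : ∀ i j, lt (σ i) (σ j) ↔ i < j) (hT : ∀ x y, lt x y → S.Below x y) :
    normalConeAt T.Asso (permVertex σ) = normalConeAt (Perm V) (permVertex σ) := by
  ext g
  rw [mem_normalConeAt_iff (permVertex_mem_Perm σ),
    mem_normalConeAt_iff (T.Perm_subset_Asso (permVertex_mem_Perm σ)), hS.vertexCone_eq h hσ hT]

/-- If the cone of all functionals maximized at `a` contains the braid cone of a linear order, then
`a` is in the associahedron, because the permutation point is interior to the braid cone. -/
theorem mem_Asso_of_normalConeAt {a : V → ℝ} (ha : a ∈ hyperplaneH V)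
    (hN : ∀ g ∈ hyperplaneH V, (∀ i j, i < j → g (σ i) ≤ g (σ j)) → g ∈ normalConeAt T.Asso a) :
    a ∈ T.Asso := by
  have : Nonempty V := T.isTree.connected.nonempty
  have hmono : ∀ i j, i < j → permVertex σ (σ i) + 1 ≤ permVertex σ (σ j) := by
    intro i j hij
    simp only [permVertex, Equiv.symm_apply_apply]
    have : (i : ℕ) + 1 ≤ j := hij
    have : ((i : ℕ) : ℝ) + 1 ≤ (j : ℕ) := by exact_mod_cast this
    linarith
  -- `IsGreatest` only says that the value at `a` is attained somewhere in Asso(T); the aim is to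
  -- show that this happens at `a`.
  obtain ⟨y, hy, hya⟩ := (hN _ (permVertex_mem_hyperplaneH σ) fun i j hij => by
    linarith [hmono i j hij]).2.1
  change ∑ v, permVertex σ v * y v = _ at hya
  have hle : ∀ g : V → ℝ, (∀ i j, i < j → g (σ i) ≤ g (σ j)) →
      ∑ v, g v * y v ≤ ∑ v, g v * a v := by
    intro g hg
    obtain ⟨c, hc⟩ := exists_add_const_mem_hyperplaneH g
    have h1 : ∑ v, (g v + c) * y v ≤ ∑ v, (g v + c) * a v :=
      (hN _ hc fun i j hij => by simpa using hg i j hij).2.2 ⟨y, hy, rfl⟩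
    have h2 : ∑ v, y v = _ := hy.1
    have h3 : ∑ v, a v = _ := ha
    simp only [add_mul, Finset.sum_add_distrib, ← Finset.mul_sum, h2, h3] at h1
    linarith
  suffices h : y = a from h ▸ hy
  refine eq_of_sum_initialSet_eq σ fun k _ => ?_
  have hind : ∀ z : V → ℝ, ∑ v ∈ initialSet σ k, z v =
      ∑ v, (if (σ.symm v : ℕ) < k then (1 : ℝ) else 0) * z v := by
    intro z
    simp only [ite_mul, one_mul, zero_mul]
    rw [← Finset.sum_filter]
    rfl
  have hstep : ∀ i j : Fin (Fintype.card V), i < j →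
      (if (j : ℕ) < k then (1 : ℝ) else 0) ≤ (if (i : ℕ) < k then (1 : ℝ) else 0) ∧
      (if (i : ℕ) < k then (1 : ℝ) else 0) ≤ (if (j : ℕ) < k then (1 : ℝ) else 0) + 1 := by
    intro i j hij
    have : (i : ℕ) < j := hij
    split_ifs <;> first | omega | norm_num
  -- The coordinates of p(σ) grow by at least 1 along σ, so adding or subtracting the indicator of
  -- the first `k` vertices keeps them weakly increasing. The two inequalities give equal sums over
  -- these vertices.
  have h1 := hle (fun v => permVertex σ v + (if (σ.symm v : ℕ) < k then (1 : ℝ) else 0))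
    fun i j hij => by
      have h1 := hmono i j hij
      have h2 := (hstep i j hij).2
      simp only [Equiv.symm_apply_apply]
      linarith
  have h2 := hle (fun v => permVertex σ v - (if (σ.symm v : ℕ) < k then (1 : ℝ) else 0))
    fun i j hij => by
      have h1 := hmono i j hij
      have h2 := (hstep i j hij).1
      simp only [Equiv.symm_apply_apply]
      linarith
  simp only [add_mul, sub_mul, Finset.sum_add_distrib, Finset.sum_sub_distrib, hya] at h1 h2
  rw [hind, hind]
  linarith

open Classical in
theorem IsSpine.indicator_mem_normalConeAt (hS : T.IsSpine S) (h : S.IsSimple)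
    (ha : T.assoVertex S ∈ T.Asso) {u w : V} (huw : S.arc u w) {c : ℝ}
    (hc : (fun v => (if v ∈ S.sourceSet u w then (0 : ℝ) else 1) + c) ∈ hyperplaneH V) :
    (fun v => (if v ∈ S.sourceSet u w then (0 : ℝ) else 1) + c) ∈
      normalConeAt T.Asso (T.assoVertex S) := by
  refine ⟨hc, ⟨_, ha, rfl⟩, ?_⟩
  rintro _ ⟨x, hx, rfl⟩
  have hval : ∀ z ∈ T.Asso, ∑ v, ((if v ∈ S.sourceSet u w then (0 : ℝ) else 1) + c) * z v =
      (1 + c) * ((Fintype.card V + 1).choose 2 : ℝ) - ∑ v with v ∈ S.sourceSet u w, z v := by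
    intro z hz
    have hz' : ∑ v, z v = _ := hz.1
    rw [← hz', Finset.sum_filter, Finset.mul_sum, ← Finset.sum_sub_distrib]
    refine Finset.sum_congr rfl fun v _ => ?_
    split_ifs <;> ring
  simp only [hval x hx, hval _ ha]
  have := hS.sum_source_le h huw hx
  linarith

-- Sort first by membership in a source set that is not initial, its elements coming first, then by
-- the given order. A source set is a lower set, so this still extends `S`, and it inverts some
-- pair.
omit [Fintype V] in
theorem exists_linearExtension_of_not_sourcesInitial (hD : S.IsDirectedTree)
    [IsStrictTotalOrder V lt] (hlt : S.IsLinearExtension lt) (hT : ¬ S.SourcesInitial lt) :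
    ∃ lt', IsStrictTotalOrder V lt' ∧ S.IsLinearExtension lt' ∧ lt' ≠ lt := by
  simp only [SourcesInitial, not_forall] at hT
  obtain ⟨u, w, huw, x, y, hxy, hy, hx⟩ := hT
  set D := S.sourceSet u w
  refine ⟨fun a b => (a ∈ D ∧ b ∉ D) ∨ ((a ∈ D ↔ b ∈ D) ∧ lt a b), ?_, ?_, ?_⟩
  · refine { trichotomous := ?_, irrefl := ?_, trans := ?_ }
    · intro a b h1 h2
      rcases trichotomous_of lt a b with h | h | h
      · tauto
      · exact h
      · tauto
    · rintro a (⟨h1, h2⟩ | ⟨-, h⟩)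
      · exact h2 h1
      · exact irrefl a h
    · intro a b c h1 h2
      have ht : lt a b → lt b c → lt a c := _root_.trans
      tauto
  · intro a b hab
    have h1 := hlt a b hab
    have h2 : b ∈ D → a ∈ D := hD.mem_sourceSet_of_below huw hab
    tauto
  · intro he
    have := congrFun (congrFun he y) x
    exact asymm hxy (this.mp (Or.inl ⟨hy, hx⟩))

theorem IsMaximalSpine.tfae (hS : T.IsMaximalSpine S) (hlt : IsStrictTotalOrder V lt)
    (hσ : ∀ i j, lt (σ i) (σ j) ↔ i < j) :
    List.TFAE [
      T.assoVertex S = permVertex σ,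
      incidenceCone S.Le = incidenceCone (fun u v => u = v ∨ lt u v),
      vertexCone T.Asso (T.assoVertex S) = vertexCone (Perm V) (permVertex σ),
      braidCone S.Le = braidCone (fun u v => u = v ∨ lt u v),
      normalConeAt T.Asso (T.assoVertex S) = normalConeAt (Perm V) (permVertex σ),
      T.kappaFiber S = {lt},
      (∀ i, S.label (σ i) = {σ i}) ∧ ∀ i j, S.arc (σ i) (σ j) ↔ (i : ℕ) + 1 = j,
      S.IsDirectedPath ∧ ∀ u v, S.Le u v ↔ (u = v ∨ lt u v),
      ∀ i j : ℕ, 1 ≤ i → i < Fintype.card V → 1 ≤ j → j < Fintype.card V →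
        S.IsSourceSet (σ '' {k | (k : ℕ) < i}) ∧ S.IsSourceSet (σ '' {k | (k : ℕ) < j}) ∧
        (σ '' {k | (k : ℕ) < i} ⊆ σ '' {k | (k : ℕ) < j} ∨
          σ '' {k | (k : ℕ) < j} ⊆ σ '' {k | (k : ℕ) < i})] := by
  have : Nonempty V := T.isTree.connected.nonempty
  have h := hS.isSimple
  have hD := hS.1.isDirectedTree
  have hub : S.SourcesInitial lt → ∀ x y, lt x y → S.Below x y := fun hT x y =>
    h.below_of_sourcesInitial hD hT
  have hle : (∀ x y, lt x y → S.Below x y) → S.Le = fun u v => u = v ∨ lt u v := fun hT => by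
    funext x y
    exact propext (h.le_iff hD hT x y)
  have hlt' : ∀ u v, (u = v ∨ lt u v) → u = v ∨ σ.symm u < σ.symm v := fun u v huv =>
    huv.imp_right (lt_iff_symm_lt hσ u v).1
  -- Each statement is shown equivalent to this single condition.
  refine List.tfae_of_forall (∀ x y, lt x y → S.Below x y) _ ?_
  simp only [List.mem_cons, List.not_mem_nil, or_false, forall_eq_or_imp, forall_eq]
  refine ⟨⟨fun he => hub (hS.1.sourcesInitial_of_assoVertex_eq h hσ he),
      hS.1.assoVertex_eq h hσ⟩, ⟨fun he => hub ?_, fun hT => by rw [hle hT]⟩,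
    ⟨fun he => hub ?_, fun hT => ?_⟩, ⟨fun he => hub ?_, fun hT => by rw [hle hT]⟩,
    ⟨fun he => hub ?_, fun hT => ?_⟩, ⟨fun he => hub ?_, fun hT => ?_⟩, ⟨fun he => ?_, fun hT => ?_⟩,
    ⟨fun he => ?_, fun hT => ?_⟩, ⟨fun he => ?_, fun hT => ?_⟩⟩
  · exact sourcesInitial_of_sourceSum_nonneg
      (fun u w huw y hy => sourceSum_nonneg_of_mem_incidenceCone hD huw hy) he.ge
  · refine sourcesInitial_of_sourceSum_nonneg (C := vertexCone T.Asso (T.assoVertex S))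
      (fun u w huw y hy => hS.1.sourceSum_nonneg_of_mem_vertexCone h huw hy) ?_
    rw [he]
    exact incidenceCone_le_vertexCone σ hlt'
  · rw [hS.1.assoVertex_eq h hσ hT]
    exact hS.1.vertexCone_eq h hσ hT
  · classical
    refine sourcesInitial_of_indicator fun u w huw c hc x y hxy => ?_
    have hmem : (fun v => (if v ∈ S.sourceSet u w then (0 : ℝ) else 1) + c) ∈ braidCone S.Le := by
      refine ⟨hc, fun a b hab => ?_⟩
      have := hD.mem_sourceSet_of_le huw hab
      simp only
      split_ifs <;> first | tauto | norm_num
    rw [he] at hmem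
    convert hmem.2 x y (Or.inr hxy)
  · classical
    -- Membership of a(S) is not known beforehand, yet it is needed for its normal cone to contain
    -- the indicators of the sink sets.
    have ha : T.assoVertex S ∈ T.Asso := mem_Asso_of_normalConeAt (σ := σ)
      (hS.1.sum_assoVertex h).1 fun g hg hm => by
        rw [he]
        exact braidCone_subset_normalConeAt σ hg hm
    refine sourcesInitial_of_indicator fun u w huw c hc x y hxy => ?_
    have hmem := hS.1.indicator_mem_normalConeAt h ha huw (c := c) (by convert hc)
    rw [he] at hmem
    convert le_of_mem_normalConeAt_Perm σ hmem ((lt_iff_symm_lt hσ x y).1 hxy)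
  · rw [hS.1.assoVertex_eq h hσ hT]
    exact hS.1.normalConeAt_eq h hσ hT
  · by_contra hT
    have hmem : lt ∈ T.kappaFiber S := by rw [he]; rfl
    obtain ⟨lt', h1, h2, h3⟩ := exists_linearExtension_of_not_sourcesInitial hD
      ((mem_kappaFiber hS).1 hmem).2 hT
    have : lt' ∈ T.kappaFiber S := (mem_kappaFiber hS).2 ⟨h1, h2⟩
    rw [he] at this
    exact h3 this
  · ext lt'
    rw [mem_kappaFiber hS, Set.mem_singleton_iff]
    constructor
    · rintro ⟨h1, h2⟩
      funext x y
      refine propext ⟨fun hxy => ?_, fun hxy => h2 _ _ (hT _ _ hxy)⟩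
      rcases trichotomous_of lt x y with h' | rfl | h'
      · exact h'
      · exact absurd hxy (irrefl x)
      · exact absurd hxy (asymm (h2 _ _ (hT _ _ h')))
    · rintro rfl
      exact ⟨hlt, fun u v huv => (hD.below_iff hT u v).1 huv⟩
  · exact below_of_arc_consecutive (fun i j hij => (he.2 i j).2 hij) hσ
  · exact ⟨fun i => h.label_eq _, h.arc_iff_consecutive hD hσ hT⟩
  · intro x y hxy
    rcases (he.2 x y).2 (Or.inr hxy) with h' | h'
    · obtain rfl := h x y h'
      exact absurd hxy (irrefl x)
    · exact h'
  · refine ⟨⟨_, σ.trans (Equiv.ofBijective S.node h.node_bijective), fun i j => ?_⟩,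
      h.le_iff hD hT⟩
    exact nodeArc_node.trans (h.arc_iff_consecutive hD hσ hT i j)
  · refine below_of_arc_consecutive (fun i j hij => ?_) hσ
    refine h.arc_of_isSourceSet hD (fun k hk0 hk => ?_) hij
    rw [← image_eq_initialSet]
    exact (he k k hk0 hk hk0 hk).1
  · have hsrc : ∀ k, 1 ≤ k → k < Fintype.card V → S.IsSourceSet (σ '' {i | (i : ℕ) < k}) := by
      intro k hk0 hk
      have hij : ((⟨k - 1, by omega⟩ : Fin (Fintype.card V)) : ℕ) + 1 =
          (⟨k, hk⟩ : Fin (Fintype.card V)) := by simp; omega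
      have ha := (h.arc_iff_consecutive hD hσ hT _ _).2 hij
      rw [image_eq_initialSet]
      exact ⟨_, _, ha, hD.sourceSet_consecutive hσ hT hij ha⟩
    intro i j hi hi' hj hj'
    refine ⟨hsrc i hi hi', hsrc j hj hj', ?_⟩
    rcases le_total i j with hij | hij
    · exact Or.inl (Set.image_mono fun k hk => lt_of_lt_of_le (show (k : ℕ) < i from hk) hij)
    · exact Or.inr (Set.image_mono fun k hk => lt_of_lt_of_le (show (k : ℕ) < j from hk) hij)

end SignedTree

/-! ### Common vertices of the three polytopes. -/

section

open SimpleGraph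

theorem SimpleGraph.side_subset {N : Type*} {G : SimpleGraph N} {a b : N} {B : Set N} (ha : a ∈ B)
    (hB : ∀ x y, G.Adj x y → x ∈ B → s(x, y) ≠ s(a, b) → y ∈ B) : G.side a b ⊆ B := by
  intro x hx
  have h := (reachable_iff_reflTransGen a x).1 hx
  induction h with
  | refl => exact ha
  | tail h hxy ih =>
    rw [deleteEdges_adj] at hxy
    exact hB _ _ hxy.1 (ih ((reachable_iff_reflTransGen _ _).2 h)) hxy.2

/-- Two opposite consecutive steps would repeat a value, so the step is constant; n values within
[0, n) then fix the starting point. -/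
theorem eq_self_or_reverse_of_steps {n : ℕ} (g : ℕ → ℤ) (hn : 2 ≤ n)
    (h0 : ∀ i < n, 0 ≤ g i ∧ g i < n) (hinj : ∀ i < n, ∀ j < n, g i = g j → i = j)
    (hs : ∀ i, i + 1 < n → g (i + 1) = g i + 1 ∨ g (i + 1) = g i - 1) :
    (∀ i < n, g i = i) ∨ ∀ i < n, g i = n - 1 - i := by
  have step : ∀ i, i + 1 < n → g (i + 1) = g i + (g 1 - g 0) := by
    intro i
    induction i with
    | zero => intro _; simp
    | succ i ih =>
      intro hi
      have h1 := ih (by omega)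
      have h2 := hs (i + 1) hi
      have h3 := hs 0 (by omega)
      have h4 : g (i + 1 + 1) ≠ g i := fun e => by
        have := hinj _ hi _ (by omega) e
        omega
      simp only [zero_add] at h3
      omega
  have lin : ∀ i < n, g i = g 0 + i * (g 1 - g 0) := by
    intro i
    induction i with
    | zero => intro _; simp
    | succ i ih =>
      intro hi
      rw [step i hi, ih (by omega)]
      push_cast
      ring
  have hlast := lin (n - 1) (by omega)
  have hb0 := h0 0 (by omega)
  have hbl := h0 (n - 1) (by omega)
  have hcast : ((n - 1 : ℕ) : ℤ) = n - 1 := by omega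
  rw [hcast] at hlast
  rcases hs 0 (by omega) with h | h
  · left
    simp only [zero_add] at h
    intro i hi
    rw [lin i hi, h]
    rw [h] at hlast
    have : (g 0 + 1 - g 0) = 1 := by ring
    rw [this] at hlast ⊢
    linarith
  · right
    simp only [zero_add] at h
    intro i hi
    rw [lin i hi, h]
    rw [h] at hlast
    have : (g 0 - 1 - g 0) = -1 := by ring
    rw [this] at hlast ⊢
    linarith

namespace SignedTree

variable {V : Type*} [Fintype V] {T : SignedTree V} {σ τ : Fin (Fintype.card V) ≃ V}

theorem mem_edgeSide {u v x : V} : x ∈ T.edgeSide u v ↔ x ∈ T.graph.side u v := by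
  classical
  simp [edgeSide, SimpleGraph.side]

theorem coe_edgeSide (u v : V) : (T.edgeSide u v : Set V) = T.graph.side u v := by
  ext x
  exact mem_edgeSide

omit [Fintype V] in
theorem convexFor_side {X : Set V} {u v : V} (h : T.graph.Adj u v) :
    T.ConvexFor X (T.graph.side u v) := by
  classical
  intro x hx y hy p hp z hz _
  refine mem_side_of_notMem_support hx (p.takeUntil z hz) fun hv => ?_
  exact T.isTree.notMem_support h.symm hx hy hp (p.support_takeUntil_subset_support hz hv)

theorem Asso_subset_Para (T : SignedTree V) : T.Asso ⊆ T.Para := by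
  refine fun x hx => ⟨hx.1, fun u v h => hx.2 _ ?_⟩
  rw [coe_edgeSide]
  refine ⟨convexFor_side h, ?_⟩
  rw [← T.isTree.side_swap h]
  exact convexFor_side h.symm

theorem exists_perm_of_mem_commonVertices {x : V → ℝ} (hx : x ∈ T.commonVertices) :
    ∃ σ : Fin (Fintype.card V) ≃ V, permVertex σ = x := by
  have : x ∈ Set.range permVertex := extremePoints_convexHull_subset hx.1.1
  exact this

/-- Otherwise the point could move both ways along e_u - e_v, which changes only the sums over the
two sides of the edge `uv`. -/
theorem tight_of_mem_extremePoints_Para {x : V → ℝ} (hx : x ∈ T.Para.extremePoints ℝ) {u v : V}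
    (h : T.graph.Adj u v) :
    ∑ z ∈ T.edgeSide u v, x z = (((T.edgeSide u v).card + 1).choose 2 : ℝ) ∨
    ∑ z ∈ T.edgeSide v u, x z = (((T.edgeSide v u).card + 1).choose 2 : ℝ) := by
  classical
  by_contra! hc
  have h1 : _ ≤ ∑ z ∈ T.edgeSide u v, x z := hx.1.2 u v h
  have h2 : _ ≤ ∑ z ∈ T.edgeSide v u, x z := hx.1.2 v u h.symm
  have h1' := lt_of_le_of_ne h1 (Ne.symm hc.1)
  have h2' := lt_of_le_of_ne h2 (Ne.symm hc.2)
  set s1 := ∑ z ∈ T.edgeSide u v, x z - (((T.edgeSide u v).card + 1).choose 2 : ℝ) with hs1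
  set s2 := ∑ z ∈ T.edgeSide v u, x z - (((T.edgeSide v u).card + 1).choose 2 : ℝ) with hs2
  have hε : 0 < min s1 s2 := lt_min (by linarith) (by linarith)
  set ε := min s1 s2
  have hε1 : ε ≤ s1 := min_le_left _ _
  have hε2 : ε ≤ s2 := min_le_right _ _
  let d : V → ℝ := Pi.single u 1 - Pi.single v 1
  have hd : ∀ B : Finset V, ∑ z ∈ B, d z =
      (if u ∈ B then (1 : ℝ) else 0) - (if v ∈ B then 1 else 0) := fun B => by
    simp [d, Pi.single_apply, Finset.sum_sub_distrib]
  have mem : ∀ c : ℝ, |c| ≤ ε → x + c • d ∈ T.Para := by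
    intro c hcε
    obtain ⟨hc1, hc2⟩ := abs_le.1 hcε
    refine ⟨?_, fun a b hab => ?_⟩
    · change ∑ z, (x z + c * d z) = _
      rw [Finset.sum_add_distrib, ← Finset.mul_sum, hd]
      have hH : ∑ z, x z = _ := hx.1.1
      simpa using hH
    · change _ ≤ ∑ z ∈ T.edgeSide a b, (x z + c * d z)
      have hxab : _ ≤ ∑ z ∈ T.edgeSide a b, x z := hx.1.2 a b hab
      rw [Finset.sum_add_distrib, ← Finset.mul_sum, hd]
      by_cases hu : u ∈ T.edgeSide a b <;> by_cases hv : v ∈ T.edgeSide a b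
      · simpa [hu, hv] using hxab
      · obtain ⟨rfl, rfl⟩ := T.isTree.eq_of_crossing hab h (mem_edgeSide.1 hu)
          (fun h' => hv (mem_edgeSide.2 h'))
        simp only [hu, hv, if_true, if_false]
        linarith
      · obtain ⟨rfl, rfl⟩ := T.isTree.eq_of_crossing hab h.symm (mem_edgeSide.1 hv)
          (fun h' => hu (mem_edgeSide.2 h'))
        simp only [hu, hv, if_true, if_false]
        linarith
      · simpa [hu, hv] using hxab
  have hmid : x ∈ openSegment ℝ (x + ε • d) (x + (-ε) • d) := by
    refine ⟨1 / 2, 1 / 2, by norm_num, by norm_num, by norm_num, ?_⟩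
    module
  have heq := (mem_extremePoints.1 hx).2 _ (mem ε (by rw [abs_of_pos hε])) _
    (mem (-ε) (by rw [abs_neg, abs_of_pos hε])) hmid
  have hdu := congrFun heq.1 u
  simp [d, h.ne] at hdu
  exact hε.ne' hdu

/-- A set of vertices which is an initial segment of the order given by `σ`. -/
def IsInitial (σ : Fin (Fintype.card V) ≃ V) (B : Set V) : Prop :=
  ∀ x y, σ.symm x < σ.symm y → y ∈ B → x ∈ B

theorem isInitial_side_of_mem_commonVertices (hσ : permVertex σ ∈ T.commonVertices) {u v : V}
    (h : T.graph.Adj u v) : IsInitial σ (T.graph.side u v) ∨ IsInitial σ (T.graph.side v u) := by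
  have key : ∀ a b, ∑ z ∈ T.edgeSide a b, permVertex σ z =
      (((T.edgeSide a b).card + 1).choose 2 : ℝ) → IsInitial σ (T.graph.side a b) :=
    fun a b hab x y hxy hy => by
      rw [← mem_edgeSide] at hy ⊢
      exact mem_of_sum_permVertex_eq σ hab hxy hy
  exact (tight_of_mem_extremePoints_Para hσ.2 h).imp (key u v) (key v u)

/-- Otherwise the successor `z` of `u` lies strictly between `u` and `v`. It is in a branch at `u`
avoiding `v`, or in a branch at `v` avoiding `u`; neither side of the edge to this branch is then
initial, since the order meets `u`, `z`, `v` successively. -/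
theorem consecutive_of_isInitial (hI : ∀ u v, T.graph.Adj u v →
      IsInitial σ (T.graph.side u v) ∨ IsInitial σ (T.graph.side v u)) {u v : V}
    (h : T.graph.Adj u v) (hE : IsInitial σ (T.graph.side u v)) :
    (σ.symm u : ℕ) + 1 = σ.symm v := by
  have hG := T.isTree
  have hv : v ∉ T.graph.side u v := hG.notMem_side h
  have huv : σ.symm u < σ.symm v := by
    rcases lt_trichotomy (σ.symm u) (σ.symm v) with h' | h' | h'
    · exact h'
    · exact absurd (σ.symm.injective h') h.ne
    · exact absurd (hE v u h' (self_mem_side _ _)) hv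
  by_contra hne
  have huv' : (σ.symm u : ℕ) < σ.symm v := huv
  have hlt : (σ.symm u : ℕ) + 1 < Fintype.card V := by
    have := (σ.symm v).2
    omega
  set z := σ ⟨σ.symm u + 1, hlt⟩ with hz
  have hzi : (σ.symm z : ℕ) = σ.symm u + 1 := by simp [hz]
  have hzu : σ.symm u < σ.symm z := show (σ.symm u : ℕ) < σ.symm z by omega
  have hzv : σ.symm z < σ.symm v := show (σ.symm z : ℕ) < σ.symm v by omega
  have hzu' : z ≠ u := by rintro e; rw [e] at hzu; exact lt_irrefl _ hzu
  have hzv' : z ≠ v := by rintro e; rw [e] at hzv; exact lt_irrefl _ hzv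
  by_cases hzE : z ∈ T.graph.side u v
  · obtain ⟨y, hy, hzy⟩ := hG.exists_mem_side hzu'
    have hyv : y ≠ v := by
      rintro rfl
      rw [hG.side_swap h] at hzy
      exact hzy hzE
    have hvy : v ∈ T.graph.side u y := by
      rw [hG.side_swap hy.symm]
      exact hG.notMem_side_of_ne h hy hyv.symm (self_mem_side _ _)
    rcases hI u y hy with h' | h'
    · have := h' z v hzv hvy
      rw [hG.side_swap hy.symm] at this
      exact this hzy
    · exact hG.notMem_side hy.symm (h' u z hzu hzy)
  · obtain ⟨y, hy, hzy⟩ := hG.exists_mem_side hzv'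
    have hyu : y ≠ u := by
      rintro rfl
      exact hzE hzy
    have huy : u ∈ T.graph.side v y := by
      rw [hG.side_swap hy.symm]
      exact hG.notMem_side_of_ne h.symm hy hyu.symm (self_mem_side _ _)
    rcases hI v y hy with h' | h'
    · have := h' z v hzv (self_mem_side _ _)
      rw [hG.side_swap hy.symm] at this
      exact this hzy
    · have := h' u z hzu hzy
      rw [hG.side_swap hy.symm] at huy
      exact huy this

/-- The vertices in the order `σ` form a path which is the tree. -/
def IsPathOrder (T : SignedTree V) (σ : Fin (Fintype.card V) ≃ V) : Prop :=
  ∀ i j, T.graph.Adj (σ i) (σ j) ↔ (i : ℕ) + 1 = j ∨ (j : ℕ) + 1 = i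

/-- Edges join consecutive vertices only; if two consecutive vertices were not adjacent, no edge
would leave the initial segment ending at the first, against connectedness. -/
theorem isPathOrder_of_mem_commonVertices (hσ : permVertex σ ∈ T.commonVertices) :
    T.IsPathOrder σ := by
  have hI : ∀ u v, T.graph.Adj u v →
      IsInitial σ (T.graph.side u v) ∨ IsInitial σ (T.graph.side v u) := fun u v =>
    isInitial_side_of_mem_commonVertices hσ
  have hadj : ∀ u v, T.graph.Adj u v →
      (σ.symm u : ℕ) + 1 = σ.symm v ∨ (σ.symm v : ℕ) + 1 = σ.symm u := fun u v h =>
    (hI u v h).imp (consecutive_of_isInitial hI h) (consecutive_of_isInitial hI h.symm)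
  have hcons : ∀ i j : Fin (Fintype.card V), (i : ℕ) + 1 = j → T.graph.Adj (σ i) (σ j) := by
    intro i j hij
    by_contra hn
    have := induction_adj T.isTree.connected (P := fun x => (σ.symm x : ℕ) ≤ i) (σ i) (by simp)
      (fun x y hxy hx => ?_) (σ j)
    · simp at this
      omega
    · by_contra hy
      have h1 : (σ.symm x : ℕ) = i := by have := hadj x y hxy; omega
      have h2 : (σ.symm y : ℕ) = j := by have := hadj x y hxy; omega
      rw [← (Equiv.symm_apply_eq σ).1 (Fin.ext h1), ← (Equiv.symm_apply_eq σ).1 (Fin.ext h2)] at hn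
      exact hn hxy
  refine fun i j => ⟨fun h => ?_, ?_⟩
  · simpa using hadj _ _ h
  · rintro (h | h)
    · exact hcons i j h
    · exact (hcons j i h).symm

theorem IsPathOrder.isPathTree (h : T.IsPathOrder σ) : T.IsPathTree :=
  ⟨RelIso.symm ⟨σ, fun {i j} => by rw [h, pathGraph_adj]⟩⟩

theorem IsPathTree.exists_isPathOrder (h : T.IsPathTree) :
    ∃ σ : Fin (Fintype.card V) ≃ V, T.IsPathOrder σ := by
  obtain ⟨φ⟩ := h
  refine ⟨φ.symm.toEquiv, fun i j => ?_⟩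
  rw [← pathGraph_adj]
  exact φ.symm.map_rel_iff

theorem IsPathOrder.rev (h : T.IsPathOrder σ) : T.IsPathOrder (Fin.revPerm.trans σ) := by
  intro i j
  simp only [Equiv.trans_apply, Fin.revPerm_apply]
  rw [h, Fin.val_rev, Fin.val_rev]
  omega

theorem IsPathOrder.edgeSide_eq (h : T.IsPathOrder σ) {i j : Fin (Fintype.card V)}
    (hij : (i : ℕ) + 1 = j) : T.edgeSide (σ i) (σ j) = initialSet σ j := by
  have hadj : T.graph.Adj (σ i) (σ j) := (h i j).2 (Or.inl hij)
  have h1 : T.graph.side (σ i) (σ j) ⊆ {x | (σ.symm x : ℕ) < j} := by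
    refine side_subset (by simp; omega) fun x y hxy hx hne => ?_
    obtain ⟨k, rfl⟩ := σ.surjective x
    obtain ⟨l, rfl⟩ := σ.surjective y
    rw [h] at hxy
    simp only [Set.mem_ofPred_eq, Equiv.symm_apply_apply] at hx ⊢
    by_contra hc
    refine hne ?_
    rw [show k = i from Fin.ext (by omega), show l = j from Fin.ext (by omega)]
  have h2 : T.graph.side (σ j) (σ i) ⊆ {x | ¬ (σ.symm x : ℕ) < j} := by
    refine side_subset (by simp) fun x y hxy hx hne => ?_
    obtain ⟨k, rfl⟩ := σ.surjective x
    obtain ⟨l, rfl⟩ := σ.surjective y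
    rw [h] at hxy
    simp only [Set.mem_ofPred_eq, Equiv.symm_apply_apply] at hx ⊢
    intro hc
    refine hne ?_
    rw [show k = j from Fin.ext (by omega), show l = i from Fin.ext (by omega)]
  ext x
  rw [mem_edgeSide, mem_initialSet]
  refine ⟨fun hx => h1 hx, fun hx => ?_⟩
  by_contra hc
  refine h2 (?_ : x ∈ T.graph.side (σ j) (σ i)) hx
  rw [T.isTree.side_swap hadj]
  exact hc

/-- The edge inequalities with sides the initial segments are tight at p(σ) and, with the total sum,
determine it; so it is extreme in Para(T), and a fortiori in the smaller polytopes containing it. -/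
theorem IsPathOrder.mem_commonVertices (h : T.IsPathOrder σ) :
    permVertex σ ∈ T.commonVertices := by
  have hPerm := permVertex_mem_Perm σ
  have hAsso := T.Perm_subset_Asso hPerm
  have hPara : permVertex σ ∈ T.Para.extremePoints ℝ := by
    refine ⟨T.Asso_subset_Para hAsso, ?_⟩
    rintro x hx y hy ⟨a, b, ha, hb, hab, he⟩
    refine eq_of_sum_initialSet_eq σ fun k hk => ?_
    rw [sum_initialSet_permVertex σ hk]
    rcases Nat.eq_zero_or_pos k with rfl | hk0
    · simp [initialSet_zero]
    rcases hk.lt_or_eq with hk' | rfl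
    · have hij : ((⟨k - 1, by omega⟩ : Fin (Fintype.card V)) : ℕ) + 1 =
          (⟨k, hk'⟩ : Fin (Fintype.card V)) := by simp; omega
      have hle : ∀ z ∈ T.Para, ((k + 1).choose 2 : ℝ) ≤ ∑ v ∈ initialSet σ k, z v := by
        intro z hz
        have : _ ≤ ∑ v ∈ T.edgeSide _ _, z v := hz.2 _ _ ((h _ _).2 (Or.inl hij))
        rwa [h.edgeSide_eq hij, card_initialSet σ hk] at this
      have hx' := hle x hx
      have hy' := hle y hy
      have hs := sum_initialSet_permVertex σ hk
      rw [← he] at hs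
      simp only [Pi.add_apply, Pi.smul_apply, smul_eq_mul, Finset.sum_add_distrib,
        ← Finset.mul_sum] at hs
      nlinarith
    · rw [initialSet_card]
      exact hx.1
  refine ⟨⟨?_, ?_⟩, hPara⟩
  · exact inter_extremePoints_subset_extremePoints_of_subset
      (T.Perm_subset_Asso.trans T.Asso_subset_Para) ⟨hPerm, hPara⟩
  · exact inter_extremePoints_subset_extremePoints_of_subset T.Asso_subset_Para ⟨hAsso, hPara⟩

theorem IsPathOrder.eq_or_eq_rev (hV : 2 ≤ Fintype.card V) (hσ : T.IsPathOrder σ)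
    (hτ : T.IsPathOrder τ) : σ = τ ∨ σ = Fin.revPerm.trans τ := by
  have h := eq_self_or_reverse_of_steps (n := Fintype.card V)
    (fun i => if hi : i < Fintype.card V then ((τ.symm (σ ⟨i, hi⟩) : ℕ) : ℤ) else 0) hV
    (fun i hi => by
      simp only [dif_pos hi]
      have := (τ.symm (σ ⟨i, hi⟩)).2
      omega)
    (fun i hi j hj hij => by
      simp only [dif_pos hi, dif_pos hj] at hij
      have := σ.injective (τ.symm.injective (Fin.ext (by exact_mod_cast hij)))
      simpa using this)
    (fun i hi => by
      have hi' : i < Fintype.card V := by omega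
      simp only [dif_pos hi, dif_pos hi']
      have := (hσ ⟨i, hi'⟩ ⟨i + 1, hi⟩).2 (Or.inl rfl)
      rw [← τ.apply_symm_apply (σ ⟨i, hi'⟩), ← τ.apply_symm_apply (σ ⟨i + 1, hi⟩), hτ] at this
      omega)
  refine h.imp (fun h => ?_) fun h => ?_
  · ext i
    have := h i i.2
    simp only [dif_pos i.2] at this
    rw [← Equiv.symm_apply_eq]
    exact Fin.ext (by exact_mod_cast this)
  · ext i
    have := h i i.2
    simp only [dif_pos i.2] at this
    rw [Equiv.trans_apply, ← Equiv.symm_apply_eq]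
    refine Fin.ext ?_
    rw [Fin.revPerm_apply, Fin.val_rev]
    have hi := i.2
    simp only [Fin.eta] at this
    omega

theorem IsPathTree.ncard_commonVertices (hV : 2 ≤ Fintype.card V) (h : T.IsPathTree) :
    T.commonVertices.ncard = 2 := by
  obtain ⟨τ, hτ⟩ := h.exists_isPathOrder
  have hset : T.commonVertices = {permVertex τ, permVertex (Fin.revPerm.trans τ)} := by
    ext x
    constructor
    · intro hx
      obtain ⟨σ, rfl⟩ := exists_perm_of_mem_commonVertices hx
      rcases (isPathOrder_of_mem_commonVertices hx).eq_or_eq_rev hV hτ with rfl | rfl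
      · exact Or.inl rfl
      · exact Or.inr rfl
    · rintro (rfl | rfl)
      · exact hτ.mem_commonVertices
      · exact hτ.rev.mem_commonVertices
  rw [hset]
  refine Set.ncard_pair fun he => ?_
  -- The first vertex of τ has rank 0 in one order and ν - 1 in the other, which differ as ν ≥ 2.
  have := congrFun he (τ ⟨0, by omega⟩)
  simp only [permVertex, Equiv.symm_apply_apply, Equiv.symm_trans_apply, Fin.revPerm_symm,
    Fin.revPerm_apply, Fin.val_rev, add_left_inj, Nat.cast_inj] at this
  omega

theorem commonVertices_eq_empty (h : ¬ T.IsPathTree) : T.commonVertices = ∅ := by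
  by_contra hne
  obtain ⟨x, hx⟩ := Set.nonempty_iff_ne_empty.2 hne
  obtain ⟨σ, rfl⟩ := exists_perm_of_mem_commonVertices hx
  exact h (isPathOrder_of_mem_commonVertices hx).isPathTree

end SignedTree

end

theorem proposition74 {V : Type*} [Fintype V] (T : SignedTree V) :
    (∀ S : LabeledDigraph V, T.IsMaximalSpine S →
      ∀ lt : V → V → Prop, IsStrictTotalOrder V lt →
      ∀ σ : Fin (Fintype.card V) ≃ V, (∀ i j, lt (σ i) (σ j) ↔ i < j) →
      List.TFAE [
        -- (i) the vertices coincide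
        T.assoVertex S = permVertex σ,
        -- (ii) the incidence cones coincide
        incidenceCone S.Le = incidenceCone (fun u v => u = v ∨ lt u v),
        -- (ii) the cones of the two polytopes at these vertices coincide
        vertexCone T.Asso (T.assoVertex S) = vertexCone (Perm V) (permVertex σ),
        -- (iii) the braid cones coincide
        braidCone S.Le = braidCone (fun u v => u = v ∨ lt u v),
        -- (iii) the normal cones of the two polytopes at these vertices coincide
        normalConeAt T.Asso (T.assoVertex S) = normalConeAt (Perm V) (permVertex σ),
        -- (iv) the fiber of `S` is a singleton
        T.kappaFiber S = {lt},
        -- (v) `S` is a directed path whose `i`th node is labeled by `{σ i}`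
        (∀ i, S.label (σ i) = {σ i}) ∧ ∀ i j, S.arc (σ i) (σ j) ↔ (i : ℕ) + 1 = j,
        -- (vi) `S` is a directed path with transitive closure `lt`
        S.IsDirectedPath ∧ ∀ u v, S.Le u v ↔ (u = v ∨ lt u v),
        -- (vii) the proper non-empty initial segments are nested source label sets of `S`
        ∀ i j : ℕ, 1 ≤ i → i < Fintype.card V → 1 ≤ j → j < Fintype.card V →
          S.IsSourceSet (σ '' {k | (k : ℕ) < i}) ∧ S.IsSourceSet (σ '' {k | (k : ℕ) < j}) ∧
          (σ '' {k | (k : ℕ) < i} ⊆ σ '' {k | (k : ℕ) < j} ∨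
            σ '' {k | (k : ℕ) < j} ⊆ σ '' {k | (k : ℕ) < i})]) ∧
    (2 ≤ Fintype.card V →
      (T.IsPathTree → T.commonVertices.ncard = 2) ∧
      (¬ T.IsPathTree → T.commonVertices = ∅)) := by
  exact ⟨fun _ hS _ hlt _ hσ => hS.tfae hlt hσ, fun hV =>
    ⟨SignedTree.IsPathTree.ncard_commonVertices hV, SignedTree.commonVertices_eq_empty⟩⟩
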